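/- Let $p,q\in[1,\infty]$ with $1/p+1/q=1$. There are an algorithm and a polynomial $P$ with the following property. Let $d\ge 1$, $\varepsilon>0$, $\gamma>0$, $0\le\eta<1/2$, $0<\delta<1$. Put $\lambda=\frac{\varepsilon\gamma/2+\eta}{1+\varepsilon\gamma}$ and let $\phi(s)=\lambda(1-s/\gamma)$ for $s>\gamma$, $\phi(s)=(1-\lambda)(1-s/\gamma)$ for $s\le\gamma$. Given $d,\varepsilon,\gamma,\eta,\delta$ and access to labelled examples $(x_0,y_0),(x_1,y_1),\dots$ with $\|x_k\|_p\le 1$ and $y_k\in\{\pm1\}$, the algorithm computes the output $w\in\mathbb R^d$, with $\|w\|_q\le1$, of $T$ steps of Stochastic Mirror Descent (one example per step, step size $\alpha>0$; $T\ge1$ and $\alpha$ depend only on $p,d,\varepsilon,\gamma,\eta,\delta$) for the convex objective $G_\lambda^\gamma(w)=\mathbb E_{(x,y)\sim\mathcal D}[\phi(y\langle w,x\rangle)]$ over the ball $\{\|w\|_q\le1\}$. It takes at most $P\big(d,\tfrac1\varepsilon,\tfrac1\gamma,\tfrac1{1-2\eta},\log\tfrac1\delta\big)$ steps, where arithmetic,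 comparisons, $\exp$ and $\log$ on real numbers have unit cost and reading an example costs $d+1$. Here Stochastic Mirror Descent with potential $\psi$ on a feasible set $K$ starts at $w^0=\arg\min_K\psi$, iterates $w^{k+1}=\Pi^{\psi}_{K}\big((\nabla\psi)^{-1}(\nabla\psi(w^k)-\alpha g^k)\big)$ with $g^k$ a subgradient at $w^k$ of $w\mapsto\phi(y_k\langle w,x_k\rangle)$ and $\Pi^\psi_K$ the Bregman projection, and outputs $\frac1T\sum_{k<T}w^k$. For $1<q<\infty$ the potential is $\frac12\|w\|_q^2$; for $q=\infty$ it is $\frac12\|w\|_2^2$; for $q=1$ it is the entropy $\sum_i u_i\log u_i$ on the probability simplex of $\mathbb R^{2d}$, with $w=u^+-u^-$. Let $\mathcal D$ be any distribution of $(x,y)$ with $\|x\|_p\le1$ almost surely for which there is $w^*\in\mathbb R^d$ with $\|w^*\|_q\le1$ such that $|\langle w^*,x\rangle|>\gamma$ almost surely and, given $x$, the label $y$ equals $\operatorname{sign}\langle w^*,x\rangle$ with probability $1-\eta$ and $-\operatorname{sign}\langle w^*,x\rangle$ with probability $\eta$. If the examples are drawn independently from $\mathcal D$, then with probability at least $1-\delta$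 the output $w$ satisfies $$\Pr_{(x,y)\sim\mathcal D}\big[y\langle w,x\rangle\le\gamma/2\big]\le\eta+\varepsilon .$$ -/

import Mathlib

open MeasureTheory
open scoped ENNReal

noncomputable section

/-! ### Norms, labelled examples, random classification noise -/

/-- The `ℓ_p` norm of a finite real vector, `p ∈ [1, ∞]` (the supremum norm for `p = ∞`). -/
def vecNorm {ι : Type} [Fintype ι] (p : ℝ≥0∞) (v : ι → ℝ) : ℝ :=
  ‖(WithLp.toLp p v : PiLp p (fun _ : ι => ℝ))‖

/-- A labelled example `(x, y)` with `x ∈ ℝ^d` and a label `y`, which is `1` or `-1`. -/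
abbrev Example (d : ℕ) : Type := (Fin d → ℝ) × ℝ

/-- The halfspace `h_w(x) = sign ⟨w, x⟩`. -/
def halfspace {d : ℕ} (w x : Fin d → ℝ) : ℝ := Real.sign (w ⬝ᵥ x)

/-- `D` is generated by the halfspace `h_w` with random classification noise at rate `η`:
`x` is drawn from the marginal `D_x`, and independently of `x` the label is `h_w(x)` with
probability `1 - η` and `-h_w(x)` with probability `η`. -/
def IsRCN {d : ℕ} (D : Measure (Example d)) (w : Fin d → ℝ) (η : ℝ) : Prop :=
  D = ENNReal.ofReal (1 - η) • D.fst.map (fun x => (x, halfspace w x)) +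
      ENNReal.ofReal η • D.fst.map (fun x => (x, -halfspace w x))

/-- The `θ`-margin error `Pr_{(x,y) ∼ D} [y ⟨w, x⟩ ≤ θ]`. -/
def marginError {d : ℕ} (D : Measure (Example d)) (θ : ℝ) (w : Fin d → ℝ) : ℝ :=
  D.real {z | z.2 * (w ⬝ᵥ z.1) ≤ θ}

/-- An example in the unit `ℓ_p` ball with a label in `{1, -1}`. -/
def IsValid {d : ℕ} (p : ℝ≥0∞) (z : Example d) : Prop :=
  vecNorm p z.1 ≤ 1 ∧ (z.2 = 1 ∨ z.2 = -1)

/-! ### The surrogate loss -/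

/-- The leaky piecewise linear function `φ`. -/
def leaky (lam γ s : ℝ) : ℝ :=
  if γ < s then lam * (1 - s / γ) else (1 - lam) * (1 - s / γ)

/-- The loss `φ(y ⟨w, x⟩)` of `w` on the example `(x, y)`; its expectation over
`(x, y) ∼ D` is the surrogate objective `G(w)`. -/
def surrogateLoss {d : ℕ} (lam γ : ℝ) (w : Fin d → ℝ) (z : Example d) : ℝ :=
  leaky lam γ (z.2 * (w ⬝ᵥ z.1))

/-! ### Stochastic mirror descent -/

section MirrorDescent

variable {ι : Type} [Fintype ι]

/-- `θ` is the gradient of `ψ` at `w`. -/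
def IsGradientAt (ψ : (ι → ℝ) → ℝ) (θ w : ι → ℝ) : Prop :=
  HasFDerivAt ψ (∑ i, θ i • (ContinuousLinearMap.proj i : (ι → ℝ) →L[ℝ] ℝ)) w

/-- `g` is a subgradient of `f` at `w`. -/
def IsSubgradientAt (f : (ι → ℝ) → ℝ) (g w : ι → ℝ) : Prop :=
  ∀ u, f w + g ⬝ᵥ (u - w) ≤ f u

/-- `v` minimizes `f` over the set `S`. -/
def IsArgmin (f : (ι → ℝ) → ℝ) (S : Set (ι → ℝ)) (v : ι → ℝ) : Prop :=
  v ∈ S ∧ ∀ u ∈ S, f v ≤ f u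

/-- The mirror descent update `w' = Π_K^ψ ((∇ψ)⁻¹ (∇ψ(w) - α g))` for the potential `ψ` on
the open set `U` and the feasible set `K`, where `Π_K^ψ` is the Bregman projection:
there is `z ∈ U` with `∇ψ(z) = ∇ψ(w) - α g`, and `w'` minimizes the Bregman divergence
`u ↦ ψ(u) - ψ(z) - ⟨∇ψ(z), u - z⟩` over `K ∩ U`. -/
def IsMirrorStep (ψ : (ι → ℝ) → ℝ) (U K : Set (ι → ℝ)) (α : ℝ) (w g w' : ι → ℝ) : Prop :=
  ∃ θ z : ι → ℝ, IsGradientAt ψ θ w ∧ z ∈ U ∧ IsGradientAt ψ (θ - α • g) z ∧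
    IsArgmin (fun u => ψ u - ψ z - (θ - α • g) ⬝ᵥ (u - z)) (K ∩ U) w'

/-- `w 0, …, w T` are the iterates of `T` steps of stochastic mirror descent with step size `α`
for the objective `w ↦ E_z [ℓ w z]`: the start `w 0` minimizes the potential, and step `k` uses
as stochastic gradient a subgradient at `w k` of the loss on the `k`-th sample `z k`. -/
def IsSMDRun {Z : Type} (ψ : (ι → ℝ) → ℝ) (U K : Set (ι → ℝ)) (ℓ : (ι → ℝ) → Z → ℝ)
    (α : ℝ) (T : ℕ) (z : ℕ → Z) (w : ℕ → ι → ℝ) : Prop :=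
  IsArgmin ψ (K ∩ U) (w 0) ∧
    ∀ k < T, ∃ g, IsSubgradientAt (fun u => ℓ u (z k)) g (w k) ∧
      IsMirrorStep ψ U K α (w k) g (w (k + 1))

/-- The average of the first `T` iterates. -/
def average (T : ℕ) (w : ℕ → ι → ℝ) : ι → ℝ := (T : ℝ)⁻¹ • ∑ k ∈ Finset.range T, w k

end MirrorDescent

/-- The exponent of the potential `½‖w‖_r²` used on the unit `ℓ_q` ball: `r = q` for finite `q`;
the function `½‖w‖_∞²` is not differentiable, and for `q = ∞` we take `r = 2`. -/
def potentialExponent (q : ℝ≥0∞) : ℝ≥0∞ := if q = ∞ then 2 else q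

/-- `out` is the averaged output of `T` steps of stochastic mirror descent with step size `α` for
the loss `ℓ` over the unit `ℓ_q` ball. For `q > 1` the potential is `½‖w‖_q²` (`½‖w‖_2²` if
`q = ∞`). For `q = 1` it is the entropy: the `ℓ_1` ball is written as the image of the
probability simplex in `ℝ^(2d)` under `(u⁺, u⁻) ↦ u⁺ - u⁻`. -/
def IsSMDOutput {d : ℕ} {Z : Type} (q : ℝ≥0∞) (ℓ : (Fin d → ℝ) → Z → ℝ)
    (α : ℝ) (T : ℕ) (z : ℕ → Z) (out : Fin d → ℝ) : Prop :=
  if q = 1 then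
    ∃ u : ℕ → (Fin d ⊕ Fin d) → ℝ,
      IsSMDRun (fun v => ∑ i, v i * Real.log (v i)) {v | ∀ i, 0 < v i}
        (stdSimplex ℝ (Fin d ⊕ Fin d))
        (fun v => ℓ (fun j => v (Sum.inl j) - v (Sum.inr j))) α T z u ∧
      out = average T (fun k j => u k (Sum.inl j) - u k (Sum.inr j))
  else
    ∃ w : ℕ → Fin d → ℝ,
      IsSMDRun (fun v => vecNorm (potentialExponent q) v ^ 2 / 2) Set.univ
        {v | vecNorm q v ≤ 1} ℓ α T z w ∧
      out = average T w

/-! ### A real random access machine with an example oracle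

Programs work on natural number registers (counters and indices) and on arrays of real numbers.
Every elementary operation has cost one: arithmetic, `exp` and `log` on real numbers, addition and
subtraction on natural numbers, memory access, comparison. Reading one labelled example from the
oracle costs its length `d + 1`. -/

namespace RealRAM

/-- The memory: `nat v` is a natural number register, `arr a i` is cell `i` of the real array `a`,
and `drawn` counts the examples that have been read from the oracle. -/
structure Store where
  nat : ℕ → ℕ
  arr : ℕ → ℕ → ℝ
  drawn : ℕ

/-- Expressions with natural number values. -/
inductive NatExpr where
  | const (n : ℕ)
  | var (v : ℕ)
  | add (e f : NatExpr)
  | sub (e f : NatExpr)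

/-- Expressions with real values; `get a i` reads cell `i` of the array `a`. -/
inductive RealExpr where
  | const (n : ℤ)
  | get (a : ℕ) (i : NatExpr)
  | cast (e : NatExpr)
  | add (e f : RealExpr)
  | sub (e f : RealExpr)
  | mul (e f : RealExpr)
  | div (e f : RealExpr)
  | exp (e : RealExpr)
  | log (e : RealExpr)

/-- Comparisons. -/
inductive Test where
  | natLT (e f : NatExpr)
  | realLT (e f : RealExpr)

/-- Programs. -/
inductive Cmd where
  | skip
  | setNat (v : ℕ) (e : NatExpr)
  | setReal (a : ℕ) (i : NatExpr) (e : RealExpr)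
  | draw (a : ℕ)
  | seq (c c' : Cmd)
  | ite (b : Test) (c c' : Cmd)
  | loop (b : Test) (c : Cmd)

/-- The value of a natural number expression (subtraction is truncated at zero). -/
def NatExpr.eval (s : Store) : NatExpr → ℕ
  | const n => n
  | var v => s.nat v
  | add e f => e.eval s + f.eval s
  | sub e f => e.eval s - f.eval s

/-- The number of elementary operations in the evaluation of an expression. -/
def NatExpr.cost : NatExpr → ℕ
  | const _ => 1
  | var _ => 1
  | add e f => e.cost + f.cost + 1
  | sub e f => e.cost + f.cost + 1

/-- The value of a real expression (with `x / 0 = 0` and `log 0 = 0`). -/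
def RealExpr.eval (s : Store) : RealExpr → ℝ
  | const n => n
  | get a i => s.arr a (i.eval s)
  | cast e => (e.eval s : ℝ)
  | add e f => e.eval s + f.eval s
  | sub e f => e.eval s - f.eval s
  | mul e f => e.eval s * f.eval s
  | div e f => e.eval s / f.eval s
  | exp e => Real.exp (e.eval s)
  | log e => Real.log (e.eval s)

/-- The number of elementary operations in the evaluation of an expression. -/
def RealExpr.cost : RealExpr → ℕ
  | const _ => 1
  | get _ i => i.cost + 1
  | cast e => e.cost + 1
  | add e f => e.cost + f.cost + 1
  | sub e f => e.cost + f.cost + 1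
  | mul e f => e.cost + f.cost + 1
  | div e f => e.cost + f.cost + 1
  | exp e => e.cost + 1
  | log e => e.cost + 1

/-- Whether a comparison holds. -/
def Test.holds (s : Store) : Test → Prop
  | natLT e f => e.eval s < f.eval s
  | realLT e f => e.eval s < f.eval s

/-- The number of elementary operations in the evaluation of a comparison. -/
def Test.cost : Test → ℕ
  | natLT e f => e.cost + f.cost + 1
  | realLT e f => e.cost + f.cost + 1

/-- The memory after `s.nat v := n`. -/
def Store.setNat (s : Store) (v n : ℕ) : Store :=
  { s with nat := Function.update s.nat v n }

/-- The memory after `s.arr a i := r`. -/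
def Store.setReal (s : Store) (a i : ℕ) (r : ℝ) : Store :=
  { s with arr := Function.update s.arr a (Function.update (s.arr a) i r) }

/-- The memory after the next example `(x, y)` of the stream `ω` has been written into the array
`a`: the coordinates of `x` go to the cells `0, …, d - 1` and the label `y` goes to cell `d`. -/
def Store.draw {d : ℕ} (ω : ℕ → Example d) (s : Store) (a : ℕ) : Store :=
  { s with
    arr := Function.update s.arr a (fun i =>
      if h : i < d then (ω s.drawn).1 ⟨i, h⟩
      else if i = d then (ω s.drawn).2
      else s.arr a i)
    drawn := s.drawn + 1 }

/-- `Exec ω c s s' t`: with the example stream `ω`, the program `c` started in the memory `s` halts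
in the memory `s'` after `t` steps. -/
inductive Exec {d : ℕ} (ω : ℕ → Example d) : Cmd → Store → Store → ℕ → Prop where
  | skip (s : Store) : Exec ω Cmd.skip s s 1
  | setNat (s : Store) (v : ℕ) (e : NatExpr) :
      Exec ω (Cmd.setNat v e) s (s.setNat v (e.eval s)) (e.cost + 1)
  | setReal (s : Store) (a : ℕ) (i : NatExpr) (e : RealExpr) :
      Exec ω (Cmd.setReal a i e) s (s.setReal a (i.eval s) (e.eval s)) (i.cost + e.cost + 1)
  | draw (s : Store) (a : ℕ) : Exec ω (Cmd.draw a) s (s.draw ω a) (d + 1)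
  | seq {c c' : Cmd} {s s' s'' : Store} {t t' : ℕ} :
      Exec ω c s s' t → Exec ω c' s' s'' t' → Exec ω (Cmd.seq c c') s s'' (t + t')
  | iteTrue {b : Test} {c c' : Cmd} {s s' : Store} {t : ℕ} :
      b.holds s → Exec ω c s s' t → Exec ω (Cmd.ite b c c') s s' (b.cost + 1 + t)
  | iteFalse {b : Test} {c c' : Cmd} {s s' : Store} {t : ℕ} :
      ¬ b.holds s → Exec ω c' s s' t → Exec ω (Cmd.ite b c c') s s' (b.cost + 1 + t)
  | loopTrue {b : Test} {c : Cmd} {s s' s'' : Store} {t t' : ℕ} :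
      b.holds s → Exec ω c s s' t → Exec ω (Cmd.loop b c) s' s'' t' →
        Exec ω (Cmd.loop b c) s s'' (b.cost + 1 + t + t')
  | loopFalse {b : Test} {c : Cmd} {s : Store} :
      ¬ b.holds s → Exec ω (Cmd.loop b c) s s (b.cost + 1)

/-- The initial memory for the input `d` (in the natural number register `0`) and `r₀, r₁, …` (in
the first cells of the real array `0`); everything else is zero. -/
def Store.init (d : ℕ) (input : List ℝ) : Store where
  nat := fun v => if v = 0 then d else 0
  arr := fun a i => if a = 0 then input.getD i 0 else 0
  drawn := 0

/-- On the stream `ω` and the given input, the program `c` halts after `t` steps, having read exactly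
`T` examples, with the vector `out` in the first `d` cells of the real array `1`. -/
def Outputs {d : ℕ} (c : Cmd) (input : List ℝ) (ω : ℕ → Example d) (t T : ℕ)
    (out : Fin d → ℝ) : Prop :=
  ∃ s, Exec ω c (Store.init d input) s t ∧ s.drawn = T ∧ ∀ j : Fin d, s.arr 1 j = out j

end RealRAM

/-- The value of a polynomial in five variables at
`(d, 1/ε, 1/γ, 1/(1 - 2η), log (1/δ))`. -/
def polyBound (P : MvPolynomial (Fin 5) ℕ) (d : ℕ) (ε γ η δ : ℝ) : ℝ :=
  MvPolynomial.aeval ![(d : ℝ), 1 / ε, 1 / γ, 1 / (1 - 2 * η), Real.log (1 / δ)] P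

end

noncomputable section

/-! Two facts are combined: a small excess of the surrogate objective forces a small margin error,
and mirror descent makes this excess small in polynomial time.

Since `λ ≤ 1/2`, the leaky loss is a maximum of two lines, hence convex. Fix `x`, let `m` be the
margin of `w` on `x` signed by the noiseless label, and let `M > γ` be that of `w*`. If `m ≤ γ/2`,
the loss of `w` averaged over the noisy label exceeds that of `w*` by at least `(1-λ)(1/2-η)`;
otherwise it falls short by at most `(λ-η)(1/γ-1)` (`leaky_pointwise`). After integration over `x`,
an excess of at most `λ - η` yields margin error at most `η + ε`; the value of `λ` is chosen for
this (`HasMargin.marginError_le`).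

Mirror descent is followed in dual variables. For `1 < q < ∞` the gradient of `½‖·‖_q²` is inverted
by the duality map of the conjugate norm and the Bregman projection becomes radial projection. For
`q = ∞` it is clipping. For `q = 1` no projection is needed and the primal points are exponential
weights. In each case a Bregman-type potential drops by the linearized regret, up to an error `C d
b^(m+1)` when the dual step has norm at most `b^m`. The exponent `m` is needed because for `p < 2`
the duality map is only Hölder continuous with exponent `p - 1`; so `m` is about `1/(p-1)`, and the
degree of the polynomial depends on `p`.

With balanced parameters the average regret is at most `(λ-η)/2`
(`IsMirrorScheme.sum_excessLoss_le`). The difference between expected and sampled excess loss along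
the iterates is a sum of bounded martingale differences; by `measure_sum_stateSeq_ge_le` it
contributes at most another `(λ-η)/2` on average, except with probability `δ`. Jensen's inequality
passes to the averaged iterate.

The program carries out the dual recursion itself. A round costs `O(d)` and the number of rounds is
polynomial (`RealRAM.outputs_smdCmd`). -/

lemma average_eq {ι : Type} (T : ℕ) (w : ℕ → ι → ℝ) :
    _root_.average T w = (T : ℝ)⁻¹ • ∑ k ∈ Finset.range T, w k := rfl

/-! ### The leaky loss -/

/-- Both lines vanish at `γ`, and `lam ≤ 1 / 2` makes the left piece at least as steep as the right
one. All convexity used later comes from here. -/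
lemma leaky_eq_max {lam γ : ℝ} (hγ : 0 < γ) (h : lam ≤ 1 / 2) (s : ℝ) :
    leaky lam γ s = max (lam * (1 - s / γ)) ((1 - lam) * (1 - s / γ)) := by
  unfold leaky
  split_ifs with hs
  · have : 1 < s / γ := (one_lt_div hγ).2 hs
    rw [max_eq_left]; nlinarith
  · have : s / γ ≤ 1 := (div_le_one hγ).2 (not_lt.1 hs)
    rw [max_eq_right]; nlinarith

/-- The slope of the leaky loss at `s`. -/
def leakySlope (lam γ s : ℝ) : ℝ := if γ < s then -(lam / γ) else -((1 - lam) / γ)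

lemma leaky_ge_tangent {lam γ : ℝ} (hγ : 0 < γ) (h : lam ≤ 1 / 2) (s t : ℝ) :
    leaky lam γ s + leakySlope lam γ s * (t - s) ≤ leaky lam γ t := by
  rw [leaky_eq_max hγ h t]
  unfold leaky leakySlope
  split_ifs
  · refine le_trans (le_of_eq ?_) (le_max_left _ _)
    ring
  · refine le_trans (le_of_eq ?_) (le_max_right _ _)
    ring

lemma abs_leakySlope_le {lam γ : ℝ} (hγ : 0 < γ) (h0 : 0 ≤ lam) (h1 : lam ≤ 1) (s : ℝ) :
    |leakySlope lam γ s| ≤ 1 / γ := by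
  unfold leakySlope
  split_ifs <;> rw [abs_neg, abs_div, abs_of_pos hγ] <;> gcongr <;> rw [abs_of_nonneg] <;> linarith

/-- Comparing the tangents at both points avoids distinguishing on which pieces they lie. -/
lemma leaky_sub_le {lam γ : ℝ} (hγ : 0 < γ) (h0 : 0 ≤ lam) (h : lam ≤ 1 / 2) (s t : ℝ) :
    |leaky lam γ s - leaky lam γ t| ≤ 1 / γ * |s - t| := by
  have h1 := leaky_ge_tangent hγ h s t
  have h2 := leaky_ge_tangent hγ h t s
  have b1 := abs_leakySlope_le hγ h0 (by linarith) s
  have b2 := abs_leakySlope_le hγ h0 (by linarith) t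
  have c1 := (abs_mul (leakySlope lam γ s) (t - s)).le.trans
    (mul_le_mul_of_nonneg_right b1 (abs_nonneg _))
  have c2 := (abs_mul (leakySlope lam γ t) (s - t)).le.trans
    (mul_le_mul_of_nonneg_right b2 (abs_nonneg _))
  rw [abs_sub_comm t s] at c1
  rw [abs_le] at c1 c2 ⊢
  constructor <;> linarith [c1.1, c2.1]

lemma measurable_leaky (lam γ : ℝ) : Measurable (leaky lam γ) := by
  unfold leaky
  exact Measurable.ite measurableSet_Ioi (by fun_prop) (by fun_prop)

lemma measurable_leakySlope (lam γ : ℝ) : Measurable (leakySlope lam γ) := by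
  unfold leakySlope
  exact Measurable.ite measurableSet_Ioi (by fun_prop) (by fun_prop)

/-- A subgradient of `w ↦ φ(y ⟨w, x⟩)`. -/
def lossGrad {d : ℕ} (lam γ : ℝ) (w : Fin d → ℝ) (z : Example d) : Fin d → ℝ :=
  (leakySlope lam γ (z.2 * (w ⬝ᵥ z.1)) * z.2) • z.1

lemma isSubgradientAt_lossGrad {d : ℕ} {lam γ : ℝ} (hγ : 0 < γ) (h : lam ≤ 1 / 2)
    (w : Fin d → ℝ) (z : Example d) :
    IsSubgradientAt (fun u => surrogateLoss lam γ u z) (lossGrad lam γ w z) w := by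
  intro u
  refine le_trans (le_of_eq ?_) (leaky_ge_tangent hγ h (z.2 * (w ⬝ᵥ z.1)) (z.2 * (u ⬝ᵥ z.1)))
  simp only [surrogateLoss, lossGrad, smul_dotProduct, dotProduct_sub, smul_eq_mul,
    dotProduct_comm z.1]
  ring

lemma measurable_dotProduct_fst {d : ℕ} :
    Measurable fun a : (Fin d → ℝ) × Example d => a.1 ⬝ᵥ a.2.1 := by
  unfold dotProduct
  fun_prop

lemma measurable_lossGrad {d : ℕ} (lam γ : ℝ) :
    Measurable fun a : (Fin d → ℝ) × Example d => lossGrad lam γ a.1 a.2 := by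
  unfold lossGrad
  have h1 := measurable_dotProduct_fst (d := d)
  have h2 := (measurable_leakySlope lam γ).comp
    ((measurable_snd.comp measurable_snd).mul h1 : Measurable
      fun a : (Fin d → ℝ) × Example d => a.2.2 * (a.1 ⬝ᵥ a.2.1))
  exact (h2.mul (measurable_snd.comp measurable_snd)).smul (measurable_fst.comp measurable_snd)

lemma measurable_surrogateLoss {d : ℕ} (lam γ : ℝ) :
    Measurable fun a : (Fin d → ℝ) × Example d => surrogateLoss lam γ a.1 a.2 :=
  (measurable_leaky lam γ).comp ((measurable_snd.comp measurable_snd).mul measurable_dotProduct_fst)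

/-- Jensen's inequality, from the supporting hyperplane at the average. -/
lemma surrogateLoss_average_le {d : ℕ} {lam γ : ℝ} (hγ : 0 < γ) (h : lam ≤ 1 / 2) {T : ℕ}
    (hT : 0 < T) (w : ℕ → Fin d → ℝ) (z : Example d) :
    surrogateLoss lam γ (_root_.average T w) z ≤
      (T : ℝ)⁻¹ * ∑ k ∈ Finset.range T, surrogateLoss lam γ (w k) z := by
  set v := _root_.average T w with hv
  have hT' : (0 : ℝ) < T := by exact_mod_cast hT
  have hs : ∑ k ∈ Finset.range T, w k = (T : ℝ) • v := by
    rw [hv, average_eq, smul_smul, mul_inv_cancel₀ hT'.ne', one_smul]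
  have key : ∑ k ∈ Finset.range T, (surrogateLoss lam γ v z + lossGrad lam γ v z ⬝ᵥ (w k - v)) ≤
      ∑ k ∈ Finset.range T, surrogateLoss lam γ (w k) z :=
    Finset.sum_le_sum fun k _ => isSubgradientAt_lossGrad hγ h v z (w k)
  rw [Finset.sum_add_distrib, ← dotProduct_sum, Finset.sum_sub_distrib, hs] at key
  simp only [Finset.sum_const, Finset.card_range, nsmul_eq_mul] at key
  -- The deviations from the average sum to zero, so the linear term disappears.
  rw [show (T : ℝ) • v - (T : Fin d → ℝ) * v = 0 by ext; simp] at key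
  rw [dotProduct_zero, add_zero] at key
  rw [inv_mul_eq_div, le_div_iff₀ hT', mul_comm]
  exact key

/-! ### `ℓ_p` norms -/

section EllNorm

variable {ι : Type} [Fintype ι]

/-- The `ℓ_p` norm for a real exponent. -/
def ellNorm (p : ℝ) (v : ι → ℝ) : ℝ := (∑ i, |v i| ^ p) ^ (1 / p)

lemma vecNorm_eq_ellNorm {p : ℝ≥0∞} (hp : 0 < p.toReal) (v : ι → ℝ) :
    vecNorm p v = ellNorm p.toReal v := by
  rw [vecNorm, PiLp.norm_eq_sum hp]; rfl

lemma vecNorm_one (v : ι → ℝ) : vecNorm 1 v = ∑ i, |v i| := by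
  rw [vecNorm_eq_ellNorm (by simp)]
  simp [ellNorm]

lemma vecNorm_top_le {v : ι → ℝ} {a : ℝ} (ha : 0 ≤ a) :
    vecNorm ∞ v ≤ a ↔ ∀ i, |v i| ≤ a := by
  rw [vecNorm, PiLp.norm_toLp, pi_norm_le_iff_of_nonneg ha]
  rfl

lemma vecNorm_nonneg {p : ℝ≥0∞} [Fact (1 ≤ p)] (v : ι → ℝ) : 0 ≤ vecNorm p v := norm_nonneg _

lemma vecNorm_smul {p : ℝ≥0∞} [Fact (1 ≤ p)] (c : ℝ) (v : ι → ℝ) :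
    vecNorm p (c • v) = |c| * vecNorm p v := by
  rw [vecNorm, WithLp.toLp_smul, norm_smul]; rfl

lemma vecNorm_sub_le {p : ℝ≥0∞} [Fact (1 ≤ p)] (u v : ι → ℝ) :
    vecNorm p (u - v) ≤ vecNorm p u + vecNorm p v := by
  rw [vecNorm, WithLp.toLp_sub]; exact norm_sub_le _ _

lemma vecNorm_sum_le {p : ℝ≥0∞} [Fact (1 ≤ p)] {κ : Type} (s : Finset κ) (w : κ → ι → ℝ) :
    vecNorm p (∑ k ∈ s, w k) ≤ ∑ k ∈ s, vecNorm p (w k) := by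
  rw [vecNorm, WithLp.toLp_sum]; exact norm_sum_le _ _

lemma abs_le_vecNorm {p : ℝ≥0∞} [Fact (1 ≤ p)] (v : ι → ℝ) (i : ι) : |v i| ≤ vecNorm p v :=
  PiLp.norm_apply_le (WithLp.toLp p v) i

lemma vecNorm_average_le {p : ℝ≥0∞} [Fact (1 ≤ p)] {T : ℕ} (hT : 0 < T) (w : ℕ → ι → ℝ)
    (hw : ∀ k, vecNorm p (w k) ≤ 1) : vecNorm p (_root_.average T w) ≤ 1 := by
  have hT' : (0 : ℝ) < T := by exact_mod_cast hT
  rw [average_eq, vecNorm_smul, abs_of_pos (inv_pos.2 hT'), inv_mul_eq_div, div_le_one hT']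
  refine (vecNorm_sum_le _ _).trans ((Finset.sum_le_sum fun k _ => hw k).trans (by simp))

lemma abs_dotProduct_le_one_top (u v : ι → ℝ) :
    |u ⬝ᵥ v| ≤ vecNorm 1 u * vecNorm ∞ v := by
  have hv : ∀ i, |v i| ≤ vecNorm ∞ v := fun i => abs_le_vecNorm v i
  rw [vecNorm_one, Finset.sum_mul]
  refine (Finset.abs_sum_le_sum_abs _ _).trans (Finset.sum_le_sum fun i _ => ?_)
  rw [abs_mul]
  exact mul_le_mul_of_nonneg_left (hv i) (abs_nonneg _)

lemma abs_dotProduct_le_ellNorm {p q : ℝ} (h : p.HolderConjugate q) (u v : ι → ℝ) :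
    |u ⬝ᵥ v| ≤ ellNorm p u * ellNorm q v := by
  refine abs_le.2 ⟨?_, Real.inner_le_Lp_mul_Lq _ u v h⟩
  have := Real.inner_le_Lp_mul_Lq Finset.univ (-u) v h
  simp only [Pi.neg_apply, abs_neg, neg_mul, Finset.sum_neg_distrib] at this
  exact neg_le.1 this

/-- The three cases match the three potentials: entropy, Euclidean, and `½‖·‖_q²`. -/
lemma ENNReal.HolderConjugate.cases {p q : ℝ≥0∞} (h : p.HolderConjugate q) :
    (p = ∞ ∧ q = 1) ∨ (p = 1 ∧ q = ∞) ∨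
      (p ≠ ∞ ∧ q ≠ ∞ ∧ q ≠ 1 ∧ p.toReal.HolderConjugate q.toReal) := by
  by_cases hp : p = ∞
  · subst hp
    exact Or.inl ⟨rfl, by have := h.symm.inv_add_inv_eq_one; simpa using this⟩
  by_cases hq : q = ∞
  · subst hq
    exact Or.inr (Or.inl ⟨by have := h.inv_add_inv_eq_one; simpa using this, rfl⟩)
  have hq1 : q ≠ 1 := by
    rintro rfl
    have := h.inv_add_inv_eq_one
    simp [hp] at this
  have hp1 : p ≠ 1 := by
    rintro rfl
    have := h.inv_add_inv_eq_one
    simp [hq] at this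
  refine Or.inr (Or.inr ⟨hp, hq, hq1, ?_⟩)
  have hp' : 1 < p := lt_of_le_of_ne h.one_le (Ne.symm hp1)
  have hp0 : p ≠ 0 := (zero_lt_one.trans hp').ne'
  have hq0 : q ≠ 0 := (zero_lt_one.trans_le h.symm.one_le).ne'
  rw [Real.holderConjugate_iff]
  refine ⟨by simpa using (ENNReal.toReal_lt_toReal (by simp) hp).2 hp', ?_⟩
  have := congrArg ENNReal.toReal h.inv_add_inv_eq_one
  rwa [ENNReal.toReal_add (by simpa) (by simpa), ENNReal.toReal_inv, ENNReal.toReal_inv,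
    ENNReal.toReal_one] at this

/-- Hölder's inequality. -/
lemma abs_dotProduct_le_vecNorm {p q : ℝ≥0∞} (h : p.HolderConjugate q) (u v : ι → ℝ) :
    |u ⬝ᵥ v| ≤ vecNorm p u * vecNorm q v := by
  rcases ENNReal.HolderConjugate.cases h with ⟨rfl, rfl⟩ | ⟨rfl, rfl⟩ | ⟨hp, hq, -, h⟩
  · rw [dotProduct_comm, mul_comm]; exact abs_dotProduct_le_one_top v u
  · exact abs_dotProduct_le_one_top u v
  · rw [vecNorm_eq_ellNorm h.pos, vecNorm_eq_ellNorm h.symm.pos]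
    exact abs_dotProduct_le_ellNorm h u v

end EllNorm

/-! ### The duality map of `½‖·‖_p²` -/

section DualMap

variable {ι : Type} [Fintype ι] {p q : ℝ}

lemma sum_abs_rpow_nonneg (p : ℝ) (v : ι → ℝ) : 0 ≤ ∑ i, |v i| ^ p :=
  Finset.sum_nonneg fun _ _ => Real.rpow_nonneg (abs_nonneg _) _

lemma ellNorm_nonneg (p : ℝ) (v : ι → ℝ) : 0 ≤ ellNorm p v :=
  Real.rpow_nonneg (sum_abs_rpow_nonneg p v) _

lemma ellNorm_rpow (hp : p ≠ 0) (v : ι → ℝ) : ellNorm p v ^ p = ∑ i, |v i| ^ p := by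
  rw [ellNorm, ← Real.rpow_mul (sum_abs_rpow_nonneg p v), one_div_mul_cancel hp, Real.rpow_one]

lemma ellNorm_eq_vecNorm (hp : 0 < p) (v : ι → ℝ) :
    ellNorm p v = vecNorm (ENNReal.ofReal p) v := by
  rw [vecNorm_eq_ellNorm (by rwa [ENNReal.toReal_ofReal hp.le]), ENNReal.toReal_ofReal hp.le]

lemma fact_one_le_ofReal (hp : 1 ≤ p) : Fact (1 ≤ ENNReal.ofReal p) :=
  ⟨by rwa [ENNReal.one_le_ofReal]⟩

lemma abs_le_ellNorm (hp : 1 ≤ p) (v : ι → ℝ) (i : ι) : |v i| ≤ ellNorm p v := by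
  have := fact_one_le_ofReal hp
  rw [ellNorm_eq_vecNorm (by linarith)]
  exact abs_le_vecNorm v i

lemma ellNorm_smul (hp : 1 ≤ p) (c : ℝ) (v : ι → ℝ) : ellNorm p (c • v) = |c| * ellNorm p v := by
  have := fact_one_le_ofReal hp
  rw [ellNorm_eq_vecNorm (by linarith), ellNorm_eq_vecNorm (by linarith), vecNorm_smul]

lemma ellNorm_sub_le (hp : 1 ≤ p) (u v : ι → ℝ) : ellNorm p (u - v) ≤ ellNorm p u + ellNorm p v := by
  have := fact_one_le_ofReal hp
  simp only [ellNorm_eq_vecNorm (show 0 < p by linarith)]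
  exact vecNorm_sub_le u v

lemma ellNorm_zero (hp : 1 ≤ p) : ellNorm p (0 : ι → ℝ) = 0 := by
  simpa using ellNorm_smul hp 0 (0 : ι → ℝ)

lemma eq_zero_of_ellNorm_eq_zero (hp : 1 ≤ p) {v : ι → ℝ} (h : ellNorm p v = 0) : v = 0 := by
  ext i
  exact abs_nonpos_iff.1 ((abs_le_ellNorm hp v i).trans h.le)

lemma ellNorm_pos (hp : 1 ≤ p) {v : ι → ℝ} (h : v ≠ 0) : 0 < ellNorm p v :=
  (ellNorm_nonneg p v).lt_of_ne' fun h' => h (eq_zero_of_ellNorm_eq_zero hp h')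

/-- The gradient of `½‖·‖_p²`. -/
def dualMap (p : ℝ) (v : ι → ℝ) : ι → ℝ :=
  fun i => ellNorm p v ^ (2 - p) * (|v i| ^ (p - 2) * v i)

lemma dualMap_zero : dualMap p (0 : ι → ℝ) = 0 := by ext; simp [dualMap]

lemma abs_rpow_mul_self {p t : ℝ} (ht : t ≠ 0) : |t| ^ (p - 2) * |t| = |t| ^ (p - 1) := by
  rw [← Real.rpow_add_one (abs_ne_zero.2 ht)]; ring_nf

lemma abs_rpow_mul_self_mul_self {p : ℝ} (hp : 0 < p) (t : ℝ) :
    |t| ^ (p - 2) * t * t = |t| ^ p := by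
  rcases eq_or_ne t 0 with rfl | ht
  · simp [Real.zero_rpow hp.ne']
  · rw [mul_assoc, ← abs_mul_abs_self t, ← mul_assoc, ← Real.rpow_add_one (abs_ne_zero.2 ht),
      ← Real.rpow_add_one (abs_ne_zero.2 ht)]
    ring_nf

lemma dotProduct_dualMap (hp : 1 ≤ p) (v : ι → ℝ) : v ⬝ᵥ dualMap p v = ellNorm p v ^ 2 := by
  rcases eq_or_ne v 0 with rfl | hv
  · simp [ellNorm_zero hp]
  have hN := ellNorm_pos hp hv
  have : v ⬝ᵥ dualMap p v = ellNorm p v ^ (2 - p) * ∑ i, |v i| ^ p := by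
    rw [Finset.mul_sum]
    refine Finset.sum_congr rfl fun i _ => ?_
    rw [← abs_rpow_mul_self_mul_self (by linarith) (v i), dualMap]
    ring
  rw [this, ← ellNorm_rpow (by linarith), ← Real.rpow_add hN]
  norm_num

lemma dualMap_smul (hp : 1 ≤ p) {c : ℝ} (hc : 0 < c) (v : ι → ℝ) :
    dualMap p (c • v) = c • dualMap p v := by
  ext i
  simp only [dualMap, ellNorm_smul hp, Pi.smul_apply, smul_eq_mul, abs_mul, abs_of_pos hc]
  rw [Real.mul_rpow hc.le (ellNorm_nonneg p v), Real.mul_rpow hc.le (abs_nonneg _)]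
  have : c ^ (2 - p) * c ^ (p - 2) = 1 := by
    rw [← Real.rpow_add hc]; simp
  linear_combination (ellNorm p v ^ (2 - p) * |v i| ^ (p - 2) * c * v i) * this

lemma abs_dualMap_apply {v : ι → ℝ} {i : ι} (hi : v i ≠ 0) :
    |dualMap p v i| = ellNorm p v ^ (2 - p) * |v i| ^ (p - 1) := by
  rw [dualMap, abs_mul, abs_mul, abs_of_nonneg (Real.rpow_nonneg (ellNorm_nonneg p v) _),
    abs_of_nonneg (Real.rpow_nonneg (abs_nonneg (v i)) _), abs_rpow_mul_self hi]

/-- The identity `(p - 1) q = p` turns the `ℓ_q` sum of the image into the `ℓ_p` sum of `v`. -/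
lemma ellNorm_dualMap (h : p.HolderConjugate q) (v : ι → ℝ) :
    ellNorm q (dualMap p v) = ellNorm p v := by
  rcases eq_or_ne v 0 with rfl | hv
  · rw [dualMap_zero, ellNorm_zero h.lt.le, ellNorm_zero h.symm.lt.le]
  have hN := ellNorm_pos h.lt.le hv
  have hpq := h.mul_eq_add
  have hsum : ∑ i, |dualMap p v i| ^ q = ellNorm p v ^ q := by
    have : ∀ i, |dualMap p v i| ^ q = ellNorm p v ^ ((2 - p) * q) * |v i| ^ p := by
      intro i
      by_cases hi : v i = 0
      · simp [dualMap, hi, Real.zero_rpow h.pos.ne', Real.zero_rpow h.symm.pos.ne']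
      · rw [abs_dualMap_apply hi, Real.mul_rpow (by positivity) (by positivity),
          ← Real.rpow_mul hN.le, ← Real.rpow_mul (abs_nonneg _)]
        congr 2
        linarith
    simp only [this]
    rw [← Finset.mul_sum, ← ellNorm_rpow h.pos.ne', ← Real.rpow_add hN]
    congr 1
    linarith
  rw [ellNorm, hsum, ← Real.rpow_mul hN.le, mul_one_div_cancel h.symm.pos.ne', Real.rpow_one]

/-- This explicit inverse of the mirror map supplies the point `z` required by `IsMirrorStep` and
allows the iteration to be kept in dual coordinates. -/
lemma dualMap_dualMap (h : p.HolderConjugate q) (v : ι → ℝ) : dualMap q (dualMap p v) = v := by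
  rcases eq_or_ne v 0 with rfl | hv
  · rw [dualMap_zero, dualMap_zero]
  have hN := ellNorm_pos h.lt.le hv
  have hpq := h.mul_eq_add
  ext i
  by_cases hi : v i = 0
  · simp [dualMap, hi]
  have hi' := abs_pos.2 hi
  rw [dualMap, ellNorm_dualMap h, abs_dualMap_apply hi, dualMap,
    Real.mul_rpow (by positivity) (by positivity), ← Real.rpow_mul hN.le,
    ← Real.rpow_mul (abs_nonneg _)]
  have e1 : ellNorm p v ^ (2 - q) * ellNorm p v ^ ((2 - p) * (q - 2)) * ellNorm p v ^ (2 - p) = 1 := by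
    rw [← Real.rpow_add hN, ← Real.rpow_add hN, ← Real.rpow_zero (ellNorm p v)]
    congr 1; linarith
  have e2 : |v i| ^ ((p - 1) * (q - 2)) * |v i| ^ (p - 2) = 1 := by
    rw [← Real.rpow_add hi', show (p - 1) * (q - 2) + (p - 2) = 0 by linarith, Real.rpow_zero]
  linear_combination (|v i| ^ ((p - 1) * (q - 2)) * |v i| ^ (p - 2) * v i) * e1 + v i * e2

/-- Convexity without calculus: Hölder's inequality, the isometry of the duality map, and `2ab ≤ a²
+ b²`. -/
lemma half_sq_ellNorm_sub_le (h : p.HolderConjugate q) (x y : ι → ℝ) :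
    ellNorm p x ^ 2 / 2 + dualMap p x ⬝ᵥ (y - x) ≤ ellNorm p y ^ 2 / 2 := by
  have h1 := (abs_le.1 (abs_dotProduct_le_ellNorm h y (dualMap p x))).2
  rw [ellNorm_dualMap h] at h1
  rw [dotProduct_sub, dotProduct_comm _ x, dotProduct_dualMap h.lt.le, dotProduct_comm _ y]
  nlinarith [sq_nonneg (ellNorm p x - ellNorm p y)]

lemma isGradientAt_half_sq_ellNorm (hp : 1 < p) (w : ι → ℝ) :
    IsGradientAt (fun v => ellNorm p v ^ 2 / 2) (dualMap p w) w := by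
  unfold IsGradientAt
  -- At the origin the power `2 / p` would be differentiated at zero, so the chain rule is replaced
  -- by the bound `O(‖v‖²)` from equivalence of norms.
  rcases eq_or_ne w 0 with rfl | hw
  · have h0 : (∑ i, dualMap p (0 : ι → ℝ) i • (ContinuousLinearMap.proj i : (ι → ℝ) →L[ℝ] ℝ)) = 0 := by
      simp [dualMap_zero]
    rw [h0]
    have := fact_one_le_ofReal hp.le
    let L := (PiLp.continuousLinearEquiv (ENNReal.ofReal p) ℝ (fun _ : ι => ℝ)).symm
    refine Asymptotics.IsBigO.hasFDerivAt (n := 2) ?_ one_lt_two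
    refine Asymptotics.IsBigO.of_bound (‖L.toContinuousLinearMap‖ ^ 2) (Filter.Eventually.of_forall
      fun v => ?_)
    have hv : ellNorm p v ≤ ‖L.toContinuousLinearMap‖ * ‖v‖ := by
      rw [ellNorm_eq_vecNorm (by linarith)]
      exact L.toContinuousLinearMap.le_opNorm v
    have hn := ellNorm_nonneg p v
    rw [sub_zero, Real.norm_of_nonneg (by positivity), Real.norm_of_nonneg (by positivity),
      ← mul_pow]
    nlinarith [pow_le_pow_left₀ hn hv 2]
  · have hS : 0 < ∑ i, |w i| ^ p := by
      rw [← ellNorm_rpow (by linarith)]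
      exact Real.rpow_pos_of_pos (ellNorm_pos hp.le hw) _
    have hsum : HasFDerivAt (fun v : ι → ℝ => ∑ i, |v i| ^ p)
        (∑ i, (p * |w i| ^ (p - 2) * w i) • (ContinuousLinearMap.proj i : (ι → ℝ) →L[ℝ] ℝ)) w := by
      refine HasFDerivAt.fun_sum fun i _ => ?_
      exact (hasDerivAt_abs_rpow (w i) hp).comp_hasFDerivAt w
        (ContinuousLinearMap.proj i : (ι → ℝ) →L[ℝ] ℝ).hasFDerivAt
    have hpow := (hsum.rpow_const (p := 2 / p) (Or.inl hS.ne')).const_mul (1 / 2)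
    have hfun : (fun v : ι → ℝ => ellNorm p v ^ 2 / 2) =
        fun v => 1 / 2 * (∑ i, |v i| ^ p) ^ (2 / p) := by
      ext v
      rw [ellNorm, ← Real.rpow_natCast, ← Real.rpow_mul (sum_abs_rpow_nonneg p v)]
      rw [show 1 / p * ((2 : ℕ) : ℝ) = 2 / p by push_cast; ring]
      ring
    rw [hfun]
    refine hpow.congr_fderiv ?_
    symm
    rw [Finset.smul_sum, Finset.smul_sum]
    refine Finset.sum_congr rfl fun i _ => ?_
    rw [smul_smul, smul_smul]
    congr 1
    have : ellNorm p w ^ (2 - p) = (∑ i, |w i| ^ p) ^ (2 / p - 1) := by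
      rw [ellNorm, ← Real.rpow_mul hS.le]
      congr 1
      field_simp
    rw [dualMap, this]
    field_simp

end DualMap

/-! ### Hölder continuity of the duality map -/

/-- For `s ≤ 1` this is subadditivity of `t ↦ t ^ s`; for `s ≥ 1` it is Bernoulli's inequality at `b
/ a`. On `[0, 1]` lowering the exponent to `h` only increases the right side. -/
lemma abs_rpow_sub_rpow_le {s h a b : ℝ} (hs : 0 < s) (h0 : 0 < h) (h1 : h ≤ 1) (hhs : h ≤ s)
    (hb : 0 ≤ b) (hab : b ≤ a) (ha : a ≤ 1) : a ^ s - b ^ s ≤ (1 + s) * (a - b) ^ h := by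
  have hd0 : 0 ≤ a - b := sub_nonneg.2 hab
  have hd1 : a - b ≤ 1 := by linarith
  have hpos : 0 ≤ (a - b) ^ h := Real.rpow_nonneg hd0 _
  rcases le_total s 1 with hs1 | hs1
  · have := Real.rpow_add_le_add_rpow hb hd0 hs.le hs1
    rw [add_sub_cancel] at this
    have h2 : (a - b) ^ s ≤ (a - b) ^ h :=
      Real.rpow_le_rpow_of_exponent_ge' hd0 hd1 h0.le hhs
    nlinarith
  · have h2 : a - b ≤ (a - b) ^ h := by
      simpa using Real.rpow_le_rpow_of_exponent_ge' hd0 hd1 h0.le h1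
    have h3 : a ^ s - b ^ s ≤ s * (a - b) := by
      rcases eq_or_lt_of_le (hb.trans hab) with ha0 | ha0
      · have : b = a := by linarith
        subst this; simp
      have h4 := one_add_mul_self_le_rpow_one_add (s := b / a - 1)
        (by linarith [div_nonneg hb ha0.le]) hs1
      rw [add_sub_cancel, Real.div_rpow hb ha0.le, le_div_iff₀ (by positivity)] at h4
      have h5 : a ^ s ≤ a := by
        simpa using Real.rpow_le_rpow_of_exponent_ge ha0 ha hs1
      have h6 : a ^ s * (1 - b / a) ≤ a * (1 - b / a) :=
        mul_le_mul_of_nonneg_right h5 (sub_nonneg.2 ((div_le_one ha0).2 hab))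
      have h7 : a * (1 - b / a) = a - b := by field_simp
      nlinarith
    nlinarith

/-- Hölder continuity of the signed power. Equal signs reduce to `abs_rpow_sub_rpow_le`; for
opposite signs each of the two powers is bounded by `(a - b) ^ h` separately, which explains the
`2`. -/
lemma abs_rpow_mul_sub_le {s h a b : ℝ} (hs : 0 < s) (h0 : 0 < h) (h1 : h ≤ 1) (hhs : h ≤ s)
    (ha : |a| ≤ 1) (hb : |b| ≤ 1) :
    |(|a| ^ (s - 1) * a) - |b| ^ (s - 1) * b| ≤ (2 + s) * |a - b| ^ h := by
  wlog hab : b ≤ a generalizing a b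
  · rw [abs_sub_comm, abs_sub_comm a b]; exact this hb ha (le_of_not_ge hab)
  have val : ∀ t : ℝ, 0 ≤ t → |t| ^ (s - 1) * t = t ^ s := by
    intro t ht
    rcases eq_or_lt_of_le ht with rfl | ht'
    · simp [Real.zero_rpow hs.ne']
    · rw [abs_of_pos ht', ← Real.rpow_add_one ht'.ne']; simp
  have valneg : ∀ t : ℝ, t ≤ 0 → |t| ^ (s - 1) * t = -(-t) ^ s := by
    intro t ht
    have := val (-t) (by linarith)
    rw [abs_neg] at this
    linarith
  rw [abs_of_nonneg (sub_nonneg.2 hab)]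
  have hd : 0 ≤ (a - b) ^ h := Real.rpow_nonneg (sub_nonneg.2 hab) _
  have ha' := abs_le.1 ha
  have hb' := abs_le.1 hb
  rcases le_total 0 b with hb0 | hb0
  · rw [val b hb0, val a (hb0.trans hab)]
    have := abs_rpow_sub_rpow_le hs h0 h1 hhs hb0 hab ha'.2
    have hm : b ^ s ≤ a ^ s := Real.rpow_le_rpow hb0 hab hs.le
    rw [abs_of_nonneg (sub_nonneg.2 hm)]
    linarith
  rcases le_total a 0 with ha0 | ha0
  · rw [valneg b hb0, valneg a ha0]
    have := abs_rpow_sub_rpow_le hs h0 h1 hhs (b := -a) (a := -b) (by linarith) (by linarith)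
      (by linarith)
    have hm : (-a) ^ s ≤ (-b) ^ s := Real.rpow_le_rpow (by linarith) (by linarith) hs.le
    rw [show -b - -a = a - b by ring] at this
    rw [abs_of_nonneg (by linarith)]
    linarith
  · rw [val a ha0, valneg b hb0]
    have e1 : a ^ s ≤ (a - b) ^ h :=
      (Real.rpow_le_rpow_of_exponent_ge' ha0 ha'.2 h0.le hhs).trans
        (Real.rpow_le_rpow ha0 (by linarith) h0.le)
    have e2 : (-b) ^ s ≤ (a - b) ^ h :=
      (Real.rpow_le_rpow_of_exponent_ge' (by linarith) (by linarith) h0.le hhs).trans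
        (Real.rpow_le_rpow (by linarith) (by linarith) h0.le)
    have e3 : 0 ≤ a ^ s := Real.rpow_nonneg ha0 _
    have e4 : 0 ≤ (-b) ^ s := Real.rpow_nonneg (by linarith) _
    rw [abs_of_nonneg (by linarith)]
    nlinarith

/-- Coordinatewise, the duality map is `‖v‖` times the signed power `p - 1` of `v i / ‖v‖`, and this
power is `1 / m`-Hölder on `[-1, 1]` because `1 / m ≤ p - 1`. Measuring the distance as `b ^ m`
makes the conclusion linear in `b`. -/
lemma abs_dualMap_sub_le {ι : Type} [Fintype ι] {p : ℝ} {m : ℕ} (hp : 1 < p) (hm : 1 ≤ m)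
    (hmp : 1 ≤ m * (p - 1)) {x y : ι → ℝ} {b : ℝ} (hb0 : 0 ≤ b) (hb1 : b ≤ 1)
    (hx : ellNorm p x ≤ 2) (hy : ellNorm p y ≤ 2) (hxy : ellNorm p (x - y) ≤ b ^ m) (i : ι) :
    |dualMap p x i - dualMap p y i| ≤ (5 + 4 * p) * b := by
  wlog hle : ellNorm p y ≤ ellNorm p x generalizing x y
  · rw [abs_sub_comm]
    refine this hy hx ?_ (le_of_not_ge hle)
    rw [← neg_sub x y, ← neg_one_smul ℝ, ellNorm_smul hp.le]
    simpa using hxy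
  have hm0 : (0 : ℝ) < m := by exact_mod_cast hm
  set Δ := ellNorm p (x - y) with hΔ
  have hΔ0 : 0 ≤ Δ := ellNorm_nonneg _ _
  have hbm : b ^ m ≤ b := by simpa using pow_le_pow_of_le_one hb0 hb1 hm
  have hΔb : Δ ≤ b := hxy.trans hbm
  rcases eq_or_ne x 0 with rfl | hx0
  · rw [ellNorm_zero hp.le] at hle
    have := eq_zero_of_ellNorm_eq_zero hp.le (hle.antisymm (ellNorm_nonneg p y))
    subst this
    simp only [sub_self, abs_zero]
    positivity
  have hN := ellNorm_pos hp.le hx0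
  set N := ellNorm p x
  set M := ellNorm p y with hMdef
  have hNM : N - M ≤ Δ := by
    have := ellNorm_sub_le hp.le (x - y) (-y)
    rw [sub_neg_eq_add, sub_add_cancel, ← neg_one_smul ℝ, ellNorm_smul hp.le] at this
    simp only [abs_neg, abs_one, one_mul] at this
    linarith
  have hval : ∀ v : ι → ℝ, v ≠ 0 → dualMap p v i = ellNorm p v *
      (|v i / ellNorm p v| ^ (p - 1 - 1) * (v i / ellNorm p v)) := by
    intro v hv
    have hv' := ellNorm_pos hp.le hv
    rw [dualMap, abs_div, abs_of_pos hv', Real.div_rpow (abs_nonneg _) hv'.le,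
      show p - 1 - 1 = p - 2 by ring, show 2 - p = -(p - 2) by ring, Real.rpow_neg hv'.le]
    field_simp
  have hunit : ∀ v : ι → ℝ, v ≠ 0 → |v i / ellNorm p v| ≤ 1 := by
    intro v hv
    have hv' := ellNorm_pos hp.le hv
    rw [abs_div, abs_of_pos hv', div_le_one hv']
    exact abs_le_ellNorm hp.le v i
  have hf1 : ∀ t : ℝ, |t| ≤ 1 → |(|t| ^ (p - 1 - 1) * t)| ≤ 1 := by
    intro t ht
    rcases eq_or_ne t 0 with rfl | ht0
    · simp
    rw [abs_mul, abs_of_nonneg (Real.rpow_nonneg (abs_nonneg t) _),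
      ← Real.rpow_add_one (abs_ne_zero.2 ht0)]
    exact Real.rpow_le_one (abs_nonneg _) ht (by linarith)
  rcases eq_or_ne y 0 with rfl | hy0
  · rw [dualMap_zero, Pi.zero_apply, sub_zero, hval x hx0, abs_mul, abs_of_pos hN]
    have h1 := mul_le_mul_of_nonneg_left (hf1 _ (hunit x hx0)) hN.le
    rw [ellNorm_zero hp.le] at hMdef
    nlinarith
  have hM := ellNorm_pos hp.le hy0
  rw [hval x hx0, hval y hy0]
  -- Separates the change of direction from the change of norm; the latter costs at most `Δ ≤ b`.
  have hsplit : ∀ F G : ℝ, |G| ≤ 1 → |N * F - M * G| ≤ N * |F - G| + Δ := by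
    intro F G hG
    calc |N * F - M * G| = |N * (F - G) + (N - M) * G| := by ring_nf
      _ ≤ |N * (F - G)| + |(N - M) * G| := abs_add_le _ _
      _ ≤ N * |F - G| + Δ := by
        rw [abs_mul, abs_mul, abs_of_pos hN, abs_of_nonneg (sub_nonneg.2 hle)]
        nlinarith [abs_nonneg G]
  refine (hsplit _ _ (hf1 _ (hunit y hy0))).trans ?_
  have hdiff : |x i / N - y i / M| ≤ 2 * b ^ m / N := by
    have e : x i / N - y i / M = ((x - y) i - (y i / M) * (N - M)) / N := by
      have hM' : M ≠ 0 := hM.ne'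
      rw [Pi.sub_apply]; field_simp; ring
    rw [e, abs_div, abs_of_pos hN]
    gcongr
    refine (abs_sub _ _).trans ?_
    have h1 := abs_le_ellNorm hp.le (x - y) i
    rw [abs_mul, abs_of_nonneg (sub_nonneg.2 hle)]
    nlinarith [hunit y hy0, abs_nonneg (y i / M)]
  have hh0 : 0 < 1 / (m : ℝ) := by positivity
  have hh1 : 1 / (m : ℝ) ≤ 1 := by rw [div_le_one hm0]; exact_mod_cast hm
  have hhs : 1 / (m : ℝ) ≤ p - 1 := by rw [div_le_iff₀ hm0]; linarith
  have key := abs_rpow_mul_sub_le (by linarith) hh0 hh1 hhs (hunit x hx0) (hunit y hy0)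
  -- Normalizing divides the distance by `N`, which may be tiny. The prefactor `N` compensates,
  -- since `N * N ^ (-1 / m) = N ^ (1 - 1 / m) ≤ 2`. The final constant is `4 * (p + 1) + 1`.
  have hpow : N * |x i / N - y i / M| ^ (1 / (m : ℝ)) ≤ 4 * b := by
    have h1 : |x i / N - y i / M| ^ (1 / (m : ℝ)) ≤ 2 ^ (1 / (m : ℝ)) * b / N ^ (1 / (m : ℝ)) := by
      refine (Real.rpow_le_rpow (abs_nonneg _) hdiff hh0.le).trans (le_of_eq ?_)
      rw [Real.div_rpow (by positivity) hN.le, Real.mul_rpow (by norm_num) (by positivity),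
        ← Real.rpow_natCast, ← Real.rpow_mul hb0, mul_one_div_cancel hm0.ne', Real.rpow_one]
    have h2 : (2 : ℝ) ^ (1 / (m : ℝ)) ≤ 2 := by
      simpa using Real.rpow_le_rpow_of_exponent_le one_le_two hh1
    have h3 : N / N ^ (1 / (m : ℝ)) ≤ 2 := by
      have : N / N ^ (1 / (m : ℝ)) = N ^ (1 - 1 / (m : ℝ)) := by
        rw [Real.rpow_sub hN, Real.rpow_one]
      rw [this]
      rcases le_total N 1 with hN1 | hN1
      · exact (Real.rpow_le_one hN.le hN1 (by linarith)).trans one_le_two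
      · refine (Real.rpow_le_rpow_of_exponent_le hN1 (show 1 - 1 / (m : ℝ) ≤ 1 by linarith)).trans ?_
        rw [Real.rpow_one]; exact hx
    have h4 : 0 ≤ N / N ^ (1 / (m : ℝ)) := by positivity
    calc N * |x i / N - y i / M| ^ (1 / (m : ℝ))
        ≤ N * (2 ^ (1 / (m : ℝ)) * b / N ^ (1 / (m : ℝ))) := by gcongr
      _ = 2 ^ (1 / (m : ℝ)) * (N / N ^ (1 / (m : ℝ))) * b := by ring
      _ ≤ 2 * 2 * b := by gcongr
      _ = 4 * b := by ring
  have h5 := mul_le_mul_of_nonneg_left key hN.le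
  nlinarith

/-! ### Stochastic mirror descent in dual variables -/

section Scheme

variable {d : ℕ}

/-- The dual iterates before projection: `proj` is the Bregman projection in dual variables and
`W` sends a dual iterate to the projected primal point. -/
def dualIter (proj W : (Fin d → ℝ) → Fin d → ℝ) (lam γ α : ℝ) (ω : ℕ → Example d) : ℕ → Fin d → ℝ
  | 0 => 0
  | k + 1 => proj (dualIter proj W lam γ α ω k) -
      α • lossGrad lam γ (W (dualIter proj W lam γ α ω k)) (ω k)

/-- `proj` and `W` implement stochastic mirror descent over the unit `ℓ_q` ball in dual variables,
and satisfy a one-step regret inequality with an error of order `1 + 1 / m` in the step size. -/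
structure IsMirrorScheme (p q : ℝ≥0∞) (C m : ℕ) (proj W : (Fin d → ℝ) → Fin d → ℝ) : Prop where
  measurable_proj : Measurable proj
  measurable_primal : Measurable W
  vecNorm_primal_le : ∀ v, vecNorm q (W v) ≤ 1
  exists_potential : ∃ V : (Fin d → ℝ) → (Fin d → ℝ) → ℝ, ∀ u, vecNorm q u ≤ 1 →
    (∀ v, 0 ≤ V u v) ∧ V u 0 ≤ 2 * d ∧ ∀ v h b, 0 ≤ b → b ≤ 1 → vecNorm p h ≤ b ^ m →
      V u (proj v - h) ≤ V u v - h ⬝ᵥ (W v - u) + C * d * b ^ (m + 1)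
  isSMDOutput : ∀ lam γ α T ω, 0 < γ → lam ≤ 1 / 2 → IsSMDOutput q (surrogateLoss lam γ) α T ω
    (_root_.average T fun k => W (dualIter proj W lam γ α ω k))

/-- Up to terms free of `u`, the Bregman divergence from the point with gradient `v` is `½‖u‖_r² - v
⬝ᵥ u`. So `hmin` states that `W v` is the Bregman projection, and its case `v = 0` gives the
starting point. -/
lemma isSMDOutput_of_dual {q : ℝ≥0∞} {r r' : ℝ} {proj W : (Fin d → ℝ) → Fin d → ℝ}
    (hq : q ≠ 1) (hr : (potentialExponent q).toReal = r) (h : r'.HolderConjugate r)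
    (hgrad : ∀ v, dualMap r (W v) = proj v) (hW : ∀ v, vecNorm q (W v) ≤ 1)
    (hmin : ∀ v u, vecNorm q u ≤ 1 →
      ellNorm r (W v) ^ 2 / 2 - v ⬝ᵥ W v ≤ ellNorm r u ^ 2 / 2 - v ⬝ᵥ u)
    {lam γ : ℝ} (hγ : 0 < γ) (hlam : lam ≤ 1 / 2) (α : ℝ) (T : ℕ) (ω : ℕ → Example d) :
    IsSMDOutput q (surrogateLoss lam γ) α T ω
      (_root_.average T fun k => W (dualIter proj W lam γ α ω k)) := by
  have hψ : (fun v : Fin d → ℝ => vecNorm (potentialExponent q) v ^ 2 / 2) =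
      fun v => ellNorm r v ^ 2 / 2 := by
    ext v; rw [vecNorm_eq_ellNorm (by rw [hr]; exact h.symm.pos), hr]
  rw [IsSMDOutput, if_neg hq, hψ]
  refine ⟨_, ⟨⟨⟨?_, Set.mem_univ _⟩, fun u hu => ?_⟩, fun k _ => ?_⟩, rfl⟩
  · exact hW _
  · have := hmin 0 u hu.1
    simpa [dualIter] using this
  refine ⟨_, isSubgradientAt_lossGrad hγ hlam _ _, proj (dualIter proj W lam γ α ω k),
    dualMap r' (dualIter proj W lam γ α ω (k + 1)), ?_, Set.mem_univ _, ?_, ⟨?_, Set.mem_univ _⟩,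
    fun u hu => ?_⟩
  · rw [← hgrad]; exact isGradientAt_half_sq_ellNorm h.symm.lt _
  · have := isGradientAt_half_sq_ellNorm h.symm.lt
      (dualMap r' (dualIter proj W lam γ α ω (k + 1)))
    rwa [dualMap_dualMap h] at this
  · exact hW _
  · have := hmin (dualIter proj W lam γ α ω (k + 1)) u hu.1
    simp only [dualIter, dotProduct_sub] at this ⊢
    linarith

/-! #### The ball of `ℓ_q` with `1 < q < ∞` -/

/-- Radial projection to the unit `ℓ_p` ball. -/
def ballProj (p : ℝ) (v : Fin d → ℝ) : Fin d → ℝ := (max 1 (ellNorm p v))⁻¹ • v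

lemma measurable_ellNorm (p : ℝ) : Measurable (ellNorm p : (Fin d → ℝ) → ℝ) := by
  unfold ellNorm
  fun_prop

lemma measurable_ballProj (p : ℝ) : Measurable (ballProj p : (Fin d → ℝ) → _) := by
  unfold ballProj
  exact (measurable_const.max (measurable_ellNorm p)).inv.smul measurable_id

lemma measurable_dualMap (p : ℝ) : Measurable (dualMap p : (Fin d → ℝ) → _) := by
  unfold dualMap
  have := measurable_ellNorm (d := d) p
  fun_prop

lemma ellNorm_ballProj {p : ℝ} (hp : 1 ≤ p) (v : Fin d → ℝ) :
    ellNorm p (ballProj p v) = min 1 (ellNorm p v) := by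
  have h0 := ellNorm_nonneg p v
  rw [ballProj, ellNorm_smul hp, abs_of_pos (by positivity)]
  rcases le_total 1 (ellNorm p v) with h | h
  · rw [max_eq_right h, min_eq_left h, inv_mul_cancel₀ (by linarith)]
  · rw [max_eq_left h, min_eq_right h, inv_one, one_mul]

/-- The potential is the Fenchel–Young gap between `u` and the projected dual point, which is a
Bregman divergence and hence nonnegative. One step is bounded by three facts: projection does not
increase the gap, the half squared dual norm is convex, and its gradient is Hölder continuous. -/
lemma isMirrorScheme_ball {p q : ℝ≥0∞} (hq : q ≠ ∞) (hq1 : q ≠ 1)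
    (h : p.toReal.HolderConjugate q.toReal) {m C : ℕ} (hm : 1 ≤ m)
    (hmp : 1 ≤ m * (p.toReal - 1)) (hC : 5 + 4 * p.toReal ≤ C) (hd : 0 < d) :
    IsMirrorScheme (d := d) p q C m (ballProj p.toReal)
      (fun v => dualMap p.toReal (ballProj p.toReal v)) := by
  have hd' : (1 : ℝ) ≤ d := by exact_mod_cast hd
  have hp1 := h.lt
  have hvp : ∀ v : Fin d → ℝ, vecNorm p v = ellNorm p.toReal v := vecNorm_eq_ellNorm h.pos
  have hvq : ∀ v : Fin d → ℝ, vecNorm q v = ellNorm q.toReal v := vecNorm_eq_ellNorm h.symm.pos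
  have hWnorm : ∀ v : Fin d → ℝ, ellNorm q.toReal (dualMap p.toReal (ballProj p.toReal v)) =
      min 1 (ellNorm p.toReal v) := fun v => by rw [ellNorm_dualMap h, ellNorm_ballProj hp1.le]
  set P := p.toReal
  set Q := q.toReal
  refine ⟨measurable_ballProj _, (measurable_dualMap _).comp (measurable_ballProj _),
    fun v => ?_, ⟨fun u v => ellNorm Q u ^ 2 / 2 + ellNorm P (ballProj P v) ^ 2 / 2 -
      ballProj P v ⬝ᵥ u, fun u hu => ⟨fun v => ?_, ?_, fun v g b hb0 hb1 hg => ?_⟩⟩, ?_⟩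
  · rw [hvq, hWnorm]; exact min_le_left _ _
  · have := (abs_le.1 (abs_dotProduct_le_ellNorm h (ballProj P v) u)).2
    nlinarith [sq_nonneg (ellNorm P (ballProj P v) - ellNorm Q u)]
  · rw [hvq] at hu
    have h0 := ellNorm_nonneg Q u
    have : ballProj P (0 : Fin d → ℝ) = 0 := by simp [ballProj]
    simp only [this, ellNorm_zero hp1.le, zero_dotProduct]
    nlinarith
  · rw [hvq] at hu
    rw [hvp] at hg
    set θ := ballProj P v with hθ
    have hθ1 : ellNorm P θ ≤ 1 := by rw [hθ, ellNorm_ballProj hp1.le]; exact min_le_left _ _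
    have hbm : b ^ m ≤ 1 := pow_le_one₀ hb0 hb1
    have hn0 := ellNorm_nonneg P (θ - g)
    have hn2 : ellNorm P (θ - g) ≤ 2 := (ellNorm_sub_le hp1.le _ _).trans (by linarith)
    -- Radial projection does not increase the gap to a point `u` of the unit ball: shrinking from
    -- norm `n ≥ 1` loses at most `n - 1` in the pairing and gains `(n² - 1) / 2`.
    have hproj : ellNorm P (ballProj P (θ - g)) ^ 2 / 2 - ballProj P (θ - g) ⬝ᵥ u ≤
        ellNorm P (θ - g) ^ 2 / 2 - (θ - g) ⬝ᵥ u := by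
      rw [ellNorm_ballProj hp1.le, ballProj]
      set n := ellNorm P (θ - g) with hn
      rcases le_total n 1 with hn1 | hn1
      · rw [max_eq_left hn1, min_eq_right hn1, inv_one, one_smul]
      · rw [max_eq_right hn1, min_eq_left hn1, smul_dotProduct, smul_eq_mul]
        have h1 := (abs_le.1 (abs_dotProduct_le_ellNorm h (θ - g) u)).2
        rw [← hn] at h1
        have h2 : (θ - g) ⬝ᵥ u ≤ n := h1.trans (by nlinarith)
        have h3 : 0 ≤ 1 - n⁻¹ := sub_nonneg.2 (inv_le_one_of_one_le₀ hn1)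
        have h4 := mul_le_mul_of_nonneg_right h2 h3
        have h5 : n * (1 - n⁻¹) = n - 1 := by field_simp
        nlinarith
    -- Convexity yields the gradient at the moved point `θ - g`; the next estimate replaces it by
    -- the gradient at `θ`, which is the primal iterate.
    have hconv := half_sq_ellNorm_sub_le h (θ - g) θ
    rw [sub_sub_cancel] at hconv
    -- Each coordinate contributes at most `b ^ m * (C * b)`; summation over coordinates gives the
    -- factor `d`.
    have herr : |g ⬝ᵥ (dualMap P θ - dualMap P (θ - g))| ≤ C * d * b ^ (m + 1) := by
      have hcoord : ∀ i, |dualMap P θ i - dualMap P (θ - g) i| ≤ C * b := fun i =>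
        (abs_dualMap_sub_le hp1 hm hmp hb0 hb1 (by linarith) hn2 (by simpa using hg) i).trans
          (mul_le_mul_of_nonneg_right hC hb0)
      refine (Finset.abs_sum_le_sum_abs _ _).trans
        ((Finset.sum_le_sum (g := fun _ => b ^ m * (C * b)) fun i _ => ?_).trans (le_of_eq ?_))
      · rw [abs_mul]
        exact mul_le_mul ((abs_le_ellNorm hp1.le g i).trans hg) (hcoord i) (abs_nonneg _)
          (by positivity)
      · simp only [Finset.sum_const, Finset.card_univ, Fintype.card_fin, nsmul_eq_mul]
        ring
    have herr' := (abs_le.1 herr).2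
    rw [dotProduct_sub] at herr' ⊢
    rw [dotProduct_comm _ g] at hconv
    rw [sub_dotProduct] at hproj
    linarith
  · intro lam γ α T ω hγ hlam
    refine isSMDOutput_of_dual (r := Q) (r' := P) hq1 (by rw [potentialExponent, if_neg hq]) h
      (fun v => dualMap_dualMap h _) ?_ (fun v u hu => ?_) hγ hlam α T ω
    · intro v; rw [hvq, hWnorm]; exact min_le_left _ _
    · rw [hvq] at hu
      have hu0 := ellNorm_nonneg Q u
      have h1 := (abs_le.1 (abs_dotProduct_le_ellNorm h v u)).2
      have h2 := dotProduct_dualMap hp1.le v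
      have hn0 := ellNorm_nonneg P v
      rw [hWnorm, ballProj]
      set n := ellNorm P v with hn
      rcases le_total n 1 with hn1 | hn1
      · rw [max_eq_left hn1, min_eq_right hn1, inv_one, one_smul, h2]
        nlinarith [sq_nonneg (n - ellNorm Q u)]
      · rw [max_eq_right hn1, min_eq_left hn1, dualMap_smul hp1.le (by positivity),
          dotProduct_smul, h2, smul_eq_mul]
        have : n⁻¹ * n ^ 2 = n := by field_simp
        nlinarith [sq_nonneg (1 - ellNorm Q u)]

/-! #### The cube, `q = ∞` -/

/-- Coordinatewise projection to `[-1, 1]`. -/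
def clip (v : Fin d → ℝ) : Fin d → ℝ := fun i => max (-1) (min 1 (v i))

lemma abs_clip_le (v : Fin d → ℝ) (i : Fin d) : |clip v i| ≤ 1 :=
  abs_le.2 ⟨le_max_left _ _, max_le (by norm_num) (min_le_left _ _)⟩

/-- Clipping gives the nearest point of `[-1, 1]`. The first part serves the regret estimate, the
second the identification with the Bregman projection. -/
lemma clip_sub_sq_le (v u : Fin d → ℝ) {i : Fin d} (hu : |u i| ≤ 1) :
    (u i - clip v i) ^ 2 ≤ (u i - v i) ^ 2 ∧
      clip v i ^ 2 / 2 - v i * clip v i ≤ u i ^ 2 / 2 - v i * u i := by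
  obtain ⟨h1, h2⟩ := abs_le.1 hu
  unfold clip
  rcases le_total 1 (v i) with h | h
  · rw [min_eq_left h, max_eq_right (by norm_num)]
    constructor <;> nlinarith
  · rw [min_eq_right h]
    rcases le_total (-1) (v i) with h' | h'
    · rw [max_eq_right h']
      exact ⟨le_rfl, by nlinarith [sq_nonneg (v i - u i)]⟩
    · rw [max_eq_left h']
      constructor <;> nlinarith

lemma dualMap_two (v : Fin d → ℝ) : dualMap 2 v = v := by
  ext i; simp [dualMap]

/-- For the Euclidean potential primal and dual coordinates coincide, and half the squared distance
to `u` is the potential. Each entry of the step is at most `b`, whence the error `d * b ^ 2`. -/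
lemma isMirrorScheme_cube (hd : 0 < d) : IsMirrorScheme (d := d) 1 ∞ 1 1 clip clip := by
  have hd' : (1 : ℝ) ≤ d := by exact_mod_cast hd
  have hmeas : Measurable (clip : (Fin d → ℝ) → _) := by unfold clip; fun_prop
  have hnorm : ∀ v : Fin d → ℝ, vecNorm ∞ (clip v) ≤ 1 := fun v =>
    (vecNorm_top_le zero_le_one).2 (abs_clip_le v)
  refine ⟨hmeas, hmeas, hnorm, ⟨fun u v => ∑ i, (u i - clip v i) ^ 2 / 2,
    fun u hu => ⟨fun v => by positivity, ?_, fun v g b hb0 hb1 hg => ?_⟩⟩, ?_⟩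
  · rw [vecNorm_top_le zero_le_one] at hu
    refine (Finset.sum_le_sum (g := fun _ => (1 : ℝ)) fun i _ => ?_).trans ?_
    · have : clip (0 : Fin d → ℝ) i = 0 := by simp [clip]
      rw [this]
      nlinarith [abs_le.1 (hu i)]
    · simp only [Finset.sum_const, Finset.card_univ, Fintype.card_fin, nsmul_eq_mul]
      linarith
  · rw [vecNorm_top_le zero_le_one] at hu
    have hgi : ∀ i, |g i| ≤ b := fun i => by simpa using (abs_le_vecNorm g i).trans hg
    have : ∀ i, (u i - clip (clip v - g) i) ^ 2 / 2 ≤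
        (u i - clip v i) ^ 2 / 2 - g i * (clip v - u) i + b ^ 2 := by
      intro i
      have h1 := (clip_sub_sq_le (clip v - g) u (hu i)).1
      have h2 : g i ^ 2 ≤ b ^ 2 := sq_le_sq.2 (by rw [abs_of_nonneg hb0]; exact hgi i)
      simp only [Pi.sub_apply] at h1 ⊢
      nlinarith [sq_nonneg b]
    refine (Finset.sum_le_sum fun i _ => this i).trans (le_of_eq ?_)
    simp only [Finset.sum_add_distrib, Finset.sum_sub_distrib, Finset.sum_const, Finset.card_univ,
      Fintype.card_fin, nsmul_eq_mul, dotProduct]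
    norm_num
  · intro lam γ α T ω hγ hlam
    refine isSMDOutput_of_dual (r := 2) (r' := 2) (by simp) (by simp [potentialExponent])
      (by rw [Real.holderConjugate_iff]; norm_num) (fun v => dualMap_two _) hnorm
      (fun v u hu => ?_) hγ hlam α T ω
    · rw [vecNorm_top_le zero_le_one] at hu
      have hsq : ∀ v : Fin d → ℝ, ellNorm 2 v ^ 2 = ∑ i, v i ^ 2 := by
        intro v
        have := ellNorm_rpow (p := 2) two_ne_zero v
        simpa using this
      rw [hsq, hsq, Finset.sum_div, Finset.sum_div, dotProduct, dotProduct,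
        ← Finset.sum_sub_distrib, ← Finset.sum_sub_distrib]
      exact Finset.sum_le_sum fun i _ => (clip_sub_sq_le v u (hu i)).2

/-! #### The cross-polytope, `q = 1` -/

/-- The normalizing factor of the exponential weights. -/
def partition (v : Fin d → ℝ) : ℝ := ∑ i, (Real.exp (v i) + Real.exp (-v i))

/-- Exponential weights with signs. -/
def expWeights (v : Fin d → ℝ) : Fin d → ℝ :=
  fun i => (Real.exp (v i) - Real.exp (-v i)) / partition v

/-- Exponential weights as a point of the probability simplex. -/
def pairWeights (v : Fin d → ℝ) : Fin d ⊕ Fin d → ℝ :=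
  fun i => Real.exp (Sum.elim v (-v) i) / partition v

lemma partition_pos (hd : 0 < d) (v : Fin d → ℝ) : 0 < partition v :=
  Finset.sum_pos (fun _ _ => by positivity) ⟨⟨0, hd⟩, Finset.mem_univ _⟩

lemma pairWeights_pos (hd : 0 < d) (v : Fin d → ℝ) (i : Fin d ⊕ Fin d) : 0 < pairWeights v i :=
  div_pos (Real.exp_pos _) (partition_pos hd v)

lemma log_pairWeights (hd : 0 < d) (v : Fin d → ℝ) (i : Fin d ⊕ Fin d) :
    Real.log (pairWeights v i) = Sum.elim v (-v) i - Real.log (partition v) := by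
  rw [pairWeights, Real.log_div (Real.exp_ne_zero _) (partition_pos hd v).ne', Real.log_exp]

lemma pairWeights_mem (hd : 0 < d) (v : Fin d → ℝ) :
    pairWeights v ∈ stdSimplex ℝ (Fin d ⊕ Fin d) ∩ {v | ∀ i, 0 < v i} := by
  refine ⟨⟨fun i => (pairWeights_pos hd v i).le, ?_⟩, pairWeights_pos hd v⟩
  simp only [Fintype.sum_sum_type, pairWeights, Sum.elim_inl, Sum.elim_inr, Pi.neg_apply]
  rw [← Finset.sum_add_distrib]
  simp only [← add_div]
  rw [← Finset.sum_div]
  exact div_self (partition_pos hd v).ne'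

lemma pairWeights_sub (v : Fin d → ℝ) :
    (fun j => pairWeights v (Sum.inl j) - pairWeights v (Sum.inr j)) = expWeights v := by
  ext i
  simp [pairWeights, expWeights, sub_div]

lemma isGradientAt_entropy {ι : Type} [Fintype ι] {w : ι → ℝ} (hw : ∀ i, 0 < w i) :
    IsGradientAt (fun v => ∑ i, v i * Real.log (v i)) (fun i => Real.log (w i) + 1) w := by
  refine HasFDerivAt.fun_sum fun i _ => ?_
  exact (Real.hasDerivAt_mul_log (hw i).ne').comp_hasFDerivAt w
    (ContinuousLinearMap.proj i : (ι → ℝ) →L[ℝ] ℝ).hasFDerivAt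

/-- Gibbs' variational principle. -/
lemma entropy_sub_le {ι : Type} [Fintype ι] {w u θ : ι → ℝ} {c : ℝ}
    (hw : w ∈ stdSimplex ℝ ι ∩ {v | ∀ i, 0 < v i}) (hu : u ∈ stdSimplex ℝ ι ∩ {v | ∀ i, 0 < v i})
    (hθ : ∀ i, θ i = Real.log (w i) + c) :
    ∑ i, w i * Real.log (w i) - θ ⬝ᵥ w ≤ ∑ i, u i * Real.log (u i) - θ ⬝ᵥ u := by
  have e1 : ∑ i, w i * Real.log (w i) - θ ⬝ᵥ w = -c := by
    rw [dotProduct, ← Finset.sum_sub_distrib]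
    have : ∀ i, w i * Real.log (w i) - θ i * w i = -c * w i := fun i => by rw [hθ]; ring
    simp only [this, ← Finset.mul_sum, hw.1.2, mul_one]
  have e2 : ∑ i, u i * Real.log (u i) - θ ⬝ᵥ u =
      -c + ∑ i, u i * (Real.log (u i) - Real.log (w i)) := by
    rw [dotProduct, ← Finset.sum_sub_distrib]
    have : ∀ i, u i * Real.log (u i) - θ i * u i =
        -c * u i + u i * (Real.log (u i) - Real.log (w i)) := fun i => by rw [hθ]; ring
    simp only [this, Finset.sum_add_distrib, ← Finset.mul_sum, hu.1.2, mul_one]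
  have e3 : ∑ i, (u i - w i) ≤ ∑ i, u i * (Real.log (u i) - Real.log (w i)) := by
    refine Finset.sum_le_sum fun i _ => ?_
    have hui := hu.2 i
    have hwi := hw.2 i
    have := Real.log_le_sub_one_of_pos (div_pos hwi hui)
    rw [Real.log_div hwi.ne' hui.ne'] at this
    have h2 := mul_le_mul_of_nonneg_left this hui.le
    have h3 : u i * (w i / u i - 1) = w i - u i := by field_simp
    linarith
  rw [Finset.sum_sub_distrib, hu.1.2, hw.1.2] at e3
  rw [e1, e2]
  linarith

/-- Apply `exp x ≤ 1 + x + x ^ 2` for `|x| ≤ 1` to every summand and then `1 + t ≤ exp t`. -/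
lemma partition_step_le (hd : 0 < d) (v g : Fin d → ℝ) {b : ℝ} (hb0 : 0 ≤ b) (hb1 : b ≤ 1)
    (hg : ∀ i, |g i| ≤ b) :
    Real.log (partition (v - g)) ≤ Real.log (partition v) - g ⬝ᵥ expWeights v + b ^ 2 := by
  have hZ := partition_pos hd v
  have hx : ∀ x : ℝ, |x| ≤ b → Real.exp x ≤ 1 + x + b ^ 2 := by
    intro x hx
    have h1 := (abs_le.1 (Real.abs_exp_sub_one_sub_id_le (hx.trans hb1))).2
    have h2 : x ^ 2 ≤ b ^ 2 := sq_le_sq.2 (by rwa [abs_of_nonneg hb0])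
    linarith
  have h1 : partition (v - g) ≤ partition v * (1 - g ⬝ᵥ expWeights v + b ^ 2) := by
    have e : partition v * (1 - g ⬝ᵥ expWeights v + b ^ 2) =
        ∑ i, (Real.exp (v i) * (1 - g i + b ^ 2) + Real.exp (-v i) * (1 + g i + b ^ 2)) := by
      have : partition v * (g ⬝ᵥ expWeights v) =
          ∑ i, g i * (Real.exp (v i) - Real.exp (-v i)) := by
        rw [dotProduct, Finset.mul_sum]
        refine Finset.sum_congr rfl fun i _ => ?_
        rw [expWeights]; field_simp
      rw [show partition v * (1 - g ⬝ᵥ expWeights v + b ^ 2) =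
        partition v * (1 + b ^ 2) - partition v * (g ⬝ᵥ expWeights v) by ring, this, partition,
        Finset.sum_mul, ← Finset.sum_sub_distrib]
      exact Finset.sum_congr rfl fun i _ => by ring
    rw [e]
    refine Finset.sum_le_sum fun i _ => add_le_add ?_ ?_
    · rw [Pi.sub_apply, sub_eq_add_neg, Real.exp_add]
      refine mul_le_mul_of_nonneg_left ?_ (Real.exp_pos _).le
      simpa [sub_eq_add_neg] using hx (-g i) (by simpa using hg i)
    · rw [Pi.sub_apply, neg_sub', sub_neg_eq_add, Real.exp_add]
      exact mul_le_mul_of_nonneg_left (hx (g i) (hg i)) (Real.exp_pos _).le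
  rw [← Real.exp_le_exp, Real.exp_log (partition_pos hd _), add_comm_sub, Real.exp_add,
    Real.exp_log hZ]
  refine h1.trans (mul_le_mul_of_nonneg_left ?_ hZ.le)
  linarith [Real.add_one_le_exp (b ^ 2 - g ⬝ᵥ expWeights v)]

/-- Projection onto the simplex is a normalization, which shifts the gradient of the entropy by a
constant vector; hence the unprojected sum `v` is a sufficient dual variable. The potential `log
(partition v) - u ⬝ᵥ v` is nonnegative because `log (partition v)` dominates every `|v i|`, and it
starts at `log (2 d)`. -/
lemma isMirrorScheme_crossPolytope (hd : 0 < d) :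
    IsMirrorScheme (d := d) ∞ 1 1 1 id expWeights := by
  have hd' : (1 : ℝ) ≤ d := by exact_mod_cast hd
  have hmeas : Measurable (expWeights : (Fin d → ℝ) → _) := by
    unfold expWeights partition; fun_prop
  refine ⟨measurable_id, hmeas, fun v => ?_, ⟨fun u v => Real.log (partition v) - u ⬝ᵥ v,
    fun u hu => ⟨fun v => ?_, ?_, fun v g b hb0 hb1 hg => ?_⟩⟩, ?_⟩
  · rw [vecNorm_one]
    have hZ := partition_pos hd v
    have h1 : (∑ i, (Real.exp (v i) + Real.exp (-v i))) / partition v = 1 := div_self hZ.ne'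
    rw [← h1, Finset.sum_div]
    refine Finset.sum_le_sum fun i _ => ?_
    rw [expWeights, abs_div, abs_of_pos hZ]
    gcongr
    rw [abs_le]
    constructor <;> linarith [Real.exp_pos (v i), Real.exp_pos (-v i)]
  · have hZ := partition_pos hd v
    have hlog : ∀ i, |v i| ≤ Real.log (partition v) := by
      intro i
      rw [Real.le_log_iff_exp_le hZ]
      refine le_trans ?_ (Finset.single_le_sum (f := fun i => Real.exp (v i) + Real.exp (-v i))
        (fun i _ => by positivity) (Finset.mem_univ i))
      rcases abs_cases (v i) with ⟨h, -⟩ | ⟨h, -⟩ <;> rw [h] <;>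
        linarith [Real.exp_pos (v i), Real.exp_pos (-v i)]
    have h0 : 0 ≤ Real.log (partition v) := (abs_nonneg _).trans (hlog ⟨0, hd⟩)
    have h1 := (abs_le.1 (abs_dotProduct_le_one_top u v)).2
    have h2 := (vecNorm_top_le h0).2 hlog
    have h3 := vecNorm_nonneg (p := ∞) v
    nlinarith
  · have : partition (0 : Fin d → ℝ) = 2 * d := by
      simp only [partition, Pi.zero_apply, neg_zero, Real.exp_zero, Finset.sum_const,
        Finset.card_univ, Fintype.card_fin, nsmul_eq_mul]
      ring
    simp only [this, dotProduct_zero, sub_zero]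
    exact (Real.log_le_sub_one_of_pos (by positivity)).trans (by linarith)
  · have := partition_step_le hd v g hb0 hb1 fun i => by simpa using (abs_le_vecNorm g i).trans hg
    simp only [id, dotProduct_sub, Nat.cast_one, one_mul, dotProduct_comm u]
    rw [sub_dotProduct, dotProduct_comm v]
    norm_num
    nlinarith [sq_nonneg b]
  · intro lam γ α T ω hγ hlam
    rw [IsSMDOutput, if_pos rfl]
    refine ⟨fun k => pairWeights (dualIter id expWeights lam γ α ω k),
      ⟨⟨pairWeights_mem hd _, fun u hu => ?_⟩, fun k _ => ?_⟩, ?_⟩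
    · have := entropy_sub_le (θ := 0) (c := Real.log (partition (0 : Fin d → ℝ)))
        (pairWeights_mem hd (0 : Fin d → ℝ)) hu fun i => by
          rw [log_pairWeights hd]
          rcases i with i | i <;> simp
      simpa [dualIter] using this
    · set v := dualIter id expWeights lam γ α ω k with hv
      have hG := isSubgradientAt_lossGrad hγ hlam (expWeights v) (ω k)
      set G := lossGrad lam γ (expWeights v) (ω k) with hGdef
      have hz : ∀ i, 0 < pairWeights v i * Real.exp (-(α * Sum.elim G (-G) i)) := fun i =>
        mul_pos (pairWeights_pos hd v i) (Real.exp_pos _)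
      have hzlog : ∀ i, Real.log (pairWeights v i * Real.exp (-(α * Sum.elim G (-G) i))) + 1 =
          Real.log (pairWeights v i) + 1 - α * Sum.elim G (-G) i := fun i => by
        rw [Real.log_mul (pairWeights_pos hd v i).ne' (Real.exp_ne_zero _), Real.log_exp]; ring
      have hθ : (fun i => Real.log (pairWeights v i * Real.exp (-(α * Sum.elim G (-G) i))) + 1) =
          (fun i => Real.log (pairWeights v i) + 1) - α • Sum.elim G (-G) := by
        ext i; rw [hzlog]; rfl
      -- In doubled coordinates the subgradient is `(G, -G)`, so the dual variable keeps the form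
      -- `(v, -v)` up to constants. The unprojected point multiplies each weight by an exponential.
      refine ⟨Sum.elim G (-G), fun u => ?_, fun i => Real.log (pairWeights v i) + 1,
        fun i => pairWeights v i * Real.exp (-(α * Sum.elim G (-G) i)),
        isGradientAt_entropy (pairWeights_pos hd v), hz, ?_, pairWeights_mem hd _,
        fun u hu => ?_⟩
      · refine le_trans (le_of_eq ?_) (hG fun j => u (Sum.inl j) - u (Sum.inr j))
        simp only [pairWeights_sub]
        congr 1
        rw [← pairWeights_sub]
        simp only [dotProduct, Fintype.sum_sum_type, Sum.elim_inl, Sum.elim_inr, Pi.sub_apply,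
          Pi.neg_apply]
        rw [← Finset.sum_add_distrib]
        exact Finset.sum_congr rfl fun i _ => by ring
      · rw [← hθ]; exact isGradientAt_entropy hz
      -- The constant `c` collects the two normalizing factors and the `1` from the derivative of `t
      -- log t`.
      · have := entropy_sub_le (w := pairWeights (v - α • G))
          (θ := (fun i => Real.log (pairWeights v i) + 1) - α • Sum.elim G (-G))
          (c := Real.log (partition (v - α • G)) - Real.log (partition v) + 1)
          (pairWeights_mem hd _) hu fun i => by
            rw [log_pairWeights hd]
            simp only [Pi.sub_apply, log_pairWeights hd]
            rcases i with i | i <;> simp <;> ring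
        simp only [dualIter, id, ← hv, ← hGdef, dotProduct_sub] at this ⊢
        linarith
    · exact congrArg _ (funext fun k => (pairWeights_sub _).symm)

end Scheme

/-! ### Concentration along an adapted process on an infinite product -/

section Concentration

variable {Z S : Type}

/-- Prepend a sample to a stream. -/
def streamCons (a : Z × (ℕ → Z)) : ℕ → Z
  | 0 => a.1
  | k + 1 => a.2 k

/-- The states visited from `s` under the update rule `step`. -/
def stateSeq (step : S → Z → S) (s : S) (ω : ℕ → Z) : ℕ → S
  | 0 => s
  | k + 1 => step (stateSeq step s ω k) (ω k)

lemma stateSeq_streamCons (step : S → Z → S) (s : S) (a : Z × (ℕ → Z)) (k : ℕ) :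
    stateSeq step s (streamCons a) (k + 1) = stateSeq step (step s a.1) a.2 k := by
  induction k with
  | zero => rfl
  | succ k ih => rw [stateSeq, ih]; rfl

variable [MeasurableSpace Z]

lemma measurable_streamCons : Measurable (streamCons : Z × (ℕ → Z) → ℕ → Z) := by
  refine measurable_pi_lambda _ fun k => ?_
  cases k with
  | zero => exact measurable_fst
  | succ k => exact (measurable_pi_apply k).comp measurable_snd

/-- Isolates the first sample of an i.i.d. stream, so that Fubini applies. It suffices to compare
the measures on boxes. -/
lemma map_streamCons (μ : Measure Z) [IsProbabilityMeasure μ] :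
    (μ.prod (Measure.infinitePi fun _ : ℕ => μ)).map streamCons =
      Measure.infinitePi fun _ : ℕ => μ := by
  classical
  refine Measure.eq_infinitePi _ fun s t ht => ?_
  -- Enlarging the index set to an initial segment, with full sides at the new indices, makes every
  -- box split as a side at `0` times a shifted box.
  obtain ⟨n, hn⟩ : ∃ n, s ⊆ Finset.range (n + 1) :=
    ⟨s.sup id, fun i hi => Finset.mem_range_succ_iff.2 (Finset.le_sup (f := id) hi)⟩
  set t' : ℕ → Set Z := fun i => if i ∈ s then t i else Set.univ with ht'
  have hmt : ∀ i, MeasurableSet (t' i) := fun i => by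
    simp only [ht']; split_ifs; exacts [ht i, MeasurableSet.univ]
  have hpi : Set.pi (s : Set ℕ) t = Set.pi (Finset.range (n + 1) : Finset ℕ) t' := by
    ext ω
    simp only [Set.mem_pi, Finset.mem_coe, ht']
    refine ⟨fun h i _ => ?_, fun h i hi => by simpa [hi] using h i (hn hi)⟩
    split_ifs with his
    exacts [h i his, Set.mem_univ _]
  have hprod : ∏ i ∈ s, μ (t i) = ∏ i ∈ Finset.range (n + 1), μ (t' i) := by
    rw [← Finset.prod_subset hn (fun i _ hi => by simp [ht', hi])]
    exact Finset.prod_congr rfl fun i hi => by simp [ht', hi]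
  have hpre : streamCons ⁻¹' Set.pi (Finset.range (n + 1) : Finset ℕ) t' =
      t' 0 ×ˢ Set.pi (Finset.range n : Finset ℕ) (fun i => t' (i + 1)) := by
    ext a
    simp only [Set.mem_preimage, Set.mem_pi, Finset.coe_range, Set.mem_Iio, Set.mem_prod]
    refine ⟨fun h => ⟨h 0 (by omega), fun i hi => h (i + 1) (by omega)⟩, fun h i hi => ?_⟩
    cases i with
    | zero => exact h.1
    | succ i => exact h.2 i (by omega)
  rw [hpi, Measure.map_apply measurable_streamCons
    (MeasurableSet.pi (Finset.countable_toSet _) fun i _ => hmt i), hpre, Measure.prod_prod,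
    Measure.infinitePi_pi _ (fun i _ => hmt (i + 1)), hprod, Finset.prod_range_succ', mul_comm]

variable [MeasurableSpace S]

lemma measurable_stateSeq {step : S → Z → S} (hstep : Measurable (Function.uncurry step)) (s : S)
    (k : ℕ) : Measurable fun ω => stateSeq step s ω k := by
  induction k with
  | zero => exact measurable_const
  | succ k ih => exact hstep.comp (ih.prodMk (measurable_pi_apply k))

variable {μ : Measure Z} [IsProbabilityMeasure μ] {step : S → Z → S} {X : S → Z → ℝ}

/-- The first sample is integrated last and the induction hypothesis is applied from the state it
leads to. Generalizing over the initial state replaces filtrations and conditional expectations. -/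
lemma lintegral_exp_sum_le (hstep : Measurable (Function.uncurry step))
    (hX : Measurable (Function.uncurry X)) {t : ℝ} {M : ℝ≥0∞}
    (hmgf : ∀ s, ∫⁻ z, ENNReal.ofReal (Real.exp (t * X s z)) ∂μ ≤ M) (n : ℕ) (s : S) :
    ∫⁻ ω, ENNReal.ofReal (Real.exp (t * ∑ k ∈ Finset.range n, X (stateSeq step s ω k) (ω k)))
      ∂(Measure.infinitePi fun _ : ℕ => μ) ≤ M ^ n := by
  have hmeas : ∀ n s, Measurable fun ω : ℕ → Z => ENNReal.ofReal
      (Real.exp (t * ∑ k ∈ Finset.range n, X (stateSeq step s ω k) (ω k))) := by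
    intro n s
    refine ENNReal.measurable_ofReal.comp (Real.measurable_exp.comp (measurable_const.mul ?_))
    exact Finset.measurable_fun_sum _ fun k _ =>
      hX.comp ((measurable_stateSeq hstep s k).prodMk (measurable_pi_apply k))
  induction n generalizing s with
  | zero => simp
  | succ n ih =>
    have hXs : Measurable fun z => ENNReal.ofReal (Real.exp (t * X s z)) :=
      ENNReal.measurable_ofReal.comp (Real.measurable_exp.comp
        (measurable_const.mul (hX.comp (measurable_const.prodMk measurable_id))))
    have hcons : Measurable fun a : Z × (ℕ → Z) => ENNReal.ofReal (Real.exp (t *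
        ∑ k ∈ Finset.range (n + 1), X (stateSeq step s (streamCons a) k) (streamCons a k))) :=
      (hmeas _ _).comp measurable_streamCons
    rw [← map_streamCons μ, lintegral_map (hmeas _ _) measurable_streamCons,
      lintegral_prod _ hcons.aemeasurable]
    have hsplit : ∀ z (ω : ℕ → Z), ENNReal.ofReal (Real.exp (t * ∑ k ∈ Finset.range (n + 1),
        X (stateSeq step s (streamCons (z, ω)) k) (streamCons (z, ω) k))) =
        ENNReal.ofReal (Real.exp (t * X s z)) * ENNReal.ofReal (Real.exp (t *
          ∑ k ∈ Finset.range n, X (stateSeq step (step s z) ω k) (ω k))) := by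
      intro z ω
      rw [← ENNReal.ofReal_mul (Real.exp_pos _).le, ← Real.exp_add, ← mul_add,
        Finset.sum_range_succ', add_comm]
      simp only [stateSeq_streamCons]
      rfl
    simp only [hsplit]
    calc _ ≤ ∫⁻ z, ENNReal.ofReal (Real.exp (t * X s z)) * M ^ n ∂μ := by
          refine lintegral_mono fun z => ?_
          rw [lintegral_const_mul _ (hmeas n _)]
          gcongr
          exact ih _
      _ ≤ M ^ (n + 1) := by
          rw [lintegral_mul_const _ hXs, pow_succ']
          gcongr
          exact hmgf s

/-- An Azuma–Hoeffding inequality. -/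
lemma measure_sum_stateSeq_ge_le (hstep : Measurable (Function.uncurry step))
    (hX : Measurable (Function.uncurry X)) {B : ℝ} (hB : 0 < B)
    (hbound : ∀ s, ∀ᵐ z ∂μ, |X s z| ≤ B) (hmean : ∀ s, ∫ z, X s z ∂μ = 0) {n : ℕ} (hn : 0 < n)
    {a : ℝ} (ha : 0 ≤ a) (s : S) :
    (Measure.infinitePi fun _ : ℕ => μ)
      {ω | a ≤ ∑ k ∈ Finset.range n, X (stateSeq step s ω k) (ω k)} ≤
      ENNReal.ofReal (Real.exp (-(a ^ 2 / (2 * n * B ^ 2)))) := by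
  have hn' : (0 : ℝ) < n := by exact_mod_cast hn
  -- This `t` minimizes the Chernoff exponent `n * B ^ 2 * t ^ 2 / 2 - t * a`.
  set t := a / (n * B ^ 2) with ht
  have ht0 : 0 ≤ t := by positivity
  have hmgf : ∀ s, ∫⁻ z, ENNReal.ofReal (Real.exp (t * X s z)) ∂μ ≤
      ENNReal.ofReal (Real.exp (B ^ 2 * t ^ 2 / 2)) := by
    intro s
    have hsub := ProbabilityTheory.hasSubgaussianMGF_of_mem_Icc_of_integral_eq_zero (μ := μ)
      (X := X s) (a := -B) (b := B) (hX.comp (measurable_const.prodMk measurable_id)).aemeasurable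
      ((hbound s).mono fun z hz => abs_le.1 hz) (hmean s)
    rw [← ofReal_integral_eq_lintegral_ofReal (hsub.integrable_exp_mul t)
      (Filter.Eventually.of_forall fun z => (Real.exp_pos _).le)]
    refine ENNReal.ofReal_le_ofReal ((hsub.mgf_le t).trans (le_of_eq ?_))
    have : (((‖B - -B‖₊ / 2) ^ 2 : NNReal) : ℝ) = B ^ 2 := by
      push_cast
      rw [Real.norm_of_nonneg (by linarith)]
      ring
    rw [this]
  have hmain := lintegral_exp_sum_le hstep hX hmgf n s
  have hmeasurable : Measurable fun ω : ℕ → Z => ENNReal.ofReal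
      (Real.exp (t * ∑ k ∈ Finset.range n, X (stateSeq step s ω k) (ω k))) := by
    refine ENNReal.measurable_ofReal.comp (Real.measurable_exp.comp (measurable_const.mul ?_))
    exact Finset.measurable_fun_sum _ fun k _ =>
      hX.comp ((measurable_stateSeq hstep s k).prodMk (measurable_pi_apply k))
  have hmarkov := mul_meas_ge_le_lintegral₀ (μ := Measure.infinitePi fun _ : ℕ => μ)
    hmeasurable.aemeasurable (ENNReal.ofReal (Real.exp (t * a)))
  have hsub : {ω : ℕ → Z | a ≤ ∑ k ∈ Finset.range n, X (stateSeq step s ω k) (ω k)} ⊆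
      {ω | ENNReal.ofReal (Real.exp (t * a)) ≤ ENNReal.ofReal
        (Real.exp (t * ∑ k ∈ Finset.range n, X (stateSeq step s ω k) (ω k)))} := fun ω hω =>
    ENNReal.ofReal_le_ofReal (Real.exp_le_exp.2 (mul_le_mul_of_nonneg_left hω ht0))
  refine (measure_mono hsub).trans ?_
  have hpos : ENNReal.ofReal (Real.exp (t * a)) ≠ 0 := by simp [Real.exp_pos]
  have h1 := hmarkov.trans hmain
  rw [mul_comm, ← ENNReal.le_div_iff_mul_le (Or.inl hpos) (Or.inl ENNReal.ofReal_ne_top)] at h1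
  refine h1.trans (le_of_eq ?_)
  rw [← ENNReal.ofReal_pow (Real.exp_pos _).le, ← ENNReal.ofReal_div_of_pos (Real.exp_pos _),
    ← Real.exp_nat_mul, ← Real.exp_sub]
  congr 2
  rw [ht]
  field_simp
  ring

end Concentration

/-! ### From the surrogate objective to the margin error -/

section Accuracy

variable {d : ℕ}

lemma measurable_halfspace (w : Fin d → ℝ) : Measurable (halfspace w) := by
  unfold halfspace Real.sign dotProduct
  refine Measurable.ite ?_ measurable_const (Measurable.ite ?_ measurable_const measurable_const)
  · exact measurableSet_lt (by fun_prop) measurable_const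
  · exact measurableSet_lt measurable_const (by fun_prop)

lemma measurableSet_isValid (p : ℝ≥0∞) [Fact (1 ≤ p)] :
    MeasurableSet {z : Example d | IsValid p z} := by
  have h1 : Measurable (vecNorm p : (Fin d → ℝ) → ℝ) := by
    have : Continuous (vecNorm p : (Fin d → ℝ) → ℝ) :=
      continuous_norm.comp (PiLp.continuous_toLp p _)
    exact this.measurable
  refine MeasurableSet.inter (measurableSet_le (h1.comp measurable_fst) measurable_const)
    (MeasurableSet.union ?_ ?_)
  · exact measurableSet_eq_fun measurable_snd measurable_const
  · exact measurableSet_eq_fun measurable_snd measurable_const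

/-- A halfspace with margin together with the marginal distribution it separates. -/
structure HasMargin (μ : Measure (Fin d → ℝ)) (p : ℝ≥0∞) (γ : ℝ) (w : Fin d → ℝ) : Prop where
  norm_le : ∀ᵐ x ∂μ, vecNorm p x ≤ 1
  lt_abs : ∀ᵐ x ∂μ, γ < |w ⬝ᵥ x|

lemma halfspace_cases {γ : ℝ} (hγ : 0 < γ) {w x : Fin d → ℝ} (h : γ < |w ⬝ᵥ x|) :
    (halfspace w x = 1 ∨ halfspace w x = -1) ∧ halfspace w x * (w ⬝ᵥ x) = |w ⬝ᵥ x| := by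
  unfold halfspace
  rcases lt_trichotomy (w ⬝ᵥ x) 0 with h0 | h0 | h0
  · rw [Real.sign_of_neg h0, abs_of_neg h0]; simp
  · rw [h0, abs_zero] at h; linarith
  · rw [Real.sign_of_pos h0, abs_of_pos h0]; simp

variable {p q : ℝ≥0∞} {γ η : ℝ} {wstar : Fin d → ℝ} {D : Measure (Example d)}

lemma HasMargin.ae_isValid [Fact (1 ≤ p)] (hγ : 0 < γ) (h : HasMargin D.fst p γ wstar)
    (hD : IsRCN D wstar η) : ∀ᵐ z ∂D, IsValid p z := by
  have hm := measurable_halfspace wstar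
  rw [hD, ae_add_measure_iff]
  constructor <;> refine Measure.ae_smul_measure ?_ _
  · rw [ae_map_iff (by fun_prop) (measurableSet_isValid p)]
    filter_upwards [h.norm_le, h.lt_abs] with x h1 h2
    exact ⟨h1, (halfspace_cases hγ h2).1⟩
  · rw [ae_map_iff (by fun_prop) (measurableSet_isValid p)]
    filter_upwards [h.norm_le, h.lt_abs] with x h1 h2
    refine ⟨h1, ?_⟩
    rcases (halfspace_cases hγ h2).1 with h | h <;> simp [h]

/-- Transfers an inequality averaged over the noisy label at each point to the joint distribution.
-/
lemma HasMargin.integral_nonpos [Fact (1 ≤ p)] [IsProbabilityMeasure D] (hγ : 0 < γ)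
    (h : HasMargin D.fst p γ wstar) (hD : IsRCN D wstar η) (hη0 : 0 ≤ η) (hη1 : η ≤ 1)
    {F : Example d → ℝ} (hF : Measurable F) {B : ℝ} (hB : ∀ z, IsValid p z → |F z| ≤ B)
    (hle : ∀ᵐ x ∂D.fst,
      (1 - η) * F (x, halfspace wstar x) + η * F (x, -halfspace wstar x) ≤ 0) :
    ∫ z, F z ∂D ≤ 0 := by
  have hm := measurable_halfspace wstar
  have hi : ∀ c : ℝ, c = 1 ∨ c = -1 →
      Integrable (fun x => F (x, c * halfspace wstar x)) D.fst := by
    intro c hc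
    refine Integrable.of_bound (hF.comp (by fun_prop)).aestronglyMeasurable B ?_
    filter_upwards [h.norm_le, h.lt_abs] with x h1 h2
    refine hB _ ⟨h1, ?_⟩
    rcases (halfspace_cases hγ h2).1 with h | h <;> rcases hc with rfl | rfl <;> simp [h]
  have hi1 := hi 1 (Or.inl rfl)
  have hi2 := hi (-1) (Or.inr rfl)
  simp only [one_mul, neg_mul] at hi1 hi2
  have hint : ∫ z, F z ∂D = ∫ x, ((1 - η) * F (x, halfspace wstar x) +
      η * F (x, -halfspace wstar x)) ∂D.fst := by
    have e1 : Integrable F (D.fst.map fun x => (x, halfspace wstar x)) :=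
      (integrable_map_measure hF.aestronglyMeasurable (by fun_prop)).2 hi1
    have e2 : Integrable F (D.fst.map fun x => (x, -halfspace wstar x)) :=
      (integrable_map_measure hF.aestronglyMeasurable (by fun_prop)).2 hi2
    conv_lhs => rw [hD]
    rw [integral_add_measure (e1.smul_measure ENNReal.ofReal_ne_top)
      (e2.smul_measure ENNReal.ofReal_ne_top), integral_smul_measure, integral_smul_measure,
      integral_map (by fun_prop) hF.aestronglyMeasurable,
      integral_map (by fun_prop) hF.aestronglyMeasurable,
      ENNReal.toReal_ofReal (by linarith), ENNReal.toReal_ofReal hη0,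
      integral_add (hi1.const_mul _) (hi2.const_mul _), integral_const_mul, integral_const_mul]
    rfl
  rw [hint]
  exact integral_nonpos_of_ae hle

/-- The core estimate. Here `M` and `m` are the margins of `w*` and `w` with respect to the
noiseless label; flipping the label changes their signs. -/
lemma leaky_pointwise {lam M m : ℝ} (hγ : 0 < γ) (hγ1 : γ ≤ 1) (hη0 : 0 ≤ η) (hηl : η ≤ lam)
    (hlam : lam ≤ 1 / 2) (hM : γ < M) (hm : |m| ≤ 1) :
    ((1 - lam) * (1 / 2 - η) + (lam - η) * (1 / γ - 1)) *
      ((1 - η) * ((if m ≤ γ / 2 then 1 else 0) - η) +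
        η * ((if -m ≤ γ / 2 then 1 else 0) - η)) ≤
      (1 - η) * ((1 - η) * leaky lam γ m + η * leaky lam γ (-m) -
        ((1 - η) * leaky lam γ M + η * leaky lam γ (-M)) + (lam - η) * (1 / γ - 1)) := by
  have h1γ : 1 ≤ 1 / γ := by rw [le_div_iff₀ hγ]; linarith
  obtain ⟨hm1, hm2⟩ := abs_le.1 hm
  set A := (1 - lam) * (1 / 2 - η) + (lam - η) * (1 / γ - 1) with hA
  have hA0 : 0 ≤ A := by
    have := mul_nonneg (show 0 ≤ 1 - lam by linarith) (show 0 ≤ 1 / 2 - η by linarith)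
    have := mul_nonneg (show 0 ≤ lam - η by linarith) (show 0 ≤ 1 / γ - 1 by linarith)
    linarith
  have p1 : lam * (1 - m / γ) ≤ leaky lam γ m := by
    rw [leaky_eq_max hγ hlam]; exact le_max_left _ _
  have p2 : (1 - lam) * (1 - m / γ) ≤ leaky lam γ m := by
    rw [leaky_eq_max hγ hlam]; exact le_max_right _ _
  have p3 : (1 - lam) * (1 + m / γ) ≤ leaky lam γ (-m) := by
    rw [leaky_eq_max hγ hlam, neg_div, sub_neg_eq_add]; exact le_max_right _ _
  have hMγ : 1 ≤ M / γ := by rw [le_div_iff₀ hγ]; linarith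
  -- As a function of `M / γ` the left side is affine with slope `η - lam ≤ 0`, so its value at `M =
  -- γ` is an upper bound.
  have pM : (1 - η) * leaky lam γ M + η * leaky lam γ (-M) ≤ 2 * η * (1 - lam) := by
    rw [leaky, if_pos hM, leaky, if_neg (by linarith), neg_div, sub_neg_eq_add]
    nlinarith
  have hη1 : 0 ≤ 1 - η := by linarith
  -- If `m > γ / 2`, only the flipped label is counted as an error, so the error probability is `η`
  -- and the left side vanishes. Otherwise it is at most `1 - η`.
  have herr : (1 - η) * ((if m ≤ γ / 2 then 1 else 0) - η) +
        η * ((if -m ≤ γ / 2 then 1 else 0) - η) ≤ (1 - η) * (if m ≤ γ / 2 then 1 else 0) := by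
    split_ifs <;> nlinarith
  refine (mul_le_mul_of_nonneg_left herr hA0).trans ?_
  rw [← mul_assoc, mul_comm A, mul_assoc]
  refine mul_le_mul_of_nonneg_left ?_ hη1
  have q3 := mul_le_mul_of_nonneg_left p3 hη0
  -- For `m ≤ γ / 2` the steep line is a sufficient lower bound at both `m` and `-m`. In the other
  -- case the flat line is used at `m`, and the worst value is `m = 1`.
  split_ifs with hmγ
  · have q2 := mul_le_mul_of_nonneg_left p2 hη1
    have hx : m / γ ≤ 1 / 2 := by rw [div_le_iff₀ hγ]; linarith
    have q4 : 0 ≤ ((1 - lam) * (1 - 2 * η)) * (1 / 2 - m / γ) :=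
      mul_nonneg (mul_nonneg (by linarith) (by linarith)) (by linarith)
    nlinarith
  · have q1 := mul_le_mul_of_nonneg_left p1 hη1
    have hx : m / γ ≤ 1 / γ := by gcongr
    have q4 := mul_nonneg (show 0 ≤ lam - η by linarith) (show 0 ≤ 1 / γ - m / γ by linarith)
    nlinarith

lemma abs_mul_dotProduct_le (hpq : p.HolderConjugate q) {w : Fin d → ℝ} (hw : vecNorm q w ≤ 1)
    {z : Example d} (hz : IsValid p z) : |z.2 * (w ⬝ᵥ z.1)| ≤ 1 := by
  have := Fact.mk hpq.one_le
  have hy : |z.2| = 1 := by rcases hz.2 with h | h <;> simp [h]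
  rw [abs_mul, hy, one_mul, dotProduct_comm]
  have h0 := vecNorm_nonneg (p := p) z.1
  have h1 := hz.1
  exact (abs_dotProduct_le_vecNorm hpq z.1 w).trans (by nlinarith)

lemma abs_surrogateLoss_sub_le (hpq : p.HolderConjugate q) {lam : ℝ} (hγ : 0 < γ) (h0 : 0 ≤ lam)
    (hlam : lam ≤ 1 / 2) {w u : Fin d → ℝ} (hw : vecNorm q w ≤ 1) (hu : vecNorm q u ≤ 1)
    {z : Example d} (hz : IsValid p z) :
    |surrogateLoss lam γ w z - surrogateLoss lam γ u z| ≤ 2 / γ := by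
  refine (leaky_sub_le hγ h0 hlam _ _).trans ?_
  have h1 := abs_mul_dotProduct_le hpq hw hz
  have h2 := abs_mul_dotProduct_le hpq hu hz
  have h3 : |z.2 * (w ⬝ᵥ z.1) - z.2 * (u ⬝ᵥ z.1)| ≤ 2 := (abs_sub _ _).trans (by linarith)
  calc _ ≤ 1 / γ * 2 := by gcongr
    _ = 2 / γ := by ring

/-- The excess surrogate loss over the comparator `u`. -/
def excessLoss (lam γ : ℝ) (u w : Fin d → ℝ) (z : Example d) : ℝ :=
  surrogateLoss lam γ w z - surrogateLoss lam γ u z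

lemma measurable_excessLoss (lam γ : ℝ) (u : Fin d → ℝ) :
    Measurable (Function.uncurry (excessLoss lam γ u)) :=
  (measurable_surrogateLoss lam γ).sub
    ((measurable_surrogateLoss lam γ).comp (measurable_const.prodMk measurable_snd))

lemma measurable_excessLoss_right (lam γ : ℝ) (u w : Fin d → ℝ) :
    Measurable (excessLoss lam γ u w) :=
  (measurable_excessLoss lam γ u).comp (measurable_const.prodMk measurable_id)

lemma HasMargin.integrable_excessLoss [IsProbabilityMeasure D] (hpq : p.HolderConjugate q)
    {lam : ℝ} (hγ : 0 < γ) (h0 : 0 ≤ lam) (hlam : lam ≤ 1 / 2) (h : HasMargin D.fst p γ wstar)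
    (hD : IsRCN D wstar η) {w u : Fin d → ℝ} (hw : vecNorm q w ≤ 1) (hu : vecNorm q u ≤ 1) :
    Integrable (excessLoss lam γ u w) D := by
  have := Fact.mk hpq.one_le
  refine Integrable.of_bound (measurable_excessLoss_right _ _ _ _).aestronglyMeasurable
    (2 / γ) ?_
  filter_upwards [h.ae_isValid hγ hD] with z hz
  exact abs_surrogateLoss_sub_le hpq hγ h0 hlam hw hu hz

/-- Hölder's inequality at a single point in the support of the conditions. It gives the sign of the
correction term `1 / γ - 1`. -/
lemma HasMargin.lt_one [IsProbabilityMeasure D] (hpq : p.HolderConjugate q)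
    (h : HasMargin D.fst p γ wstar) (hw : vecNorm q wstar ≤ 1) : γ < 1 := by
  have := Fact.mk hpq.one_le
  have : IsProbabilityMeasure D.fst := Measure.fst.instIsProbabilityMeasure
  obtain ⟨x, h1, h2⟩ := (h.norm_le.and h.lt_abs).exists
  have h0 := vecNorm_nonneg (p := p) x
  have h3 := abs_dotProduct_le_vecNorm hpq x wstar
  rw [dotProduct_comm] at h3
  nlinarith

/-- Integrating `leaky_pointwise` gives `A (err - η) ≤ (1 - η) (excess + (lam - η) (1 / γ - 1))`.
For excess at most `lam - η` the right side is at most `(1 - η) (lam - η) / γ`, and the value of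
`lam` makes this at most `A ε`. -/
lemma HasMargin.marginError_le [IsProbabilityMeasure D] (hpq : p.HolderConjugate q)
    {lam ε : ℝ} (hγ : 0 < γ) (hε : 0 < ε) (hη0 : 0 ≤ η) (hη : η < 1 / 2)
    (hlam : lam = (ε * γ / 2 + η) / (1 + ε * γ)) (h : HasMargin D.fst p γ wstar)
    (hD : IsRCN D wstar η) (hwstar : vecNorm q wstar ≤ 1) {w : Fin d → ℝ} (hw : vecNorm q w ≤ 1)
    (hloss : ∫ z, excessLoss lam γ wstar w z ∂D ≤ lam - η) :
    marginError D (γ / 2) w ≤ η + ε := by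
  have := Fact.mk hpq.one_le
  have hγ1 := h.lt_one hpq hwstar
  have hεγ : 0 < ε * γ := mul_pos hε hγ
  have hdiff : lam - η = ε * γ * (1 / 2 - η) / (1 + ε * γ) := by rw [hlam]; field_simp; ring
  have hone : 1 - lam = (1 - η + ε * γ / 2) / (1 + ε * γ) := by rw [hlam]; field_simp; ring
  have hηl : η < lam := by
    have : 0 < lam - η := by
      rw [hdiff]; exact div_pos (mul_pos hεγ (by linarith)) (by linarith)
    linarith
  have hlam2 : lam ≤ 1 / 2 := by
    rw [hlam, div_le_iff₀ (by positivity)]; linarith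
  have h1γ : 1 ≤ 1 / γ := by rw [le_div_iff₀ hγ]; linarith
  set A := (1 - lam) * (1 / 2 - η) + (lam - η) * (1 / γ - 1) with hA
  have hA0 : 0 < A := by
    have := mul_pos (show 0 < 1 - lam by linarith) (show 0 < 1 / 2 - η by linarith)
    have := mul_nonneg (show 0 ≤ lam - η by linarith) (show 0 ≤ 1 / γ - 1 by linarith)
    linarith
  set E : Set (Example d) := {z | z.2 * (w ⬝ᵥ z.1) ≤ γ / 2} with hE
  have hEm : MeasurableSet E := by
    refine measurableSet_le (measurable_snd.mul ?_) measurable_const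
    exact measurable_dotProduct_fst.comp (measurable_const.prodMk measurable_id)
  have hind : Measurable (E.indicator (1 : Example d → ℝ)) := measurable_one.indicator hEm
  have hexc := measurable_excessLoss_right lam γ wstar w
  have hexcb : ∀ z, IsValid p z → |excessLoss lam γ wstar w z| ≤ 2 / γ := fun z hz =>
    abs_surrogateLoss_sub_le hpq hγ (by linarith) hlam2 hw hwstar hz
  have hindb : ∀ z, |E.indicator (1 : Example d → ℝ) z| ≤ 1 := fun z => by
    by_cases hz : z ∈ E <;> simp [hz]
  have key := h.integral_nonpos hγ hD hη0 (by linarith)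
    (F := fun z => A * (E.indicator 1 z - η) -
      (1 - η) * (excessLoss lam γ wstar w z + (lam - η) * (1 / γ - 1)))
    (B := A * (1 + η) + (1 - η) * (2 / γ + (lam - η) * (1 / γ - 1)))
    (by fun_prop) (fun z hz => ?_) ?_
  · have hi1 : Integrable (E.indicator (1 : Example d → ℝ)) D :=
      Integrable.of_bound hind.aestronglyMeasurable 1 (Filter.Eventually.of_forall hindb)
    have hi2 := h.integrable_excessLoss hpq hγ (by linarith) hlam2 hD hw hwstar
    have hi3 : Integrable (fun z => A * (E.indicator 1 z - η)) D :=
      (hi1.sub (integrable_const _)).const_mul _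
    have hi4 : Integrable (fun z => (1 - η) * (excessLoss lam γ wstar w z +
        (lam - η) * (1 / γ - 1))) D := (hi2.add (integrable_const _)).const_mul _
    rw [integral_sub hi3 hi4, integral_const_mul, integral_const_mul,
      integral_sub hi1 (integrable_const _), integral_add hi2 (integrable_const _),
      integral_indicator_one hEm] at key
    simp only [integral_const, probReal_univ, smul_eq_mul, one_mul] at key
    change D.real E ≤ η + ε
    -- After the common factor `ε (1/2 - η) / (1 + εγ)` is removed, the claim is `1 - η ≤ 1 - η +
    -- εγ/2 + ε (1 - γ)`.
    have hfin : (1 - η) * ((lam - η) + (lam - η) * (1 / γ - 1)) ≤ A * ε := by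
      rw [hA, hone, hdiff]
      have e1 : (1 - η) * (ε * γ * (1 / 2 - η) / (1 + ε * γ) +
          ε * γ * (1 / 2 - η) / (1 + ε * γ) * (1 / γ - 1)) =
          ε * (1 / 2 - η) / (1 + ε * γ) * (1 - η) := by field_simp; ring
      have e2 : ((1 - η + ε * γ / 2) / (1 + ε * γ) * (1 / 2 - η) +
          ε * γ * (1 / 2 - η) / (1 + ε * γ) * (1 / γ - 1)) * ε =
          ε * (1 / 2 - η) / (1 + ε * γ) * (1 - η + ε * γ / 2 + ε * (1 - γ)) := by
        field_simp
      rw [e1, e2]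
      refine mul_le_mul_of_nonneg_left ?_
        (div_nonneg (mul_nonneg hε.le (by linarith)) (by linarith))
      have := mul_nonneg hε.le (show 0 ≤ 1 - γ by linarith)
      linarith
    have h3 : (1 - η) * (∫ z, excessLoss lam γ wstar w z ∂D + (lam - η) * (1 / γ - 1)) ≤ A * ε :=
      (mul_le_mul_of_nonneg_left (by linarith) (by linarith)).trans hfin
    have h4 : A * (D.real E - η) ≤ A * ε := by linarith
    linarith [le_of_mul_le_mul_left h4 hA0]
  · refine (abs_sub _ _).trans (add_le_add ?_ ?_)
    · rw [abs_mul, abs_of_pos hA0]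
      refine mul_le_mul_of_nonneg_left ((abs_sub _ _).trans ?_) hA0.le
      rw [abs_of_nonneg hη0]
      linarith [hindb z]
    · rw [abs_mul, abs_of_nonneg (show 0 ≤ 1 - η by linarith)]
      refine mul_le_mul_of_nonneg_left ((abs_add_le _ _).trans ?_) (by linarith)
      rw [abs_of_nonneg (mul_nonneg (show 0 ≤ lam - η by linarith)
        (show 0 ≤ 1 / γ - 1 by linarith))]
      linarith [hexcb z hz]
  · filter_upwards [h.norm_le, h.lt_abs] with x hx1 hx2
    obtain ⟨hs, hM⟩ := halfspace_cases hγ hx2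
    have hm := abs_mul_dotProduct_le hpq hw (z := (x, halfspace wstar x)) ⟨hx1, hs⟩
    have hpt := leaky_pointwise hγ hγ1.le hη0 hηl.le hlam2 hx2 hm
    simp only [excessLoss, surrogateLoss, neg_mul, Set.indicator_apply, hE, Set.mem_ofPred_eq,
      Pi.one_apply, hM] at hpt ⊢
    rw [← hA] at hpt
    linarith

end Accuracy

/-! ### Step size, number of rounds, and the guarantee -/

/-- The reciprocal of `γ` times the accuracy to which the surrogate objective is minimized. -/
def invAccuracy (ε γ η : ℝ) : ℝ := 2 * (1 / (1 - 2 * η)) * (1 / γ) * ((1 / ε) * (1 / γ) + 1)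

/-- The step size of mirror descent. -/
def stepSize (C m d : ℕ) (ε γ η : ℝ) : ℝ := γ / (4 * C * d * invAccuracy ε γ η) ^ m

/-- The number of rounds of mirror descent, before rounding up. -/
def roundBound (C m d : ℕ) (ε γ η δ : ℝ) : ℝ :=
  8 * d * invAccuracy ε γ η * (4 * C * d * invAccuracy ε γ η) ^ m +
    128 * Real.log (1 / δ) * invAccuracy ε γ η ^ 2

/-- The weight in the leaky loss. -/
def lossWeight (ε γ η : ℝ) : ℝ := (ε * γ / 2 + η) / (1 + ε * γ)

section Guarantee

variable {d C m : ℕ} {p q : ℝ≥0∞} {ε γ η δ : ℝ} {proj W : (Fin d → ℝ) → Fin d → ℝ}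

lemma invAccuracy_pos (hε : 0 < ε) (hγ : 0 < γ) (hη : η < 1 / 2) : 0 < invAccuracy ε γ η := by
  have : 0 < 1 - 2 * η := by linarith
  unfold invAccuracy
  positivity

lemma stepSize_pos (hC : 0 < C) (hd : 0 < d) (hε : 0 < ε) (hγ : 0 < γ) (hη : η < 1 / 2) :
    0 < stepSize C m d ε γ η := by
  have := invAccuracy_pos hε hγ hη
  unfold stepSize
  positivity

lemma roundBound_pos (hC : 0 < C) (hd : 0 < d) (hε : 0 < ε) (hγ : 0 < γ) (hη : η < 1 / 2)
    (hδ0 : 0 < δ) (hδ1 : δ < 1) : 0 < roundBound C m d ε γ η δ := by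
  have := invAccuracy_pos hε hγ hη
  have : 0 < Real.log (1 / δ) := Real.log_pos (by rwa [lt_div_iff₀ hδ0, one_mul])
  unfold roundBound
  positivity

/-- Explains `invAccuracy`: the tolerated excess `lam - η` is the reciprocal of `invAccuracy * γ`.
-/
lemma lossWeight_sub (hε : 0 < ε) (hγ : 0 < γ) (hη : η < 1 / 2) :
    lossWeight ε γ η - η = 1 / (invAccuracy ε γ η * γ) := by
  have h1 : (1 - 2 * η) ≠ 0 := by linarith
  have h2 : 1 + ε * γ ≠ 0 := by positivity
  have h3 : γ ≠ 0 := hγ.ne'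
  have h4 : ε ≠ 0 := hε.ne'
  have h5 : invAccuracy ε γ η = 2 * (1 + ε * γ) / ((1 - 2 * η) * γ * (ε * γ)) := by
    unfold invAccuracy; field_simp
  rw [h5, lossWeight]
  field_simp
  ring

lemma lossWeight_le (hε : 0 < ε) (hγ : 0 < γ) (hη : η < 1 / 2) : lossWeight ε γ η ≤ 1 / 2 := by
  have : 0 < ε * γ := mul_pos hε hγ
  rw [lossWeight, div_le_iff₀ (by positivity)]
  linarith

lemma lossWeight_pos (hε : 0 < ε) (hγ : 0 < γ) (hη0 : 0 ≤ η) : 0 < lossWeight ε γ η := by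
  have : 0 < ε * γ := mul_pos hε hγ
  unfold lossWeight
  positivity

lemma vecNorm_lossGrad_le [Fact (1 ≤ p)] {lam : ℝ} (hγ : 0 < γ) (h0 : 0 ≤ lam) (h1 : lam ≤ 1)
    (w : Fin d → ℝ) {z : Example d} (hz : IsValid p z) : vecNorm p (lossGrad lam γ w z) ≤ 1 / γ := by
  have hy : |z.2| = 1 := by rcases hz.2 with h | h <;> simp [h]
  rw [lossGrad, vecNorm_smul, abs_mul, hy, mul_one]
  have := abs_leakySlope_le hγ h0 h1 (z.2 * (w ⬝ᵥ z.1))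
  have := hz.1
  have := vecNorm_nonneg (p := p) z.1
  nlinarith [abs_nonneg (leakySlope lam γ (z.2 * (w ⬝ᵥ z.1)))]

/-- The regret of mirror descent against a fixed comparator. -/
lemma IsMirrorScheme.regret [Fact (1 ≤ p)] (hs : IsMirrorScheme p q C m proj W) {lam b : ℝ}
    (hγ : 0 < γ) (h0 : 0 ≤ lam) (hlam : lam ≤ 1 / 2) (hb0 : 0 ≤ b) (hb1 : b ≤ 1)
    {u : Fin d → ℝ} (hu : vecNorm q u ≤ 1) {ω : ℕ → Example d} (hω : ∀ k, IsValid p (ω k)) (T : ℕ) :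
    γ * b ^ m * ∑ k ∈ Finset.range T,
      excessLoss lam γ u (W (dualIter proj W lam γ (γ * b ^ m) ω k)) (ω k) ≤
      2 * d + T * (C * d * b ^ (m + 1)) := by
  obtain ⟨V, hV⟩ := hs.exists_potential
  obtain ⟨hV0, hVs, hVstep⟩ := hV u hu
  set α := γ * b ^ m with hα
  have hα0 : 0 ≤ α := by positivity
  -- The potential telescopes. Gradients have norm at most `1 / γ`, so the step size `γ * b ^ m`
  -- gives dual displacements of norm at most `b ^ m`.
  have hind : ∀ n : ℕ, α * ∑ k ∈ Finset.range n,
      excessLoss lam γ u (W (dualIter proj W lam γ α ω k)) (ω k) +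
        V u (dualIter proj W lam γ α ω n) ≤ V u 0 + n * (C * d * b ^ (m + 1)) := by
    intro n
    induction n with
    | zero => simp [dualIter]
    | succ n ih =>
      set v := dualIter proj W lam γ α ω n with hv
      set g := lossGrad lam γ (W v) (ω n) with hg
      have hsub := isSubgradientAt_lossGrad hγ hlam (W v) (ω n) u
      have hgn := vecNorm_lossGrad_le hγ h0 (by linarith) (W v) (hω n)
      have hnorm : vecNorm p (α • g) ≤ b ^ m := by
        rw [vecNorm_smul, abs_of_nonneg hα0]
        calc α * vecNorm p g ≤ α * (1 / γ) := by gcongr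
          _ = b ^ m := by rw [hα]; field_simp
      have hst := hVstep v (α • g) b hb0 hb1 hnorm
      have hexc : excessLoss lam γ u (W v) (ω n) ≤ g ⬝ᵥ (W v - u) := by
        rw [excessLoss]
        simp only [dotProduct_sub] at hsub ⊢
        linarith
      have := mul_le_mul_of_nonneg_left hexc hα0
      rw [smul_dotProduct, smul_eq_mul] at hst
      rw [Finset.sum_range_succ, mul_add, dualIter, ← hv, ← hg]
      push_cast
      linarith
  linarith [hind T, hV0 (dualIter proj W lam γ α ω T)]

lemma dualIter_eq_stateSeq (lam α : ℝ) (ω : ℕ → Example d) (k : ℕ) :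
    dualIter proj W lam γ α ω k =
      stateSeq (fun v z => proj v - α • lossGrad lam γ (W v) z) 0 ω k := by
  induction k with
  | zero => rfl
  | succ k ih => rw [dualIter, stateSeq, ih]

/-- The averaged output of mirror descent. -/
def smdOutput (proj W : (Fin d → ℝ) → Fin d → ℝ) (C m : ℕ) (ε γ η δ : ℝ) (ω : ℕ → Example d) :
    Fin d → ℝ :=
  _root_.average ⌈roundBound C m d ε γ η δ⌉₊ fun k =>
    W (dualIter proj W (lossWeight ε γ η) γ (stepSize C m d ε γ η) ω k)

/-- With `β = 1 / (4 C d ξ)` the error per round is a quarter of `lam - η`, and the lower bound on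
`T` makes the initial potential contribute at most another quarter on average. -/
lemma IsMirrorScheme.sum_excessLoss_le [Fact (1 ≤ p)] (hs : IsMirrorScheme p q C m proj W)
    (hC : 0 < C) (hd : 0 < d) (hε : 0 < ε) (hγ : 0 < γ) (hγ1 : γ < 1) (hη0 : 0 ≤ η)
    (hη : η < 1 / 2) {T : ℕ}
    (hT : 8 * d * invAccuracy ε γ η * (4 * C * d * invAccuracy ε γ η) ^ m ≤ T)
    {u : Fin d → ℝ} (hu : vecNorm q u ≤ 1) {ω : ℕ → Example d} (hω : ∀ k, IsValid p (ω k)) :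
    ∑ k ∈ Finset.range T, excessLoss (lossWeight ε γ η) γ u
      (W (dualIter proj W (lossWeight ε γ η) γ (stepSize C m d ε γ η) ω k)) (ω k) ≤
      T * (lossWeight ε γ η - η) / 2 := by
  have hξ := invAccuracy_pos hε hγ hη
  have hτ := lossWeight_sub hε hγ hη
  have hlam := lossWeight_le hε hγ hη
  set ξ := invAccuracy ε γ η with hξdef
  have hC' : (1 : ℝ) ≤ C := by exact_mod_cast hC
  have hd' : (1 : ℝ) ≤ d := by exact_mod_cast hd
  -- Since `lam - η ≤ 1 / 2` and `γ < 1`, the accuracy parameter is at least `1`; this ensures `β ≤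
  -- 1`.
  have hξ1 : 1 ≤ ξ := by
    have h1 : 1 / (ξ * γ) ≤ 1 / 2 := by linarith
    rw [div_le_div_iff₀ (by positivity) (by norm_num)] at h1
    nlinarith
  set β := 1 / (4 * C * d * ξ) with hβ
  have hden : 1 ≤ 4 * C * d * ξ := by
    have := one_le_mul_of_one_le_of_one_le (one_le_mul_of_one_le_of_one_le hC' hd') hξ1
    linarith
  have hβ0 : 0 < β := by positivity
  have hβ1 : β ≤ 1 := by rw [hβ, div_le_one (by linarith)]; exact hden
  have hα : stepSize C m d ε γ η = γ * β ^ m := by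
    rw [stepSize, hβ, div_pow, one_pow, ← hξdef]; ring
  have hreg := hs.regret hγ (lossWeight_pos hε hγ hη0).le hlam hβ0.le hβ1 hu hω T
  rw [hα]
  refine le_of_mul_le_mul_left (hreg.trans ?_) (show 0 < γ * β ^ m by positivity)
  have e1 : (C : ℝ) * d * β ^ (m + 1) = β ^ m / (4 * ξ) := by
    rw [pow_succ]
    have : (C : ℝ) * d * β = 1 / (4 * ξ) := by rw [hβ]; field_simp
    calc (C : ℝ) * d * (β ^ m * β) = β ^ m * (C * d * β) := by ring
      _ = _ := by rw [this]; ring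
  have e2 : (8 : ℝ) * d * ξ ≤ T * β ^ m := by
    have h1 := mul_le_mul_of_nonneg_right hT (show 0 ≤ β ^ m by positivity)
    have h2 : (4 * C * d * ξ) ^ m * β ^ m = 1 := by
      rw [← mul_pow, hβ, mul_one_div_cancel (by linarith), one_pow]
    calc (8 : ℝ) * d * ξ = 8 * d * ξ * ((4 * C * d * ξ) ^ m * β ^ m) := by rw [h2, mul_one]
      _ = 8 * d * ξ * (4 * C * d * ξ) ^ m * β ^ m := by ring
      _ ≤ _ := h1
  have e3 : (2 : ℝ) * d ≤ T * β ^ m / (4 * ξ) := by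
    rw [le_div_iff₀ (by positivity)]; linarith
  rw [e1, hτ]
  have e4 : γ * β ^ m * (T * (1 / (ξ * γ)) / 2) = 2 * (T * β ^ m / (4 * ξ)) := by
    field_simp
    ring
  rw [e4]
  have e5 : (T : ℝ) * (β ^ m / (4 * ξ)) = T * β ^ m / (4 * ξ) := by ring
  linarith

/-- The iterate in round `k` depends only on earlier samples, so the differences `X` are centred
given the past. Regret and deviation each use up half of the tolerance `lam - η`. -/
theorem IsMirrorScheme.measure_marginError_le (hpq : p.HolderConjugate q)
    (hs : IsMirrorScheme p q C m proj W)
    (hC : 0 < C) (hd : 0 < d) (hε : 0 < ε) (hγ : 0 < γ) (hη0 : 0 ≤ η) (hη : η < 1 / 2)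
    (hδ0 : 0 < δ) (hδ1 : δ < 1) (D : Measure (Example d)) [IsProbabilityMeasure D]
    {wstar : Fin d → ℝ} (hw : vecNorm q wstar ≤ 1) (hD : IsRCN D wstar η)
    (h : HasMargin D.fst p γ wstar) :
    Measure.infinitePi (fun _ : ℕ => D)
      {ω | ¬ marginError D (γ / 2) (smdOutput proj W C m ε γ η δ ω) ≤ η + ε} ≤
      ENNReal.ofReal δ := by
  have := Fact.mk hpq.one_le
  have := Fact.mk hpq.symm.one_le
  have hγ1 := h.lt_one hpq hw
  have hξ := invAccuracy_pos hε hγ hη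
  have hτ := lossWeight_sub hε hγ hη
  have hlam := lossWeight_le hε hγ hη
  have hlam0 := lossWeight_pos hε hγ hη0
  have hlog : 0 < Real.log (1 / δ) := Real.log_pos (by rwa [lt_div_iff₀ hδ0, one_mul])
  have hRpos := roundBound_pos (m := m) hC hd hε hγ hη hδ0 hδ1
  set T := ⌈roundBound C m d ε γ η δ⌉₊ with hT
  have hT0 : 0 < T := Nat.ceil_pos.2 hRpos
  have hT' : (0 : ℝ) < T := by exact_mod_cast hT0
  have hRT : roundBound C m d ε γ η δ ≤ T := Nat.le_ceil _
  have hTa : 8 * d * invAccuracy ε γ η * (4 * C * d * invAccuracy ε γ η) ^ m ≤ T := by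
    refine le_trans ?_ hRT
    rw [roundBound]
    exact le_add_of_nonneg_right (by positivity)
  have hTb : 128 * Real.log (1 / δ) * invAccuracy ε γ η ^ 2 ≤ T := by
    refine le_trans ?_ hRT
    rw [roundBound]
    exact le_add_of_nonneg_left (by positivity)
  set ξ := invAccuracy ε γ η
  set lam := lossWeight ε γ η with hlamdef
  set α := stepSize C m d ε γ η
  set step : (Fin d → ℝ) → Example d → Fin d → ℝ :=
    fun v z => proj v - α • lossGrad lam γ (W v) z with hstep
  set X : (Fin d → ℝ) → Example d → ℝ := fun v z =>
    ∫ z', excessLoss lam γ wstar (W v) z' ∂D - excessLoss lam γ wstar (W v) z with hX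
  have hWfst : Measurable fun a : (Fin d → ℝ) × Example d => (W a.1, a.2) :=
    (hs.measurable_primal.comp measurable_fst).prodMk measurable_snd
  have hstepm : Measurable (Function.uncurry step) :=
    (hs.measurable_proj.comp measurable_fst).sub
      (((measurable_lossGrad lam γ).comp hWfst).const_smul α)
  have hexm : Measurable fun a : (Fin d → ℝ) × Example d => excessLoss lam γ wstar (W a.1) a.2 :=
    (measurable_excessLoss lam γ wstar).comp hWfst
  have hXm : Measurable (Function.uncurry X) :=
    (hexm.stronglyMeasurable.integral_prod_right'.measurable.comp measurable_fst).sub hexm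
  have hvalid := h.ae_isValid hγ hD
  have hexb : ∀ v, ∀ᵐ z ∂D, |excessLoss lam γ wstar (W v) z| ≤ 2 / γ := fun v =>
    hvalid.mono fun z hz =>
      abs_surrogateLoss_sub_le hpq hγ hlam0.le hlam (hs.vecNorm_primal_le v) hw hz
  have hexi : ∀ v, Integrable (excessLoss lam γ wstar (W v)) D := fun v =>
    h.integrable_excessLoss hpq hγ hlam0.le hlam hD (hs.vecNorm_primal_le v) hw
  have hXb : ∀ v, ∀ᵐ z ∂D, |X v z| ≤ 4 / γ := by
    intro v
    have h1 := norm_integral_le_of_norm_le_const (f := excessLoss lam γ wstar (W v))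
      (hexb v)
    rw [probReal_univ, mul_one, Real.norm_eq_abs] at h1
    filter_upwards [hexb v] with z hz
    refine (abs_sub _ _).trans ((add_le_add h1 hz).trans (le_of_eq (by ring)))
  have hXmean : ∀ v, ∫ z, X v z ∂D = 0 := by
    intro v
    rw [hX]
    simp only
    rw [integral_sub (integrable_const _) (hexi v)]
    simp
  have hconc := measure_sum_stateSeq_ge_le (μ := D) hstepm hXm (B := 4 / γ) (by positivity) hXb
    hXmean hT0 (a := T * (lam - η) / 2)
    (by rw [hτ]; positivity) 0
  have hvalidall : ∀ᵐ ω ∂(Measure.infinitePi fun _ : ℕ => D), ∀ k, IsValid p (ω k) := by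
    rw [ae_all_iff]
    intro k
    exact (measurePreserving_eval_infinitePi (fun _ : ℕ => D) k).quasiMeasurePreserving.ae hvalid
  -- The bad event lies almost surely inside the deviation event, so its own measurability is not
  -- needed.
  refine le_trans (measure_mono_ae ?_) (hconc.trans (ENNReal.ofReal_le_ofReal ?_))
  · filter_upwards [hvalidall] with ω hω hbad
    change T * (lam - η) / 2 ≤ _
    by_contra hlt
    push Not at hlt
    refine hbad (h.marginError_le hpq hγ hε hη0 hη hlamdef hD hw
      (vecNorm_average_le hT0 _ fun k => hs.vecNorm_primal_le _) ?_)
    have hreg := hs.sum_excessLoss_le hC hd hε hγ hγ1 hη0 hη hTa hw hω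
    simp only [dualIter_eq_stateSeq] at hreg
    change ∫ z, excessLoss lam γ wstar
      (_root_.average T fun k => W (dualIter proj W lam γ α ω k)) z ∂D ≤ _
    simp only [dualIter_eq_stateSeq]
    simp only [hX, Finset.sum_sub_distrib] at hlt
    set v := stateSeq step 0 ω
    have hsum : ∑ k ∈ Finset.range T, ∫ z, excessLoss lam γ wstar (W (v k)) z ∂D ≤
        T * (lam - η) := by
      have : ∑ k ∈ Finset.range T, excessLoss lam γ wstar (W (v k)) (ω k) ≤ T * (lam - η) / 2 :=
        hreg
      linarith
    have havg : ∀ z, excessLoss lam γ wstar (_root_.average T fun k => W (v k)) z ≤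
        (T : ℝ)⁻¹ * ∑ k ∈ Finset.range T, excessLoss lam γ wstar (W (v k)) z := by
      intro z
      have := surrogateLoss_average_le hγ hlam hT0 (fun k => W (v k)) z
      simp only [excessLoss, Finset.sum_sub_distrib, Finset.sum_const, Finset.card_range,
        nsmul_eq_mul, mul_sub]
      rw [inv_mul_cancel_left₀ hT'.ne']
      linarith
    have hint := integral_mono (h.integrable_excessLoss hpq hγ hlam0.le hlam hD
      (vecNorm_average_le hT0 _ fun k => hs.vecNorm_primal_le _) hw)
      ((integrable_finsetSum _ fun k _ => hexi (v k)).const_mul _) havg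
    rw [integral_const_mul, integral_finsetSum _ fun k _ => hexi (v k)] at hint
    refine hint.trans ?_
    rw [inv_mul_le_iff₀ hT']
    exact hsum
  · rw [← Real.exp_log hδ0]
    refine Real.exp_le_exp.2 ?_
    -- The Azuma exponent for differences bounded by `4 / γ`; this produces the constant `128` in
    -- `roundBound`.
    have e : (T * (lam - η) / 2) ^ 2 / (2 * T * (4 / γ) ^ 2) = T / (128 * ξ ^ 2) := by
      rw [hτ]
      field_simp
      norm_num
    rw [e, neg_le, ← Real.log_inv, ← one_div, le_div_iff₀ (by positivity)]
    linarith

end Guarantee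

/-! ### Cost calculus for programs -/

namespace RealRAM

variable {d : ℕ} {ω : ℕ → Example d}

/-- The program `c` leads from `s` to `s'` in at most `B` steps. -/
def Runs (ω : ℕ → Example d) (c : Cmd) (s s' : Store) (B : ℕ) : Prop :=
  ∃ t ≤ B, Exec ω c s s' t

lemma Runs.mono {c : Cmd} {s s' : Store} {B B' : ℕ} (h : Runs ω c s s' B) (hB : B ≤ B') :
    Runs ω c s s' B' :=
  h.imp fun _ ht => ⟨ht.1.trans hB, ht.2⟩

lemma Runs.seq {c c' : Cmd} {s s' s'' : Store} {B B' : ℕ} (h : Runs ω c s s' B)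
    (h' : Runs ω c' s' s'' B') : Runs ω (Cmd.seq c c') s s'' (B + B') := by
  obtain ⟨t, ht, e⟩ := h
  obtain ⟨t', ht', e'⟩ := h'
  exact ⟨t + t', add_le_add ht ht', e.seq e'⟩

lemma Runs.linear {c : Cmd} {s s' : Store} {B : ℕ} (h : Runs ω c s s' B) :
    Runs ω c s s' (B * (d + 1)) :=
  h.mono (Nat.le_mul_of_pos_right _ (Nat.succ_pos d))

lemma Runs.seq_linear {c c' : Cmd} {s s' s'' : Store} {K K' n : ℕ} (h : Runs ω c s s' (K * n))
    (h' : Runs ω c' s' s'' (K' * n)) : Runs ω (Cmd.seq c c') s s'' ((K + K') * n) :=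
  (h.seq h').mono (add_mul _ _ _).ge

lemma runs_skip (s : Store) : Runs ω Cmd.skip s s 1 := ⟨1, le_rfl, Exec.skip s⟩

lemma runs_setNat (s : Store) (v : ℕ) (e : NatExpr) :
    Runs ω (Cmd.setNat v e) s (s.setNat v (e.eval s)) (e.cost + 1) := ⟨_, le_rfl, Exec.setNat s v e⟩

lemma runs_setReal (s : Store) (a : ℕ) (i : NatExpr) (e : RealExpr) :
    Runs ω (Cmd.setReal a i e) s (s.setReal a (i.eval s) (e.eval s)) (i.cost + e.cost + 1) :=
  ⟨_, le_rfl, Exec.setReal s a i e⟩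

lemma runs_draw (s : Store) (a : ℕ) : Runs ω (Cmd.draw a) s (s.draw ω a) (d + 1) :=
  ⟨_, le_rfl, Exec.draw s a⟩

lemma runs_ite {b : Test} {c c' : Cmd} {s s' : Store} {B B' : ℕ}
    (h : b.holds s → Runs ω c s s' B) (h' : ¬ b.holds s → Runs ω c' s s' B') :
    Runs ω (Cmd.ite b c c') s s' (b.cost + 1 + (B + B')) := by
  by_cases hb : b.holds s
  · obtain ⟨t, ht, e⟩ := h hb
    exact ⟨_, by omega, Exec.iteTrue hb e⟩
  · obtain ⟨t, ht, e⟩ := h' hb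
    exact ⟨_, by omega, Exec.iteFalse hb e⟩

@[simp] lemma setNat_nat (s : Store) (v n r : ℕ) :
    (s.setNat v n).nat r = if r = v then n else s.nat r := by
  simp [Store.setNat, Function.update_apply]

@[simp] lemma setNat_arr (s : Store) (v n : ℕ) : (s.setNat v n).arr = s.arr := rfl

@[simp] lemma setNat_drawn (s : Store) (v n : ℕ) : (s.setNat v n).drawn = s.drawn := rfl

@[simp] lemma setReal_nat (s : Store) (a i : ℕ) (x : ℝ) : (s.setReal a i x).nat = s.nat := rfl

@[simp] lemma setReal_drawn (s : Store) (a i : ℕ) (x : ℝ) :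
    (s.setReal a i x).drawn = s.drawn := rfl

@[simp] lemma setReal_arr (s : Store) (a i : ℕ) (x : ℝ) (a' j : ℕ) :
    (s.setReal a i x).arr a' j = if a' = a ∧ j = i then x else s.arr a' j := by
  by_cases ha : a' = a
  · subst ha; simp [Store.setReal, Function.update_apply]
  · simp [Store.setReal, ha]

/-! ### Loops -/

/-- `for r := 0, …, nat b - 1 do c`. -/
def forLoop (r b : ℕ) (c : Cmd) : Cmd :=
  Cmd.seq (Cmd.setNat r (NatExpr.const 0))
    (Cmd.loop (Test.natLT (NatExpr.var r) (NatExpr.var b))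
      (Cmd.seq c (Cmd.setNat r (NatExpr.add (NatExpr.var r) (NatExpr.const 1)))))

/-- The `8` covers a test and an increment, four units each. The extra factor from `n + 1` absorbs
the initialization and the last, failing test. -/
lemma runs_forLoop {r b n K : ℕ} {c : Cmd} {s : Store} (I : ℕ → Store → Prop)
    (hI0 : I 0 (s.setNat r 0)) (hb : ∀ k s, I k s → s.nat r = k ∧ s.nat b = n)
    (hstep : ∀ k < n, ∀ s, I k s →
      ∃ s', Runs ω c s s' K ∧ s'.nat r = k ∧ I (k + 1) (s'.setNat r (k + 1))) :
    ∃ s', Runs ω (forLoop r b c) s s' ((K + 8) * (n + 1)) ∧ I n s' := by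
  have hloop : ∀ m k s, k + m = n → I k s → ∃ s', Runs ω
      (Cmd.loop (Test.natLT (NatExpr.var r) (NatExpr.var b))
        (Cmd.seq c (Cmd.setNat r (NatExpr.add (NatExpr.var r) (NatExpr.const 1)))))
      s s' ((K + 8) * m + 4) ∧ I n s' := by
    intro m
    induction m with
    | zero =>
      intro k s hk hI
      obtain rfl : k = n := by omega
      refine ⟨s, ⟨_, ?_, Exec.loopFalse ?_⟩, hI⟩
      · simp [Test.cost, NatExpr.cost]
      · simp [Test.holds, NatExpr.eval, (hb _ _ hI).1, (hb _ _ hI).2]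
    | succ m ih =>
      intro k s hk hI
      obtain ⟨s₁, ⟨t₁, ht₁, e₁⟩, hr, hI₁⟩ := hstep k (by omega) s hI
      obtain ⟨s₂, ⟨t₂, ht₂, e₂⟩, hI₂⟩ := ih (k + 1) _ (by omega) hI₁
      have e₃ := Exec.setNat (ω := ω) s₁ r (NatExpr.add (NatExpr.var r) (NatExpr.const 1))
      simp only [NatExpr.eval, hr] at e₃
      refine ⟨s₂, ⟨_, ?_, Exec.loopTrue ?_ (e₁.seq e₃) e₂⟩, hI₂⟩
      · simp only [Test.cost, NatExpr.cost]
        rw [mul_add]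
        omega
      · simp only [Test.holds, NatExpr.eval, (hb _ _ hI).1, (hb _ _ hI).2]
        omega
  obtain ⟨s', h, hI⟩ := hloop n 0 (s.setNat r 0) (by omega) hI0
  refine ⟨s', ((runs_setNat s r (NatExpr.const 0)).seq h).mono ?_, hI⟩
  simp only [NatExpr.cost]
  rw [mul_add]
  omega

/-- A loop over the coordinates, with index register `3`. -/
def forCoord (c : Cmd) : Cmd := forLoop 3 0 c

/-- The index of the current coordinate. -/
abbrev idx : NatExpr := NatExpr.var 3

/-- `s'` differs from `s` only in register `3` and in the array `a`. -/
structure AgreeOff (a : ℕ) (s s' : Store) : Prop where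
  nat : ∀ r ≠ 3, s'.nat r = s.nat r
  arr : ∀ a' ≠ a, ∀ i, s'.arr a' i = s.arr a' i
  drawn : s'.drawn = s.drawn

/-- In-place updates are allowed: when coordinate `k` is processed, its cell still holds the initial
value. -/
lemma runs_map {a n K : ℕ} {c : Cmd} {s : Store} (F : ℕ → ℝ) (hn : s.nat 0 = n)
    (hc : ∀ k < n, ∀ s', AgreeOff a s s' → s'.nat 3 = k → s'.arr a k = s.arr a k →
      Runs ω c s' (s'.setReal a k (F k)) K) :
    ∃ s', Runs ω (forCoord c) s s' ((K + 8) * (n + 1)) ∧ AgreeOff a s s' ∧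
      ∀ i, s'.arr a i = if i < n then F i else s.arr a i := by
  obtain ⟨s', h, h1, -, h2⟩ := runs_forLoop (ω := ω) (r := 3) (b := 0) (n := n) (K := K) (c := c)
    (s := s) (fun k s' => AgreeOff a s s' ∧ s'.nat 3 = k ∧
      ∀ i, s'.arr a i = if i < k then F i else s.arr a i)
    ⟨⟨fun r hr => by simp [hr], fun _ _ _ => rfl, rfl⟩, by simp, by simp⟩
    (fun k s' hI => ⟨hI.2.1, (hI.1.nat 0 (by norm_num)).trans hn⟩)
    (fun k hk s' hI => by
      refine ⟨_, hc k hk s' hI.1 hI.2.1 (by simp [hI.2.2]), hI.2.1,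
        ⟨fun r hr => by simp [hr, hI.1.nat r hr], fun a' ha' i => by simp [ha', hI.1.arr a' ha'],
          by simp [hI.1.drawn]⟩, by simp, fun i => ?_⟩
      simp only [setNat_arr, setReal_arr, true_and, hI.2.2]
      rcases lt_trichotomy i k with h | h | h
      · rw [if_neg (by omega), if_pos h, if_pos (by omega)]
      · rw [if_pos h, if_pos (by omega), h]
      · rw [if_neg (by omega), if_neg (by omega), if_neg (by omega)])
  exact ⟨s', h, h1, h2⟩

lemma runs_map_expr {a n : ℕ} {e : RealExpr} {s : Store} (F : ℕ → ℝ) (hn : s.nat 0 = n)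
    (he : ∀ k < n, ∀ s', AgreeOff a s s' → s'.nat 3 = k → s'.arr a k = s.arr a k →
      e.eval s' = F k) :
    ∃ s', Runs ω (forCoord (Cmd.setReal a idx e)) s s' ((e.cost + 10) * (n + 1)) ∧
      AgreeOff a s s' ∧ ∀ i, s'.arr a i = if i < n then F i else s.arr a i := by
  have := runs_map (ω := ω) (c := Cmd.setReal a idx e) (K := e.cost + 2) F hn
    (fun k hk s' h1 h2 h3 => by
      have := runs_setReal (ω := ω) s' a idx e
      rw [he k hk s' h1 h2 h3] at this
      simp only [idx, NatExpr.eval, h2, NatExpr.cost] at this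
      exact this.mono (by omega))
  simpa only [add_assoc] using this

/-- `arr a c := ∑ i, e i`. -/
def sumCoord (a c : ℕ) (e : RealExpr) : Cmd :=
  Cmd.seq (Cmd.setReal a (NatExpr.const c) (RealExpr.const 0))
    (forCoord (Cmd.setReal a (NatExpr.const c)
      (RealExpr.add (RealExpr.get a (NatExpr.const c)) e)))

/-- `s'` differs from `s` only in register `3` and in the cell `c` of the array `a`. -/
structure AgreeOffCell (a c : ℕ) (s s' : Store) : Prop where
  nat : ∀ r ≠ 3, s'.nat r = s.nat r
  arr : ∀ a' i, ¬ (a' = a ∧ i = c) → s'.arr a' i = s.arr a' i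
  drawn : s'.drawn = s.drawn

lemma runs_sumCoord {a c n : ℕ} {e : RealExpr} {s : Store} (F : ℕ → ℝ) (hn : s.nat 0 = n)
    (he : ∀ k < n, ∀ s', AgreeOffCell a c s s' → s'.nat 3 = k → e.eval s' = F k) :
    ∃ s', Runs ω (sumCoord a c e) s s' ((e.cost + 20) * (n + 1)) ∧ AgreeOffCell a c s s' ∧
      s'.arr a c = ∑ i ∈ Finset.range n, F i := by
  have h0 := runs_setReal (ω := ω) s a (NatExpr.const c) (RealExpr.const 0)
  simp only [NatExpr.eval, RealExpr.eval, NatExpr.cost, RealExpr.cost] at h0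
  obtain ⟨s', h, h1, -, h2⟩ := runs_forLoop (ω := ω) (r := 3) (b := 0) (n := n) (K := e.cost + 5)
    (c := Cmd.setReal a (NatExpr.const c) (RealExpr.add (RealExpr.get a (NatExpr.const c)) e))
    (s := s.setReal a c ((0 : ℤ) : ℝ))
    (fun k s' => AgreeOffCell a c s s' ∧ s'.nat 3 = k ∧ s'.arr a c = ∑ i ∈ Finset.range k, F i)
    ⟨⟨fun r hr => by simp [hr], fun a' i h => by simp [h], rfl⟩, by simp, by simp⟩
    (fun k s' hI => ⟨hI.2.1, (hI.1.nat 0 (by norm_num)).trans hn⟩)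
    (fun k hk s' hI => by
      have h1 := runs_setReal (ω := ω) s' a (NatExpr.const c)
        (RealExpr.add (RealExpr.get a (NatExpr.const c)) e)
      simp only [NatExpr.eval, RealExpr.eval, NatExpr.cost, RealExpr.cost,
        he k hk s' hI.1 hI.2.1, hI.2.2] at h1
      refine ⟨_, h1.mono (by omega), hI.2.1,
        ⟨fun r hr => by simp [hr, hI.1.nat r hr], fun a' i h => by simp [h, hI.1.arr a' i h],
          by simp [hI.1.drawn]⟩, by simp, ?_⟩
      simp [Finset.sum_range_succ])
  refine ⟨s', (h0.seq h).mono ?_, h1, h2⟩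
  have : (e.cost + 20) * (n + 1) = (e.cost + 5 + 8) * (n + 1) + 7 * n + 7 := by ring
  omega

/-- Iterated multiplication. -/
def RealExpr.pow (e : RealExpr) : ℕ → RealExpr
  | 0 => RealExpr.const 1
  | m + 1 => RealExpr.mul (e.pow m) e

lemma RealExpr.eval_pow (s : Store) (e : RealExpr) (m : ℕ) : (e.pow m).eval s = e.eval s ^ m := by
  induction m with
  | zero => simp [RealExpr.pow, RealExpr.eval]
  | succ m ih => rw [RealExpr.pow, RealExpr.eval, ih, pow_succ]

/-- `nat v := ⌈e⌉`, by counting. -/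
def natCeil (v : ℕ) (e : RealExpr) : Cmd :=
  Cmd.seq (Cmd.setNat v (NatExpr.const 0))
    (Cmd.loop (Test.realLT (RealExpr.cast (NatExpr.var v)) e)
      (Cmd.setNat v (NatExpr.add (NatExpr.var v) (NatExpr.const 1))))

/-- Counting takes time linear in the result, which is affordable because the result is the number
of rounds to be executed anyway. -/
lemma runs_natCeil {v : ℕ} {e : RealExpr} {s : Store} {x : ℝ}
    (he : ∀ n, e.eval (s.setNat v n) = x) :
    Runs ω (natCeil v e) s (s.setNat v ⌈x⌉₊) ((e.cost + 10) * (⌈x⌉₊ + 1)) := by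
  have hloop : ∀ m k, k + m = ⌈x⌉₊ → Runs ω
      (Cmd.loop (Test.realLT (RealExpr.cast (NatExpr.var v)) e)
        (Cmd.setNat v (NatExpr.add (NatExpr.var v) (NatExpr.const 1))))
      (s.setNat v k) (s.setNat v ⌈x⌉₊) ((e.cost + 8) * m + e.cost + 4) := by
    intro m
    induction m with
    | zero =>
      intro k hk
      obtain rfl : k = ⌈x⌉₊ := by omega
      refine ⟨_, ?_, Exec.loopFalse ?_⟩
      · simp only [Test.cost, RealExpr.cost, NatExpr.cost]; omega
      · simp only [Test.holds, RealExpr.eval, NatExpr.eval, he, setNat_nat, if_true, not_lt]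
        exact Nat.le_ceil x
    | succ m ih =>
      intro k hk
      obtain ⟨t, ht, ex⟩ := ih (k + 1) (by omega)
      have e₁ := Exec.setNat (ω := ω) (s.setNat v k) v
        (NatExpr.add (NatExpr.var v) (NatExpr.const 1))
      have hs : (s.setNat v k).setNat v (k + 1) = s.setNat v (k + 1) := by
        simp [Store.setNat]
      simp only [NatExpr.eval, setNat_nat, if_true, hs] at e₁
      refine ⟨_, ?_, Exec.loopTrue ?_ e₁ ex⟩
      · simp only [Test.cost, RealExpr.cost, NatExpr.cost]
        rw [mul_add]
        omega
      · simp only [Test.holds, RealExpr.eval, NatExpr.eval, he, setNat_nat, if_true]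
        exact Nat.lt_ceil.1 (by omega)
  refine ((runs_setNat s v (NatExpr.const 0)).seq (hloop _ 0 (zero_add _))).mono ?_
  simp only [NatExpr.cost]
  have : (e.cost + 10) * (⌈x⌉₊ + 1) = (e.cost + 8) * ⌈x⌉₊ + 2 * ⌈x⌉₊ + e.cost + 10 := by ring
  omega

end RealRAM

/-! ### Programs for the three projections and mirror maps -/

namespace RealRAM

variable {d : ℕ}

/-- `c` replaces the dual iterate `v` in array `2` by `proj v`, and writes `W v` into array `3`. -/
def ComputesScheme (q : ℝ≥0∞) (c : Cmd) (K : ℕ) (proj W : (Fin d → ℝ) → Fin d → ℝ) : Prop :=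
  ∀ (ω : ℕ → Example d) (s : Store) (v : Fin d → ℝ), s.nat 0 = d → s.arr 0 4 = q.toReal →
    (∀ i : Fin d, s.arr 2 i = v i) →
    ∃ s', Runs ω c s s' (K * (d + 1)) ∧ (∀ r ≠ 3, s'.nat r = s.nat r) ∧
      (∀ a, a ≠ 2 → a ≠ 3 → a ≠ 6 → ∀ i, s'.arr a i = s.arr a i) ∧ s'.drawn = s.drawn ∧
      (∀ i : Fin d, s'.arr 2 i = proj v i) ∧ ∀ i : Fin d, s'.arr 3 i = W v i

open RealExpr in
/-- Exponential weights. -/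
def expWeightsCmd : Cmd :=
  Cmd.seq (sumCoord 6 0 (add (exp (get 2 idx)) (exp (sub (const 0) (get 2 idx)))))
    (forCoord (Cmd.setReal 3 idx (div (sub (exp (get 2 idx)) (exp (sub (const 0) (get 2 idx))))
      (get 6 (NatExpr.const 0)))))

lemma computesScheme_expWeights :
    ∃ K, ∀ d, ComputesScheme (d := d) 1 expWeightsCmd K id expWeights := by
  -- The constant is left open; it is determined by adding up the costs of the pieces, none of which
  -- depends on `d`.
  apply Exists.intro
  · intro d ω s v hd hq hv
    obtain ⟨s₁, r₁, a₁, h₁⟩ := runs_sumCoord (ω := ω) (a := 6) (c := 0) (s := s)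
      (e := RealExpr.add (RealExpr.exp (RealExpr.get 2 idx))
        (RealExpr.exp (RealExpr.sub (RealExpr.const 0) (RealExpr.get 2 idx))))
      (fun i => Real.exp (s.arr 2 i) + Real.exp (-s.arr 2 i)) hd
      (fun k _ s' h hk => by simp [RealExpr.eval, NatExpr.eval, hk, h.arr])
    obtain ⟨s₂, r₂, a₂, h₂⟩ := runs_map_expr (ω := ω) (a := 3) (s := s₁)
      (e := RealExpr.div (RealExpr.sub (RealExpr.exp (RealExpr.get 2 idx))
        (RealExpr.exp (RealExpr.sub (RealExpr.const 0) (RealExpr.get 2 idx))))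
        (RealExpr.get 6 (NatExpr.const 0)))
      (fun i => (Real.exp (s₁.arr 2 i) - Real.exp (-s₁.arr 2 i)) / s₁.arr 6 0)
      ((a₁.nat 0 (by norm_num)).trans hd)
      (fun k _ s' h hk _ => by simp [RealExpr.eval, NatExpr.eval, hk, h.arr])
    refine ⟨s₂, r₁.seq_linear r₂,
      fun r hr => by rw [a₂.nat r hr, a₁.nat r hr],
      fun a h2 h3 h6 i => by rw [a₂.arr a h3, a₁.arr a i (by simp [h6])],
      by rw [a₂.drawn, a₁.drawn], fun i => ?_, fun i => ?_⟩
    · rw [a₂.arr 2 (by norm_num), a₁.arr 2 i (by norm_num), hv]; rfl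
    · rw [h₂, if_pos i.2, a₁.arr 2 i (by norm_num), h₁, hv, expWeights, partition,
        Finset.sum_range]
      simp only [hv]

open RealExpr in
/-- Projection to the cube. -/
def clipCmd : Cmd :=
  Cmd.seq (forCoord (Cmd.ite (Test.realLT (get 2 idx) (const (-1)))
      (Cmd.setReal 2 idx (const (-1)))
      (Cmd.ite (Test.realLT (const 1) (get 2 idx)) (Cmd.setReal 2 idx (const 1))
        (Cmd.setReal 2 idx (get 2 idx)))))
    (forCoord (Cmd.setReal 3 idx (get 2 idx)))

lemma computesScheme_clip : ∃ K, ∀ d, ComputesScheme (d := d) ∞ clipCmd K clip clip := by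
  apply Exists.intro
  · intro d ω s v hd hq hv
    obtain ⟨s₁, r₁, a₁, h₁⟩ := runs_map (ω := ω) (a := 2) (s := s) (K := 30)
      (c := Cmd.ite (Test.realLT (RealExpr.get 2 idx) (RealExpr.const (-1)))
        (Cmd.setReal 2 idx (RealExpr.const (-1)))
        (Cmd.ite (Test.realLT (RealExpr.const 1) (RealExpr.get 2 idx))
          (Cmd.setReal 2 idx (RealExpr.const 1)) (Cmd.setReal 2 idx (RealExpr.get 2 idx))))
      (fun i => max (-1) (min 1 (s.arr 2 i))) hd
      (fun k _ s' h hk hk' => by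
        have hset : ∀ e : RealExpr, e.eval s' = max (-1) (min 1 (s.arr 2 k)) →
            Runs ω (Cmd.setReal 2 idx e) s' (s'.setReal 2 k (max (-1) (min 1 (s.arr 2 k))))
              (e.cost + 2) := by
          intro e he
          have := runs_setReal (ω := ω) s' 2 idx e
          rw [he] at this
          simp only [idx, NatExpr.eval, hk, NatExpr.cost] at this
          exact this.mono (by omega)
        refine (runs_ite (fun hb => hset _ ?_) fun hb => runs_ite (fun hb' => hset _ ?_)
          fun hb' => hset _ ?_).mono (by simp [Test.cost, RealExpr.cost, NatExpr.cost])
        all_goals simp only [Test.holds, RealExpr.eval, NatExpr.eval, hk, hk', not_lt] at *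
        all_goals push_cast at *
        · rw [max_eq_left]
          exact (min_le_right _ _).trans hb.le
        · rw [min_eq_left hb'.le]; norm_num
        · rw [min_eq_right hb', max_eq_right hb])
    obtain ⟨s₂, r₂, a₂, h₂⟩ := runs_map_expr (ω := ω) (a := 3) (s := s₁)
      (e := RealExpr.get 2 idx) (fun i => s₁.arr 2 i) ((a₁.nat 0 (by norm_num)).trans hd)
      (fun k _ s' h hk _ => by simp [RealExpr.eval, NatExpr.eval, hk, h.arr])
    have key : ∀ i : Fin d, s₁.arr 2 i = clip v i := fun i => by
      rw [h₁, if_pos i.2, hv, clip]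
    refine ⟨s₂, r₁.seq_linear r₂,
      fun r hr => by rw [a₂.nat r hr, a₁.nat r hr],
      fun a h2 h3 h6 i => by rw [a₂.arr a h3, a₁.arr a h2],
      by rw [a₂.drawn, a₁.drawn], fun i => ?_, fun i => ?_⟩
    · rw [a₂.arr 2 (by norm_num), key]
    · rw [h₂, if_pos i.2, key]

/-- The expression `|x| ^ (p - 2)` for `x ≠ 0`. -/
def absPowExpr (x p : RealExpr) : RealExpr :=
  RealExpr.exp (RealExpr.div (RealExpr.mul (RealExpr.sub p (RealExpr.const 2))
    (RealExpr.log (RealExpr.mul x x))) (RealExpr.const 2))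

/-- The absolute value is obtained from `log (x * x) / 2`. At `x = 0` the power may evaluate
incorrectly, but the factor `x` hides this. -/
lemma eval_absPowExpr_mul (s : Store) (x p : RealExpr) :
    (absPowExpr x p).eval s * x.eval s = |x.eval s| ^ (p.eval s - 2) * x.eval s := by
  rcases eq_or_ne (x.eval s) 0 with h | h
  · rw [h]; simp
  · have : (absPowExpr x p).eval s = |x.eval s| ^ (p.eval s - 2) := by
      simp only [absPowExpr, RealExpr.eval]
      rw [Real.rpow_def_of_pos (abs_pos.2 h), Real.log_abs, Real.log_mul h h]
      push_cast
      congr 1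
      ring
    rw [this]

lemma RealExpr.eval_mul (s : Store) (e f : RealExpr) :
    (e.mul f).eval s = e.eval s * f.eval s := rfl

/-- The array cell with constant index. -/
abbrev cell (a i : ℕ) : RealExpr := RealExpr.get a (NatExpr.const i)

open RealExpr in
/-- Radial projection to the unit `ℓ_p` ball, followed by the duality map. -/
def ballCmd : Cmd :=
  Cmd.seq (Cmd.setReal 6 (NatExpr.const 1) (div (cell 0 4) (sub (cell 0 4) (const 1)))) <|
  Cmd.seq (sumCoord 6 0 (mul (mul (absPowExpr (get 2 idx) (cell 6 1)) (get 2 idx))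
    (get 2 idx))) <|
  Cmd.seq (Cmd.setReal 6 (NatExpr.const 2) (const 1)) <|
  Cmd.seq (Cmd.ite (Test.realLT (const 1) (cell 6 0))
    (Cmd.setReal 6 (NatExpr.const 2) (exp (div (log (cell 6 0)) (cell 6 1)))) Cmd.skip) <|
  Cmd.seq (Cmd.ite (Test.realLT (const 1) (cell 6 0))
    (Cmd.setReal 6 (NatExpr.const 0) (const 1)) Cmd.skip) <|
  Cmd.seq (forCoord (Cmd.setReal 2 idx (div (get 2 idx) (cell 6 2)))) <|
  Cmd.seq (Cmd.setReal 6 (NatExpr.const 2)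
    (exp (div (mul (sub (const 2) (cell 6 1)) (log (cell 6 0))) (cell 6 1)))) <|
  forCoord (Cmd.setReal 3 idx
    (mul (cell 6 2) (mul (absPowExpr (get 2 idx) (cell 6 1)) (get 2 idx))))

lemma setReal_self (s : Store) (a i : ℕ) : s.setReal a i (s.arr a i) = s := by
  simp [Store.setReal]

/-- A conditional assignment. -/
lemma runs_ite_setReal {b : Test} {s : Store} {a i : ℕ} {e : RealExpr} {x : ℝ}
    (h : b.holds s → e.eval s = x) (h' : ¬ b.holds s → s.arr a i = x) (ω : ℕ → Example d) :
    Runs ω (Cmd.ite b (Cmd.setReal a (NatExpr.const i) e) Cmd.skip) s (s.setReal a i x)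
      (b.cost + 1 + (e.cost + 2 + 1)) := by
  refine runs_ite (fun hb => ?_) (fun hb => ?_)
  · have := runs_setReal (ω := ω) s a (NatExpr.const i) e
    rw [h hb] at this
    exact this.mono (by simp only [NatExpr.cost]; omega)
  · rw [← h' hb, setReal_self]
    exact runs_skip s

lemma computesScheme_ball {p q : ℝ≥0∞} (h : p.toReal.HolderConjugate q.toReal) :
    ∃ K, ∀ d, ComputesScheme (d := d) q ballCmd K (ballProj p.toReal)
      (fun v => dualMap p.toReal (ballProj p.toReal v)) := by
  have hp1 := h.lt
  have hp0 := h.pos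
  -- The input contains only `q`; the program recovers `p` as `q / (q - 1)`.
  have hpq : q.toReal / (q.toReal - 1) = p.toReal := h.symm.conjugate_eq.symm
  apply Exists.intro
  · intro d ω s v hd hq hv
    set P := p.toReal
    have r₁ := runs_setReal (ω := ω) s 6 (NatExpr.const 1)
      (RealExpr.div (cell 0 4) (RealExpr.sub (cell 0 4) (RealExpr.const 1)))
    simp only [NatExpr.eval, RealExpr.eval, hq, Int.cast_one, hpq] at r₁
    set s₁ := s.setReal 6 1 P with hs₁
    have hv₁ : ∀ i : Fin d, s₁.arr 2 i = v i := fun i => by simp [hs₁, hv]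
    have hP₁ : s₁.arr 6 1 = P := by simp [hs₁]
    obtain ⟨s₂, r₂, a₂, h₂⟩ := runs_sumCoord (ω := ω) (a := 6) (c := 0) (s := s₁)
      (e := RealExpr.mul (RealExpr.mul (absPowExpr (RealExpr.get 2 idx) (cell 6 1))
        (RealExpr.get 2 idx)) (RealExpr.get 2 idx))
      (fun i => |s₁.arr 2 i| ^ P) hd
      (fun k _ s' h hk => by
        have hx : (RealExpr.get 2 idx).eval s' = s₁.arr 2 k := by
          simp [RealExpr.eval, NatExpr.eval, hk, h.arr]
        have hc : (cell 6 1).eval s' = P := by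
          simp [RealExpr.eval, NatExpr.eval, h.arr, hP₁]
        rw [RealExpr.eval_mul, RealExpr.eval_mul, eval_absPowExpr_mul, hx, hc,
          abs_rpow_mul_self_mul_self hp0])
    set S := ∑ i, |v i| ^ P with hS
    have hS₂ : s₂.arr 6 0 = S := by rw [h₂, Finset.sum_range]; simp only [hv₁, hS]
    have hSnn : 0 ≤ S := sum_abs_rpow_nonneg P v
    have hN : ellNorm P v = S ^ (1 / P) := rfl
    have r₃ := runs_setReal (ω := ω) s₂ 6 (NatExpr.const 2) (RealExpr.const 1)
    simp only [NatExpr.eval, RealExpr.eval, Int.cast_one] at r₃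
    set s₃ := s₂.setReal 6 2 1 with hs₃
    have hS₃ : s₃.arr 6 0 = S := by simp [hs₃, hS₂]
    have hP₃ : s₃.arr 6 1 = P := by simp [hs₃, a₂.arr, hP₁]
    have hmax : ∀ _ : 1 < S, Real.exp (Real.log S / P) = max 1 (ellNorm P v) := fun h1 => by
      rw [hN, Real.rpow_def_of_pos (by linarith), ← mul_div_assoc, mul_one, max_eq_right]
      exact Real.one_le_exp (div_nonneg (Real.log_nonneg h1.le) hp0.le)
    have hmax' : ∀ _ : ¬ 1 < S, 1 = max 1 (ellNorm P v) := fun h1 => by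
      rw [hN, max_eq_left]
      exact Real.rpow_le_one hSnn (not_lt.1 h1) (by positivity)
    have r₄ := runs_ite_setReal (b := Test.realLT (RealExpr.const 1) (cell 6 0)) (s := s₃) (a := 6)
      (i := 2) (e := RealExpr.exp (RealExpr.div (RealExpr.log (cell 6 0)) (cell 6 1)))
      (x := max 1 (ellNorm P v))
      (fun hb => by
        simp only [Test.holds, RealExpr.eval, NatExpr.eval, hS₃, hP₃, Int.cast_one] at hb ⊢
        exact hmax hb)
      (fun hb => by
        simp only [Test.holds, RealExpr.eval, NatExpr.eval, hS₃, Int.cast_one] at hb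
        rw [← hmax' hb]
        simp [hs₃]) ω
    set s₄ := s₃.setReal 6 2 (max 1 (ellNorm P v)) with hs₄
    have hS₄ : s₄.arr 6 0 = S := by simp [hs₄, hS₃]
    -- The cell that held `∑ |v i| ^ P` is overwritten by the same sum for the projected vector,
    -- which is `min 1 S`; no second summation is needed.
    have r₅ := runs_ite_setReal (b := Test.realLT (RealExpr.const 1) (cell 6 0)) (s := s₄) (a := 6)
      (i := 0) (e := RealExpr.const 1) (x := min 1 S)
      (fun hb => by
        simp only [Test.holds, RealExpr.eval, NatExpr.eval, hS₄, Int.cast_one] at hb ⊢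
        rw [min_eq_left hb.le])
      (fun hb => by
        simp only [Test.holds, RealExpr.eval, NatExpr.eval, hS₄, Int.cast_one, not_lt] at hb
        rw [min_eq_right hb, hS₄]) ω
    set s₅ := s₄.setReal 6 0 (min 1 S) with hs₅
    have hv₅ : ∀ i : Fin d, s₅.arr 2 i = v i := fun i => by
      simp [hs₅, hs₄, hs₃, a₂.arr, hv₁]
    have hd₅ : s₅.nat 0 = d := by simp [hs₅, hs₄, hs₃, a₂.nat, hs₁, hd]
    have hP₅ : s₅.arr 6 1 = P := by simp [hs₅, hs₄, hP₃]
    have hM₅ : s₅.arr 6 2 = max 1 (ellNorm P v) := by simp [hs₅, hs₄]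
    obtain ⟨s₆, r₆, a₆, h₆⟩ := runs_map_expr (ω := ω) (a := 2) (s := s₅)
      (e := RealExpr.div (RealExpr.get 2 idx) (cell 6 2))
      (fun i => s₅.arr 2 i / max 1 (ellNorm P v)) hd₅
      (fun k _ s' h hk hk' => by simp [RealExpr.eval, NatExpr.eval, hk, hk', h.arr, hM₅])
    set θ := ballProj P v with hθ
    have hv₆ : ∀ i : Fin d, s₆.arr 2 i = θ i := fun i => by
      rw [h₆, if_pos i.2, hv₅, hθ, ballProj, Pi.smul_apply, smul_eq_mul, div_eq_inv_mul]
    have r₇ := runs_setReal (ω := ω) s₆ 6 (NatExpr.const 2) (RealExpr.exp (RealExpr.div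
      (RealExpr.mul (RealExpr.sub (RealExpr.const 2) (cell 6 1)) (RealExpr.log (cell 6 0)))
      (cell 6 1)))
    have hS₆ : s₆.arr 6 0 = min 1 S := by rw [a₆.arr 6 (by norm_num)]; simp [hs₅]
    have hP₆ : s₆.arr 6 1 = P := by rw [a₆.arr 6 (by norm_num), hP₅]
    simp only [NatExpr.eval, RealExpr.eval, hS₆, hP₆, Int.cast_ofNat] at r₇
    set y := Real.exp ((2 - P) * Real.log (min 1 S) / P) with hy
    set s₇ := s₆.setReal 6 2 y with hs₇
    have hv₇ : ∀ i, s₇.arr 2 i = s₆.arr 2 i := fun i => by simp [hs₇]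
    have hP₇ : s₇.arr 6 1 = P := by simp [hs₇, hP₆]
    have hy₇ : s₇.arr 6 2 = y := by simp [hs₇]
    obtain ⟨s₈, r₈, a₈, h₈⟩ := runs_map_expr (ω := ω) (a := 3) (s := s₇)
      (e := RealExpr.mul (cell 6 2) (RealExpr.mul (absPowExpr (RealExpr.get 2 idx) (cell 6 1))
        (RealExpr.get 2 idx)))
      (fun i => y * (|s₆.arr 2 i| ^ (P - 2) * s₆.arr 2 i)) ((a₆.nat 0 (by norm_num)).trans hd₅)
      (fun k _ s' h hk hk' => by
        have hx : (RealExpr.get 2 idx).eval s' = s₆.arr 2 k := by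
          simp [RealExpr.eval, NatExpr.eval, hk, h.arr, hv₇]
        have hc : (cell 6 1).eval s' = P := by
          simp [RealExpr.eval, NatExpr.eval, h.arr, hP₇]
        have hc' : (cell 6 2).eval s' = y := by
          simp [RealExpr.eval, NatExpr.eval, h.arr, hy₇]
        rw [RealExpr.eval_mul, RealExpr.eval_mul, eval_absPowExpr_mul, hx, hc, hc'])
    have hval : ∀ i, y * (|θ i| ^ (P - 2) * θ i) = dualMap P θ i := by
      intro i
      -- For `v = 0` the convention `log 0 = 0` makes the computed factor `1`, which is harmless
      -- because all coordinates vanish.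
      rcases eq_or_ne v 0 with rfl | hv0
      · simp [hθ, ballProj, dualMap]
      have hSpos : 0 < S := by
        rw [hS, ← ellNorm_rpow hp0.ne']
        exact Real.rpow_pos_of_pos (ellNorm_pos hp1.le hv0) _
      have hmin : 0 < min 1 S := lt_min one_pos hSpos
      have hnorm : ellNorm P θ = min 1 S ^ (1 / P) := by
        rw [hθ, ellNorm_ballProj hp1.le, hN]
        rcases le_total 1 S with h1 | h1
        · rw [min_eq_left h1, Real.one_rpow, min_eq_left]
          exact Real.one_le_rpow h1 (by positivity)
        · rw [min_eq_right h1, min_eq_right]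
          exact Real.rpow_le_one hSnn h1 (by positivity)
      rw [dualMap, hnorm, ← Real.rpow_mul hmin.le, Real.rpow_def_of_pos hmin, hy]
      congr 2
      ring
    refine ⟨s₈, r₁.linear.seq_linear (r₂.seq_linear (r₃.linear.seq_linear (r₄.linear.seq_linear
      (r₅.linear.seq_linear (r₆.seq_linear (r₇.linear.seq_linear r₈)))))),
      fun r hr => ?_, fun a h2 h3 h6 i => ?_, ?_, fun i => ?_, fun i => ?_⟩
    · rw [a₈.nat r hr, hs₇, setReal_nat, a₆.nat r hr, hs₅, setReal_nat, hs₄, setReal_nat, hs₃,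
        setReal_nat, a₂.nat r hr, hs₁, setReal_nat]
    · rw [a₈.arr a h3, hs₇, setReal_arr, if_neg (by simp [h6]), a₆.arr a h2, hs₅, setReal_arr,
        if_neg (by simp [h6]), hs₄, setReal_arr, if_neg (by simp [h6]), hs₃, setReal_arr,
        if_neg (by simp [h6]), a₂.arr a i (by simp [h6]), hs₁, setReal_arr, if_neg (by simp [h6])]
    · rw [a₈.drawn, hs₇, setReal_drawn, a₆.drawn, hs₅, setReal_drawn, hs₄, setReal_drawn, hs₃,
        setReal_drawn, a₂.drawn, hs₁, setReal_drawn]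
    · rw [a₈.arr 2 (by norm_num), hv₇, hv₆]
    · rw [h₈, if_pos i.2, hv₆, hval]

end RealRAM

/-! ### The complete mirror descent program and its running time -/

namespace RealRAM

variable {d : ℕ}

@[simp] lemma draw_nat (ω : ℕ → Example d) (s : Store) (a : ℕ) : (s.draw ω a).nat = s.nat := rfl

@[simp] lemma draw_drawn (ω : ℕ → Example d) (s : Store) (a : ℕ) :
    (s.draw ω a).drawn = s.drawn + 1 := rfl

lemma draw_arr_of_ne (ω : ℕ → Example d) (s : Store) {a a' : ℕ} (h : a' ≠ a) :
    (s.draw ω a).arr a' = s.arr a' := by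
  simp [Store.draw, h]

lemma draw_arr_point (ω : ℕ → Example d) (s : Store) (a : ℕ) (i : Fin d) :
    (s.draw ω a).arr a i = (ω s.drawn).1 i := by
  simp [Store.draw]

lemma draw_arr_label (ω : ℕ → Example d) (s : Store) (a : ℕ) :
    (s.draw ω a).arr a d = (ω s.drawn).2 := by
  simp [Store.draw]

open RealExpr in
/-- One round of mirror descent: read an example, project, accumulate the primal point and take
a gradient step. -/
def roundCmd (prep : Cmd) : Cmd :=
  Cmd.seq (Cmd.draw 4) <| Cmd.seq prep <|
  Cmd.seq (forCoord (Cmd.setReal 1 idx (add (get 1 idx) (get 3 idx)))) <|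
  Cmd.seq (sumCoord 5 5 (mul (get 3 idx) (get 4 idx))) <|
  Cmd.seq (Cmd.setReal 5 (NatExpr.const 5) (mul (get 4 (NatExpr.var 0)) (cell 5 5))) <|
  Cmd.seq (Cmd.setReal 5 (NatExpr.const 6)
    (sub (const 0) (div (sub (const 1) (cell 5 0)) (cell 0 1)))) <|
  Cmd.seq (Cmd.ite (Test.realLT (cell 0 1) (cell 5 5))
    (Cmd.setReal 5 (NatExpr.const 6) (sub (const 0) (div (cell 5 0) (cell 0 1)))) Cmd.skip) <|
  Cmd.seq (Cmd.setReal 5 (NatExpr.const 6)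
    (mul (cell 5 3) (mul (cell 5 6) (get 4 (NatExpr.var 0))))) <|
  forCoord (Cmd.setReal 2 idx (sub (get 2 idx) (mul (cell 5 6) (get 4 idx))))

/-- The memory contents at the start of round `k`. -/
structure RoundInv (q : ℝ≥0∞) (proj W : (Fin d → ℝ) → Fin d → ℝ) (lam γ α : ℝ) (T : ℕ)
    (ω : ℕ → Example d) (k : ℕ) (s : Store) : Prop where
  dim : s.nat 0 = d
  rounds : s.nat 1 = T
  counter : s.nat 2 = k
  margin : s.arr 0 1 = γ
  exponent : s.arr 0 4 = q.toReal
  weight : s.arr 5 0 = lam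
  step : s.arr 5 3 = α
  drawn : s.drawn = k
  dual : ∀ i : Fin d, s.arr 2 i = dualIter proj W lam γ α ω k i
  sum : ∀ i : Fin d, s.arr 1 i = ∑ j ∈ Finset.range k, W (dualIter proj W lam γ α ω j) i

/-- A round starts with the unprojected dual iterate in array `2`. After `prep` this array holds its
projection and array `3` the primal point, so subtracting the scaled gradient produces the next
unprojected iterate. -/
lemma runs_roundCmd {q : ℝ≥0∞} {prep : Cmd} {K : ℕ}
    {proj W : (d : ℕ) → (Fin d → ℝ) → Fin d → ℝ}
    (hprep : ∀ d, ComputesScheme q prep K (proj d) (W d)) :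
    ∃ K', ∀ (d : ℕ) (lam γ α : ℝ) (T : ℕ) (ω : ℕ → Example d) (k : ℕ) (s : Store),
      RoundInv q (proj d) (W d) lam γ α T ω k s →
      ∃ s', Runs ω (roundCmd prep) s s' (K' * (d + 1)) ∧ s'.nat 2 = k ∧
        RoundInv q (proj d) (W d) lam γ α T ω (k + 1) (s'.setNat 2 (k + 1)) := by
  apply Exists.intro
  · intro d lam γ α T ω k s hI
    set v := dualIter (proj d) (W d) lam γ α ω k with hv
    have r₁ : Runs ω (Cmd.draw 4) s (s.draw ω 4) (1 * (d + 1)) := by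
      rw [one_mul]; exact runs_draw s 4
    set s₁ := s.draw ω 4 with hs₁
    have x₁ : ∀ i : Fin d, s₁.arr 4 i = (ω k).1 i := fun i => by
      rw [hs₁, draw_arr_point, hI.drawn]
    have y₁ : s₁.arr 4 d = (ω k).2 := by rw [hs₁, draw_arr_label, hI.drawn]
    have e₁ : ∀ a ≠ 4, s₁.arr a = s.arr a := fun a ha => draw_arr_of_ne ω s ha
    obtain ⟨s₂, r₂, n₂, a₂, d₂, θ₂, w₂⟩ := hprep d ω s₁ v hI.dim
      (by rw [e₁ 0 (by norm_num), hI.exponent])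
      (fun i => by rw [e₁ 2 (by norm_num), hI.dual])
    have dim₂ : s₂.nat 0 = d := (n₂ 0 (by norm_num)).trans hI.dim
    obtain ⟨s₃, r₃, a₃, h₃⟩ := runs_map_expr (ω := ω) (a := 1) (s := s₂)
      (e := RealExpr.add (RealExpr.get 1 idx) (RealExpr.get 3 idx))
      (fun i => s₂.arr 1 i + s₂.arr 3 i) dim₂
      (fun k _ s' h hk hk' => by simp [RealExpr.eval, NatExpr.eval, hk, hk', h.arr])
    have dim₃ : s₃.nat 0 = d := (a₃.nat 0 (by norm_num)).trans dim₂
    obtain ⟨s₄, r₄, a₄, h₄⟩ := runs_sumCoord (ω := ω) (a := 5) (c := 5) (s := s₃)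
      (e := RealExpr.mul (RealExpr.get 3 idx) (RealExpr.get 4 idx))
      (fun i => s₃.arr 3 i * s₃.arr 4 i) dim₃
      (fun k _ s' h hk => by simp [RealExpr.eval, NatExpr.eval, hk, h.arr])
    have dim₄ : s₄.nat 0 = d := (a₄.nat 0 (by norm_num)).trans dim₃
    have keep : ∀ a i, a ≠ 1 → a ≠ 2 → a ≠ 3 → a ≠ 4 → a ≠ 6 → ¬ (a = 5 ∧ i = 5) →
        s₄.arr a i = s.arr a i := fun a i h1 h2 h3 h4 h6 h5 => by
      rw [a₄.arr a i h5, a₃.arr a h1, a₂ a h2 h3 h6, e₁ a h4]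
    have x₄ : ∀ i, s₄.arr 4 i = s₁.arr 4 i := fun i => by
      rw [a₄.arr 4 i (by norm_num), a₃.arr 4 (by norm_num), a₂ 4 (by norm_num) (by norm_num)
        (by norm_num)]
    have γ₄ : s₄.arr 0 1 = γ := by
      rw [keep 0 1 (by norm_num) (by norm_num) (by norm_num) (by norm_num) (by norm_num)
        (by norm_num), hI.margin]
    have lam₄ : s₄.arr 5 0 = lam := by
      rw [keep 5 0 (by norm_num) (by norm_num) (by norm_num) (by norm_num) (by norm_num)
        (by norm_num), hI.weight]
    have α₄ : s₄.arr 5 3 = α := by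
      rw [keep 5 3 (by norm_num) (by norm_num) (by norm_num) (by norm_num) (by norm_num)
        (by norm_num), hI.step]
    have dot₄ : s₄.arr 5 5 = W d v ⬝ᵥ (ω k).1 := by
      rw [h₄, Finset.sum_range, dotProduct]
      refine Finset.sum_congr rfl fun i _ => ?_
      rw [a₃.arr 3 (by norm_num), w₂, a₃.arr 4 (by norm_num), a₂ 4 (by norm_num) (by norm_num)
        (by norm_num), x₁]
    have y₄ : s₄.arr 4 d = (ω k).2 := by rw [x₄, y₁]
    have r₅ := runs_setReal (ω := ω) s₄ 5 (NatExpr.const 5)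
      (RealExpr.mul (RealExpr.get 4 (NatExpr.var 0)) (cell 5 5))
    simp only [NatExpr.eval, RealExpr.eval, dim₄, y₄, dot₄] at r₅
    set margin := (ω k).2 * (W d v ⬝ᵥ (ω k).1) with hmargin
    set s₅ := s₄.setReal 5 5 margin with hs₅
    -- The steep slope is stored by default and overwritten only when the margin exceeds `γ`.
    have r₆ := runs_setReal (ω := ω) s₅ 5 (NatExpr.const 6) (RealExpr.sub (RealExpr.const 0)
      (RealExpr.div (RealExpr.sub (RealExpr.const 1) (cell 5 0)) (cell 0 1)))
    have lam₅ : s₅.arr 5 0 = lam := by simp [hs₅, lam₄]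
    have γ₅ : s₅.arr 0 1 = γ := by simp [hs₅, γ₄]
    simp only [NatExpr.eval, RealExpr.eval, lam₅, γ₅, Int.cast_zero, Int.cast_one, zero_sub] at r₆
    set s₆ := s₅.setReal 5 6 (-((1 - lam) / γ)) with hs₆
    have lam₆ : s₆.arr 5 0 = lam := by simp [hs₆, lam₅]
    have γ₆ : s₆.arr 0 1 = γ := by simp [hs₆, γ₅]
    have m₆ : s₆.arr 5 5 = margin := by simp [hs₆, hs₅]
    have r₇ := runs_ite_setReal (b := Test.realLT (cell 0 1) (cell 5 5)) (s := s₆) (a := 5) (i := 6)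
      (e := RealExpr.sub (RealExpr.const 0) (RealExpr.div (cell 5 0) (cell 0 1)))
      (x := leakySlope lam γ margin)
      (fun hb => by
        simp only [Test.holds, RealExpr.eval, NatExpr.eval, lam₆, γ₆, m₆, Int.cast_zero,
          zero_sub] at hb ⊢
        rw [leakySlope, if_pos hb])
      (fun hb => by
        simp only [Test.holds, RealExpr.eval, NatExpr.eval, γ₆, m₆] at hb
        rw [leakySlope, if_neg hb]
        simp [hs₆]) ω
    set s₇ := s₆.setReal 5 6 (leakySlope lam γ margin) with hs₇
    have r₈ := runs_setReal (ω := ω) s₇ 5 (NatExpr.const 6)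
      (RealExpr.mul (cell 5 3) (RealExpr.mul (cell 5 6) (RealExpr.get 4 (NatExpr.var 0))))
    have α₇ : s₇.arr 5 3 = α := by simp [hs₇, hs₆, hs₅, α₄]
    have c₇ : s₇.arr 5 6 = leakySlope lam γ margin := by simp [hs₇]
    have y₇ : s₇.arr 4 d = (ω k).2 := by simp [hs₇, hs₆, hs₅, y₄]
    have dim₇ : s₇.nat 0 = d := by simp [hs₇, hs₆, hs₅, dim₄]
    simp only [NatExpr.eval, RealExpr.eval, α₇, c₇, y₇, dim₇] at r₈
    set coef := α * (leakySlope lam γ margin * (ω k).2) with hcoef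
    set s₈ := s₇.setReal 5 6 coef with hs₈
    have keep₈ : ∀ a, a ≠ 5 → ∀ i, s₈.arr a i = s₄.arr a i := fun a h i => by
      simp [hs₈, hs₇, hs₆, hs₅, h]
    have nat₈ : s₈.nat = s₄.nat := by simp [hs₈, hs₇, hs₆, hs₅]
    have c₈ : s₈.arr 5 6 = coef := by simp [hs₈]
    obtain ⟨s₉, r₉, a₉, h₉⟩ := runs_map_expr (ω := ω) (a := 2) (s := s₈)
      (e := RealExpr.sub (RealExpr.get 2 idx) (RealExpr.mul (cell 5 6) (RealExpr.get 4 idx)))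
      (fun i => s₈.arr 2 i - coef * s₈.arr 4 i) (by rw [nat₈, dim₄])
      (fun k _ s' h hk hk' => by simp [RealExpr.eval, NatExpr.eval, hk, hk', h.arr, c₈])
    have nat₉ : ∀ r ≠ 3, s₉.nat r = s.nat r := fun r hr => by
      rw [a₉.nat r hr, nat₈, a₄.nat r hr, a₃.nat r hr, n₂ r hr, hs₁, draw_nat]
    have keep₉ : ∀ a i, a ≠ 1 → a ≠ 2 → a ≠ 3 → a ≠ 4 → a ≠ 5 → a ≠ 6 →
        s₉.arr a i = s.arr a i := fun a i h1 h2 h3 h4 h5 h6 => by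
      rw [a₉.arr a h2, keep₈ a h5, keep a i h1 h2 h3 h4 h6 (by simp [h5])]
    refine ⟨s₉, r₁.seq_linear (r₂.seq_linear (r₃.seq_linear (r₄.seq_linear
      (r₅.linear.seq_linear (r₆.linear.seq_linear (r₇.linear.seq_linear
      (r₈.linear.seq_linear r₉))))))), ?_, ?_⟩
    · rw [nat₉ 2 (by norm_num), hI.counter]
    constructor
    · rw [setNat_nat, if_neg (by norm_num), nat₉ 0 (by norm_num), hI.dim]
    · rw [setNat_nat, if_neg (by norm_num), nat₉ 1 (by norm_num), hI.rounds]
    · rw [setNat_nat, if_pos rfl]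
    · rw [setNat_arr, keep₉ 0 1 (by norm_num) (by norm_num) (by norm_num) (by norm_num)
        (by norm_num) (by norm_num), hI.margin]
    · rw [setNat_arr, keep₉ 0 4 (by norm_num) (by norm_num) (by norm_num) (by norm_num)
        (by norm_num) (by norm_num), hI.exponent]
    · rw [setNat_arr, a₉.arr 5 (by norm_num)]
      simp [hs₈, hs₇, lam₆]
    · rw [setNat_arr, a₉.arr 5 (by norm_num)]
      simp [hs₈, α₇]
    · rw [setNat_drawn, a₉.drawn]
      simp only [hs₈, hs₇, hs₆, hs₅, setReal_drawn]
      rw [a₄.drawn, a₃.drawn, d₂, hs₁, draw_drawn, hI.drawn]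
    · intro i
      rw [setNat_arr, h₉, if_pos i.2, keep₈ 2 (by norm_num), keep₈ 4 (by norm_num), x₄, x₁,
        a₄.arr 2 i (by norm_num), a₃.arr 2 (by norm_num), θ₂, dualIter, ← hv, Pi.sub_apply,
        Pi.smul_apply, lossGrad, Pi.smul_apply, smul_eq_mul, smul_eq_mul, hcoef]
      ring
    · intro i
      rw [setNat_arr, a₉.arr 1 (by norm_num), keep₈ 1 (by norm_num), a₄.arr 1 i (by norm_num), h₃,
        if_pos i.2, w₂, a₂ 1 (by norm_num) (by norm_num) (by norm_num), e₁ 1 (by norm_num), hI.sum,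
        Finset.sum_range_succ]

open RealExpr in
/-- The parameters of mirror descent. -/
def setupCmd (C m : ℕ) : Cmd :=
  Cmd.seq (Cmd.setReal 5 (NatExpr.const 0)
    (div (add (div (mul (cell 0 0) (cell 0 1)) (const 2)) (cell 0 2))
      (add (const 1) (mul (cell 0 0) (cell 0 1))))) <|
  Cmd.seq (Cmd.setReal 5 (NatExpr.const 1)
    (mul (mul (mul (const 2) (div (const 1) (sub (const 1) (mul (const 2) (cell 0 2)))))
      (div (const 1) (cell 0 1)))
      (add (mul (div (const 1) (cell 0 0)) (div (const 1) (cell 0 1))) (const 1)))) <|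
  Cmd.seq (Cmd.setReal 5 (NatExpr.const 2)
    (RealExpr.pow (mul (mul (mul (const 4) (const C)) (cast (NatExpr.var 0))) (cell 5 1)) m)) <|
  Cmd.seq (Cmd.setReal 5 (NatExpr.const 3) (div (cell 0 1) (cell 5 2))) <|
  Cmd.setReal 5 (NatExpr.const 4)
    (add (mul (mul (mul (const 8) (cast (NatExpr.var 0))) (cell 5 1)) (cell 5 2))
      (mul (mul (const 128) (log (div (const 1) (cell 0 3)))) (RealExpr.pow (cell 5 1) 2)))

/-- The exponent `m` belongs to the program and not to its input, so the power is an unrolled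
product and the cost is constant. -/
lemma runs_setupCmd (C m : ℕ) : ∃ K, ∀ (d : ℕ) (ω : ℕ → Example d) (ε γ η δ x : ℝ),
    ∃ s', Runs ω (setupCmd C m) (Store.init d [ε, γ, η, δ, x]) s' K ∧
      s'.nat = (Store.init d [ε, γ, η, δ, x]).nat ∧ s'.drawn = 0 ∧
      (∀ a ≠ 5, ∀ i, s'.arr a i = (Store.init d [ε, γ, η, δ, x]).arr a i) ∧
      s'.arr 5 0 = lossWeight ε γ η ∧ s'.arr 5 3 = stepSize C m d ε γ η ∧
      s'.arr 5 4 = roundBound C m d ε γ η δ := by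
  apply Exists.intro
  · intro d ω ε γ η δ x
    set s := Store.init d [ε, γ, η, δ, x] with hs
    have hd : s.nat 0 = d := by simp [hs, Store.init]
    have hε : s.arr 0 0 = ε := by simp [hs, Store.init]
    have hγ : s.arr 0 1 = γ := by simp [hs, Store.init]
    have hη : s.arr 0 2 = η := by simp [hs, Store.init]
    have hδ : s.arr 0 3 = δ := by simp [hs, Store.init]
    refine ⟨_, (runs_setReal _ _ _ _).seq ((runs_setReal _ _ _ _).seq ((runs_setReal _ _ _ _).seq
      ((runs_setReal _ _ _ _).seq (runs_setReal _ _ _ _)))), rfl, rfl, fun a ha i => ?_, ?_, ?_, ?_⟩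
    · simp [ha]
    · simp [NatExpr.eval, RealExpr.eval, hε, hγ, hη, lossWeight]
    · simp [NatExpr.eval, RealExpr.eval, RealExpr.eval_pow, hε, hγ, hη, hd, stepSize, invAccuracy]
    · simp [NatExpr.eval, RealExpr.eval, RealExpr.eval_pow, hε, hγ, hη, hδ, hd, roundBound,
        invAccuracy]

/-- Stochastic mirror descent. -/
def smdCmd (prep : Cmd) (C m : ℕ) : Cmd :=
  Cmd.seq (setupCmd C m) <| Cmd.seq (natCeil 1 (cell 5 4)) <|
  Cmd.seq (forLoop 2 1 (roundCmd prep)) <|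
  forCoord (Cmd.setReal 1 idx (RealExpr.div (RealExpr.get 1 idx) (RealExpr.cast (NatExpr.var 1))))

/-- Set-up is `O(1)`, rounding `O(T + 1)`, the rounds `O((d + 1) (T + 1))` and the final division
`O(d + 1)`; each is within the common bound. -/
theorem outputs_smdCmd {q : ℝ≥0∞} {prep : Cmd} {K : ℕ}
    {proj W : (d : ℕ) → (Fin d → ℝ) → Fin d → ℝ}
    (hprep : ∀ d, ComputesScheme q prep K (proj d) (W d)) (C m : ℕ) :
    ∃ K', ∀ (d : ℕ) (ε γ η δ : ℝ) (ω : ℕ → Example d),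
      ∃ t ≤ K' * ((d + 1) * (⌈roundBound C m d ε γ η δ⌉₊ + 1)),
        Outputs (smdCmd prep C m) [ε, γ, η, δ, q.toReal] ω t ⌈roundBound C m d ε γ η δ⌉₊
          (smdOutput (proj d) (W d) C m ε γ η δ ω) := by
  obtain ⟨K₁, h₁⟩ := runs_setupCmd C m
  obtain ⟨K₂, h₂⟩ := runs_roundCmd hprep
  apply Exists.intro
  · intro d ε γ η δ ω
    obtain ⟨s₁, r₁, n₁, d₁, a₁, lam₁, α₁, R₁⟩ := h₁ d ω ε γ η δ q.toReal
    set T := ⌈roundBound C m d ε γ η δ⌉₊ with hT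
    have r₂ := runs_natCeil (ω := ω) (v := 1) (e := cell 5 4) (s := s₁)
      (x := roundBound C m d ε γ η δ)
      (fun n => by simp [RealExpr.eval, NatExpr.eval, R₁])
    rw [← hT] at r₂
    set s₂ := s₁.setNat 1 T with hs₂
    obtain ⟨s₃, r₃, I₃⟩ := runs_forLoop (ω := ω) (r := 2) (b := 1) (n := T) (s := s₂)
      (c := roundCmd prep) (K := K₂ * (d + 1))
      (fun k s => RoundInv q (proj d) (W d) (lossWeight ε γ η) γ (stepSize C m d ε γ η) T ω k s)
      ⟨by simp [hs₂, n₁, Store.init], by simp [hs₂], by simp [hs₂],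
        by simp [hs₂, a₁, Store.init], by simp [hs₂, a₁, Store.init], by simp [hs₂, lam₁],
        by simp [hs₂, α₁], by simp [hs₂, d₁], by simp [hs₂, a₁, Store.init, dualIter],
        by simp [hs₂, a₁, Store.init]⟩
      (fun k s h => ⟨h.counter, h.rounds⟩) (fun k _ s h => h₂ d _ _ _ _ ω k s h)
    obtain ⟨s₄, r₄, a₄, h₄⟩ := runs_map_expr (ω := ω) (a := 1) (s := s₃)
      (e := RealExpr.div (RealExpr.get 1 idx) (RealExpr.cast (NatExpr.var 1)))
      (fun i => s₃.arr 1 i / T) I₃.dim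
      (fun k _ s' h hk hk' => by
        simp [RealExpr.eval, NatExpr.eval, hk, hk', h.nat, I₃.rounds])
    have hd1 : 1 ≤ d + 1 := Nat.succ_pos d
    have hT1 : 1 ≤ T + 1 := Nat.succ_pos T
    have b₁ := r₁.mono (Nat.le_mul_of_pos_right K₁ (Nat.mul_pos hd1 hT1))
    have b₂ := r₂.mono (Nat.mul_le_mul_left _ (Nat.le_mul_of_pos_left (T + 1) hd1))
    have b₃ := r₃.mono (B' := (K₂ + 8) * ((d + 1) * (T + 1))) (by
      rw [← mul_assoc]
      refine Nat.mul_le_mul_right _ ?_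
      rw [add_mul]
      omega)
    have b₄ := r₄.mono (Nat.mul_le_mul_left _ (Nat.le_mul_of_pos_right (d + 1) hT1))
    obtain ⟨t, ht, ex⟩ := b₁.seq_linear (b₂.seq_linear (b₃.seq_linear b₄))
    refine ⟨t, ht, s₄, ex, ?_, fun j => ?_⟩
    · rw [a₄.drawn, I₃.drawn]
    · rw [h₄, if_pos j.2, I₃.sum, smdOutput, average_eq, Pi.smul_apply, Finset.sum_apply,
        smul_eq_mul, div_eq_inv_mul]

end RealRAM

/-! ### The polynomial bound -/

open MvPolynomial in
/-- `invAccuracy` as a polynomial in `1/ε, 1/γ, 1/(1 - 2η)`. -/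
def invAccuracyPoly : MvPolynomial (Fin 5) ℕ := 2 * X 3 * X 2 * (X 1 * X 2 + 1)

open MvPolynomial in
/-- A bound for the running time. -/
def timePoly (K C m : ℕ) : MvPolynomial (Fin 5) ℕ :=
  (K : MvPolynomial (Fin 5) ℕ) * ((X 0 + 1) * (8 * X 0 * invAccuracyPoly *
    (4 * (C : MvPolynomial (Fin 5) ℕ) * X 0 * invAccuracyPoly) ^ m +
    128 * X 4 * invAccuracyPoly ^ 2 + 2))

/-- The added `2` accounts for rounding the number of rounds up and for the `+ 1` in the cost bound.
-/
lemma polyBound_timePoly (K C m d : ℕ) (ε γ η δ : ℝ) :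
    polyBound (timePoly K C m) d ε γ η δ = K * ((d + 1) * (roundBound C m d ε γ η δ + 2)) := by
  simp [polyBound, timePoly, invAccuracyPoly, roundBound, invAccuracy]

/-- At the endpoints the regret error is quadratic and `m = 1` suffices. Otherwise `m = ⌈1 / (p -
1)⌉` is what the Hölder exponent of the duality map demands. Both `C` and `m` depend on `p` only,
not on the dimension. -/
lemma exists_mirrorScheme {p q : ℝ≥0∞} (hpq : p.HolderConjugate q) :
    ∃ (C m K : ℕ) (prep : RealRAM.Cmd) (proj W : (d : ℕ) → (Fin d → ℝ) → Fin d → ℝ), 0 < C ∧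
      (∀ d, 0 < d → IsMirrorScheme p q C m (proj d) (W d)) ∧
      ∀ d, RealRAM.ComputesScheme q prep K (proj d) (W d) := by
  rcases ENNReal.HolderConjugate.cases hpq with ⟨rfl, rfl⟩ | ⟨rfl, rfl⟩ | ⟨hp, hq, hq1, h⟩
  · obtain ⟨K, hK⟩ := RealRAM.computesScheme_expWeights
    exact ⟨1, 1, K, _, _, _, one_pos, fun d hd => isMirrorScheme_crossPolytope hd, hK⟩
  · obtain ⟨K, hK⟩ := RealRAM.computesScheme_clip
    exact ⟨1, 1, K, _, _, _, one_pos, fun d hd => isMirrorScheme_cube hd, hK⟩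
  · obtain ⟨K, hK⟩ := RealRAM.computesScheme_ball h
    have hp1 : 0 < p.toReal - 1 := by linarith [h.lt]
    have hm : 0 < 1 / (p.toReal - 1) := by positivity
    refine ⟨⌈5 + 4 * p.toReal⌉₊, ⌈1 / (p.toReal - 1)⌉₊, K, _, _, _,
      Nat.ceil_pos.2 (by linarith [h.pos]), fun d hd => isMirrorScheme_ball hq hq1 h
        (Nat.ceil_pos.2 hm) ?_ (Nat.le_ceil _) hd, hK⟩
    rw [← div_le_iff₀ hp1]
    exact Nat.le_ceil _

end

theorem theorem4 (p q : ℝ≥0∞) (hpq : p.HolderConjugate q) :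
    ∃ (c : RealRAM.Cmd) (P : MvPolynomial (Fin 5) ℕ),
      ∀ (d : ℕ) (ε γ η δ : ℝ), 0 < d → 0 < ε → 0 < γ → 0 ≤ η → η < 1 / 2 → 0 < δ → δ < 1 →
        ∃ (α : ℝ) (T : ℕ) (out : (ℕ → Example d) → (Fin d → ℝ)), 0 < α ∧ 0 < T ∧
          (∀ ω : ℕ → Example d, (∀ k, IsValid p (ω k)) →
            IsSMDOutput q (surrogateLoss ((ε * γ / 2 + η) / (1 + ε * γ)) γ) α T ω (out ω) ∧
            vecNorm q (out ω) ≤ 1 ∧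
            ∃ t : ℕ, (t : ℝ) ≤ polyBound P d ε γ η δ ∧
              RealRAM.Outputs c [ε, γ, η, δ, q.toReal] ω t T (out ω)) ∧
          ∀ (D : Measure (Example d)) [IsProbabilityMeasure D] (wstar : Fin d → ℝ),
            (∀ᵐ x ∂D.fst, vecNorm p x ≤ 1) → vecNorm q wstar ≤ 1 →
            (∀ᵐ x ∂D.fst, γ < |wstar ⬝ᵥ x|) → IsRCN D wstar η →
            Measure.infinitePi (fun _ : ℕ => D)
              {ω | ¬ marginError D (γ / 2) (out ω) ≤ η + ε} ≤ ENNReal.ofReal δ := by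
  obtain ⟨C, m, K, prep, proj, W, hC, hs, hprep⟩ := exists_mirrorScheme hpq
  obtain ⟨K', hK'⟩ := RealRAM.outputs_smdCmd hprep C m
  refine ⟨RealRAM.smdCmd prep C m, timePoly K' C m, fun d ε γ η δ hd hε hγ hη0 hη hδ0 hδ1 => ?_⟩
  have := Fact.mk hpq.symm.one_le
  have hR := roundBound_pos (m := m) hC hd hε hγ hη hδ0 hδ1
  have hT := Nat.ceil_pos.2 hR
  refine ⟨stepSize C m d ε γ η, ⌈roundBound C m d ε γ η δ⌉₊,
    smdOutput (proj d) (W d) C m ε γ η δ, stepSize_pos hC hd hε hγ hη, hT, fun ω _ => ⟨?_, ?_, ?_⟩,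
    fun D _ wstar hx hw hmargin hD => ?_⟩
  · exact (hs d hd).isSMDOutput _ _ _ _ _ hγ (lossWeight_le hε hγ hη)
  · exact vecNorm_average_le hT _ fun k => (hs d hd).vecNorm_primal_le _
  · obtain ⟨t, ht, hout⟩ := hK' d ε γ η δ ω
    refine ⟨t, ?_, hout⟩
    rw [polyBound_timePoly]
    have h1 := (Nat.ceil_lt_add_one hR.le).le
    calc (t : ℝ) ≤ K' * ((d + 1) * (⌈roundBound C m d ε γ η δ⌉₊ + 1)) := by exact_mod_cast ht
      _ ≤ K' * ((d + 1) * (roundBound C m d ε γ η δ + 2)) :=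
        mul_le_mul_of_nonneg_left (mul_le_mul_of_nonneg_left (by linarith) (by positivity))
          (by positivity)
  · exact (hs d hd).measure_marginError_le hpq hC hd hε hγ hη0 hη hδ0 hδ1 D hw hD ⟨hx, hmargin⟩
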